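/- **Conventions.** A *C\*-category* is a $\mathbb C$-linear category whose morphism spaces are Banach spaces, with a conjugate-linear contravariant involution $f\mapsto f^*$ fixing objects, such that $\|gf\|\le\|g\|\|f\|$, $\|f^*f\|=\|f\|^2$, and $f^*f$ is positive in $\mathrm{End}(X)$ (i.e. of the form $g^*g$ with $g\in\mathrm{End}(X)$) for every $f\colon X\to Y$. A morphism $u$ is *unitary* if $u^*u=\mathrm{id}$ and $uu^*=\mathrm{id}$. A *C\*-functor* is a linear functor preserving $*$. An object $X$ is *simple* if $\mathrm{End}(X)=\mathbb C\,\mathrm{id}_X\neq 0$. A C\*-category is *semi-simple* if it has finite direct sums (with isometric injections having mutually orthogonal ranges that sum to the identity) and every object is a finite direct sum of simple objects. A *tensor C\*-category* is a C\*-category with a (not necessarily strict) monoidal structure such that $\otimes$ is bilinear and $*$-preserving on morphisms and the associativity and unit isomorphisms are unitary; it is *rigid* if every object $U$ has a conjugate $V$, with morphisms $R\colon \mathbb 1\to V\otimes U$, $R'\colon\mathbb 1\to U\otimes V$ satisfying (up to coherence) $(R'^*\otimes \mathrm{id}_U)(\mathrm{id}_U\otimes R)=\mathrm{id}_U$ and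 $(R^*\otimes\mathrm{id}_V)(\mathrm{id}_V\otimes R')=\mathrm{id}_V$. Let $\mathcal C$ be a tensor C\*-category and $J$ a set. **Based modules.** A *$J$-based semi-simple $\mathcal C$-module C\*-category* is a semi-simple C\*-category $\mathcal D$ with a family $(X_r)_{r\in J}$ of simple objects, containing exactly one representative of each isomorphism class of simple objects, together with a functor $\odot\colon\mathcal C\times\mathcal D\to\mathcal D$, bilinear and $*$-preserving on morphisms, and natural unitaries $\varphi_{U,V,X}\colon (U\otimes V)\odot X\to U\odot(V\odot X)$ and $e_X\colon\mathbb 1\odot X\to X$ satisfying the pentagon and triangle identities. It is *banded* if for every $U\in\mathcal C$ $$\sup_{r\in J}\ \sum_{s\in J}\bigl(\dim\mathrm{Mor}(X_r,U\odot X_s)+\dim\mathrm{Mor}(X_s,U\odot X_r)\bigr)<\infty .$$ A *morphism* $\mathcal D\to\mathcal D'$ of based modules is a triple $(G,\psi,u)$ of a C\*-functor $G\colon\mathcal D\to\mathcal D'$, natural unitaries $\psi_{U,X}\colon G(U\odot X)\to U\odot G(X)$ compatible with $\varphi$ and $e$, and unitaries $u_r\colon G(X_r)\to X'_r$ $(r\in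 J)$. Two morphisms $(G,\psi,u)$ and $(G',\psi',u')$ are identified if there is a natural unitary $\theta\colon G\to G'$ with $\psi'_{U,X}\theta_{U\odot X}=(\mathrm{id}_U\odot\theta_X)\psi_{U,X}$ and $u'_r\theta_{X_r}=u_r$. Let $\mathbf{Mod}_J(\mathcal C)$ be the groupoid of banded based modules and such classes of morphisms. **Strong tensor functors.** Let $\mathcal E_f^J$ be the tensor C\*-category of $J\times J$-graded Hilbert spaces $H=\bigoplus_{r,s}H_{rs}$ with $\sup_{r}\sum_s(\dim H_{rs}+\dim H_{sr})<\infty$ and bounded grading-preserving operators, with tensor product $(H\otimes K)_{rt}=\bigoplus_s H_{rs}\otimes K_{st}$ and with unit $\ell^2(J)$, graded by $\delta_r\in\ell^2(J)_{rr}$. A *strong tensor C\*-functor* $F\colon\mathcal C\to\mathcal E_f^J$ is a C\*-functor with a strong monoidal structure whose structure maps $F(U)\otimes F(V)\to F(U\otimes V)$ and $\ell^2(J)\to F(\mathbb 1)$ are unitary. Let $\mathbf{Fun}(\mathcal C,\mathcal E_f^J)$ be the groupoid of strong tensor C\*-functors and monoidal natural unitary transformations. **Statement.** (a) If $\mathcal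 C$ is rigid or $J$ is finite, then every $J$-based semi-simple $\mathcal C$-module C\*-category is banded. (b) There is an equivalence of categories $\mathbf{Mod}_J(\mathcal C)\simeq\mathbf{Fun}(\mathcal C,\mathcal E_f^J)$ which, up to grading-preserving unitary identifications of the spaces $F(U)$, sends a based module $(\mathcal D,\odot,\varphi,e,(X_r)_r)$ to the functor $$F(U)=\bigoplus_{r,s\in J}\mathrm{Mor}(X_r,U\odot X_s),\qquad \langle f,g\rangle\,\mathrm{id}_{X_r}=f^*g,\qquad F(h)f=(h\odot\mathrm{id}_{X_s})f ,$$ with (unitary) tensor structure maps $F(U)\otimes F(V)\to F(U\otimes V)$ given on components by $$F_{rs}(U)\otimes F_{st}(V)\to F_{rt}(U\otimes V),\qquad f\otimes g\mapsto\varphi_{U,V,X_t}^*\,(\mathrm{id}_U\odot g)\,f ,$$ with unit structure map $\delta_r\mapsto e_{X_r}^*$, and which sends the class of a morphism $(G,\psi,u)$ to the monoidal natural unitary given on $\mathrm{Mor}(X_r,U\odot X_s)$ by $$f\mapsto(\mathrm{id}_U\odot u_s)\,\psi_{U,X_s}\,G(f)\,u_r^* .$$ -/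

import Mathlib

open CategoryTheory MonoidalCategory
open scoped TensorProduct MonoidalCategory.MonoidalLeftAction



universe u v u₁ v₁

/-- A C*-category: a `ℂ`-linear category whose morphism spaces are Banach spaces, with an antilinear
contravariant involution, such that the norm is submultiplicative, satisfies the C*-identity, and
every `f* f` is a positive element of the endomorphism algebra of the source of `f`.
Composition is written in diagrammatic order, so `f* f` is `f ≫ adj f`. -/
class CStarCategory (D : Type u) [Category.{v} D] where
  normedAddCommGroup : ∀ X Y : D, NormedAddCommGroup (X ⟶ Y)
  normedSpace : ∀ X Y : D, NormedSpace ℂ (X ⟶ Y)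
  completeSpace : ∀ X Y : D, CompleteSpace (X ⟶ Y)
  add_comp : ∀ {X Y Z : D} (f g : X ⟶ Y) (h : Y ⟶ Z), (f + g) ≫ h = f ≫ h + g ≫ h
  comp_add : ∀ {X Y Z : D} (f : X ⟶ Y) (g h : Y ⟶ Z), f ≫ (g + h) = f ≫ g + f ≫ h
  smul_comp : ∀ {X Y Z : D} (c : ℂ) (f : X ⟶ Y) (g : Y ⟶ Z), (c • f) ≫ g = c • (f ≫ g)
  comp_smul : ∀ {X Y Z : D} (c : ℂ) (f : X ⟶ Y) (g : Y ⟶ Z), f ≫ (c • g) = c • (f ≫ g)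
  norm_comp_le : ∀ {X Y Z : D} (f : X ⟶ Y) (g : Y ⟶ Z), ‖f ≫ g‖ ≤ ‖f‖ * ‖g‖
  adj : ∀ {X Y : D}, (X ⟶ Y) → (Y ⟶ X)
  adj_adj : ∀ {X Y : D} (f : X ⟶ Y), adj (adj f) = f
  adj_add : ∀ {X Y : D} (f g : X ⟶ Y), adj (f + g) = adj f + adj g
  adj_smul : ∀ {X Y : D} (c : ℂ) (f : X ⟶ Y), adj (c • f) = (starRingEnd ℂ c) • adj f
  adj_comp : ∀ {X Y Z : D} (f : X ⟶ Y) (g : Y ⟶ Z), adj (f ≫ g) = adj g ≫ adj f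
  norm_comp_adj : ∀ {X Y : D} (f : X ⟶ Y), ‖f ≫ adj f‖ = ‖f‖ ^ 2
  positive : ∀ {X Y : D} (f : X ⟶ Y), ∃ g : X ⟶ X, f ≫ adj f = g ≫ adj g

attribute [reducible, instance] CStarCategory.normedAddCommGroup CStarCategory.normedSpace
attribute [instance] CStarCategory.completeSpace

namespace CStarCategory

variable {D : Type u} [Category.{v} D] [CStarCategory D]

/-- A unitary morphism. -/
def IsUnitary {X Y : D} (f : X ⟶ Y) : Prop := f ≫ adj f = 𝟙 X ∧ adj f ≫ f = 𝟙 Y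

theorem adj_id (X : D) : adj (𝟙 X) = 𝟙 X := by
  have h1 := adj_comp (adj (𝟙 X)) (𝟙 X)
  rw [Category.comp_id, adj_adj, Category.comp_id] at h1
  exact h1.symm

theorem isUnitary_id (X : D) : IsUnitary (𝟙 X) :=
  ⟨by rw [adj_id, Category.comp_id], by rw [adj_id, Category.comp_id]⟩

theorem IsUnitary.comp {X Y Z : D} {f : X ⟶ Y} {g : Y ⟶ Z} (hf : IsUnitary f)
    (hg : IsUnitary g) : IsUnitary (f ≫ g) := by
  constructor
  · rw [adj_comp, Category.assoc, ← Category.assoc g, hg.1, Category.id_comp, hf.1]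
  · rw [adj_comp, Category.assoc, ← Category.assoc (adj f), hf.2, Category.id_comp, hg.2]

theorem isUnitary_of_adj_eq_inv {X Y : D} (e : X ≅ Y) (h : adj e.hom = e.inv) :
    IsUnitary e.hom := by
  constructor
  · rw [h, e.hom_inv_id]
  · rw [h, e.inv_hom_id]

/-- An object is simple if its endomorphism algebra is `ℂ`: every endomorphism is a scalar multiple
of the identity, for a unique scalar. -/
def IsSimple (X : D) : Prop := ∀ f : X ⟶ X, ∃! c : ℂ, f = c • 𝟙 X

/-- `X` is the (orthogonal) direct sum of the finite family `Y`, with isometric injections `v`. -/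
def IsDirectSum {n : ℕ} (Y : Fin n → D) (X : D) (v : ∀ i, Y i ⟶ X) : Prop :=
  (∀ i, v i ≫ adj (v i) = 𝟙 (Y i)) ∧ (∀ i j, i ≠ j → v i ≫ adj (v j) = 0) ∧
    ∑ i, adj (v i) ≫ v i = 𝟙 X

variable (D) in
/-- A C*-category is semi-simple if it admits finite direct sums and every object is a finite direct
sum of simple objects. -/
def IsSemisimple : Prop :=
  (∀ (n : ℕ) (Y : Fin n → D), ∃ (X : D) (v : ∀ i, Y i ⟶ X), IsDirectSum Y X v) ∧
    ∀ X : D, ∃ (n : ℕ) (Y : Fin n → D) (v : ∀ i, Y i ⟶ X),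
      (∀ i, IsSimple (Y i)) ∧ IsDirectSum Y X v

end CStarCategory

open CStarCategory

/-- A C*-functor: a linear functor that preserves the involution. -/
structure IsCStarFunctor {D : Type u} [Category.{v} D] [CStarCategory D] {E : Type u₁}
    [Category.{v₁} E] [CStarCategory E] (F : D ⥤ E) : Prop where
  map_add : ∀ {X Y : D} (f g : X ⟶ Y), F.map (f + g) = F.map f + F.map g
  map_smul : ∀ {X Y : D} (c : ℂ) (f : X ⟶ Y), F.map (c • f) = c • F.map f
  map_adj : ∀ {X Y : D} (f : X ⟶ Y), F.map (adj f) = adj (F.map f)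

theorem CStarCategory.IsUnitary.map {D : Type u} [Category.{v} D] [CStarCategory D] {E : Type u₁}
    [Category.{v₁} E] [CStarCategory E] {F : D ⥤ E} {X Y : D} {f : X ⟶ Y} (hf : IsUnitary f)
    (hF : IsCStarFunctor F) : IsUnitary (F.map f) := by
  constructor
  · rw [← hF.map_adj, ← F.map_comp, hf.1, F.map_id]
  · rw [← hF.map_adj, ← F.map_comp, hf.2, F.map_id]

/-- A (not necessarily strict) tensor C*-category: a C*-category with a monoidal structure whose
tensor product is bilinear and compatible with the involution, and whose coherence isomorphisms are
unitary. -/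
class TensorCStarCategory (C : Type u) [Category.{v} C] [CStarCategory C] [MonoidalCategory C] :
    Prop where
  whiskerLeft_add : ∀ (X : C) {Y Z : C} (f g : Y ⟶ Z), X ◁ (f + g) = X ◁ f + X ◁ g
  whiskerLeft_smul : ∀ (X : C) {Y Z : C} (c : ℂ) (f : Y ⟶ Z), X ◁ (c • f) = c • (X ◁ f)
  whiskerRight_add : ∀ {X Y : C} (f g : X ⟶ Y) (Z : C), (f + g) ▷ Z = f ▷ Z + g ▷ Z
  whiskerRight_smul : ∀ {X Y : C} (c : ℂ) (f : X ⟶ Y) (Z : C), (c • f) ▷ Z = c • (f ▷ Z)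
  adj_whiskerLeft : ∀ (X : C) {Y Z : C} (f : Y ⟶ Z), adj (X ◁ f) = X ◁ adj f
  adj_whiskerRight : ∀ {X Y : C} (f : X ⟶ Y) (Z : C), adj (f ▷ Z) = adj f ▷ Z
  associator_unitary : ∀ X Y Z : C, IsUnitary (α_ X Y Z).hom
  leftUnitor_unitary : ∀ X : C, IsUnitary (λ_ X).hom
  rightUnitor_unitary : ∀ X : C, IsUnitary (ρ_ X).hom

/-- A tensor C*-category is rigid if every object `U` admits a conjugate `V`, by morphisms
`R : 𝟙 ⟶ V ⊗ U` and `R' : 𝟙 ⟶ U ⊗ V` that satisfy the conjugate equations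
`(R'* ⊗ id_U) (id_U ⊗ R) = id_U` and `(R* ⊗ id_V) (id_V ⊗ R') = id_V`. -/
def IsRigidCStar (C : Type u) [Category.{v} C] [CStarCategory C] [MonoidalCategory C] : Prop :=
  ∀ U : C, ∃ (V : C) (R : 𝟙_ C ⟶ V ⊗ U) (R' : 𝟙_ C ⟶ U ⊗ V),
    (ρ_ U).inv ≫ U ◁ R ≫ (α_ U V U).inv ≫ adj R' ▷ U ≫ (λ_ U).hom = 𝟙 U ∧
    (ρ_ V).inv ≫ V ◁ R' ≫ (α_ V U V).inv ≫ adj R ▷ V ≫ (λ_ V).hom = 𝟙 V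

/-- A strong tensor C*-functor: a C*-functor with a strong monoidal structure whose structure
morphisms `𝟙 ⟶ F 𝟙` and `F U ⊗ F V ⟶ F (U ⊗ V)` are unitary. -/
structure StrongTensorFunctor (C : Type u) [Category.{v} C] [CStarCategory C] [MonoidalCategory C]
    [TensorCStarCategory C] (E : Type u₁) [Category.{v₁} E] [CStarCategory E] [MonoidalCategory E]
    [TensorCStarCategory E] where
  functor : C ⥤ E
  isCStar : IsCStarFunctor functor
  [monoidal : functor.Monoidal]
  ε_unitary : IsUnitary (Functor.LaxMonoidal.ε functor)
  μ_unitary : ∀ U V : C, IsUnitary (Functor.LaxMonoidal.μ functor U V)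

namespace StrongTensorFunctor

attribute [instance] StrongTensorFunctor.monoidal

variable {C : Type u} [Category.{v} C] [CStarCategory C] [MonoidalCategory C]
  [TensorCStarCategory C] {E : Type u₁} [Category.{v₁} E] [CStarCategory E] [MonoidalCategory E]
  [TensorCStarCategory E]

/-- A monoidal natural unitary transformation between strong tensor C*-functors. -/
@[ext]
structure Hom (F G : StrongTensorFunctor C E) where
  natTrans : F.functor ⟶ G.functor
  isMonoidal : NatTrans.IsMonoidal natTrans
  unitary : ∀ U, IsUnitary (natTrans.app U)

/-- The groupoid of strong tensor C*-functors and monoidal natural unitary transformations. -/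
instance : Category (StrongTensorFunctor C E) where
  Hom := Hom
  id F := ⟨𝟙 F.functor, inferInstance, fun _ => isUnitary_id _⟩
  comp a b :=
    ⟨a.natTrans ≫ b.natTrans,
      haveI := a.isMonoidal
      haveI := b.isMonoidal
      inferInstance, fun U => (a.unitary U).comp (b.unitary U)⟩
  id_comp a := Hom.ext (Category.id_comp a.natTrans)
  comp_id a := Hom.ext (Category.comp_id a.natTrans)
  assoc a b c := Hom.ext (Category.assoc a.natTrans b.natTrans c.natTrans)

end StrongTensorFunctor

/-- A `C`-module C*-category: a C*-category `D` with an action functor `C × D ⥤ D` that is bilinear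
and compatible with the involution, and with unitary coherence isomorphisms
`(U ⊗ V) ⊙ₗ X ≅ U ⊙ₗ V ⊙ₗ X` and `𝟙 ⊙ₗ X ≅ X` (satisfying the pentagon and triangle identities,
which are part of `MonoidalLeftAction`). -/
class ModuleCStarCategory (C : Type u₁) [Category.{v₁} C] [CStarCategory C] [MonoidalCategory C]
    (D : Type u) [Category.{v} D] [CStarCategory D] [MonoidalLeftAction C D] : Prop where
  actionHomLeft_add : ∀ {U V : C} (f g : U ⟶ V) (X : D), (f + g) ⊵ₗ X = f ⊵ₗ X + g ⊵ₗ X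
  actionHomLeft_smul : ∀ {U V : C} (c : ℂ) (f : U ⟶ V) (X : D), (c • f) ⊵ₗ X = c • (f ⊵ₗ X)
  actionHomRight_add : ∀ (U : C) {X Y : D} (f g : X ⟶ Y), U ⊴ₗ (f + g) = U ⊴ₗ f + U ⊴ₗ g
  actionHomRight_smul : ∀ (U : C) {X Y : D} (c : ℂ) (f : X ⟶ Y), U ⊴ₗ (c • f) = c • (U ⊴ₗ f)
  adj_actionHomLeft : ∀ {U V : C} (f : U ⟶ V) (X : D), adj (f ⊵ₗ X) = adj f ⊵ₗ X
  adj_actionHomRight : ∀ (U : C) {X Y : D} (f : X ⟶ Y), adj (U ⊴ₗ f) = U ⊴ₗ adj f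
  assoc_unitary : ∀ (U V : C) (X : D), IsUnitary (αₗ U V X).hom
  unit_unitary : ∀ X : D, IsUnitary (MonoidalLeftActionStruct.actionUnitIso (C := C) X).hom

/-- A semi-simple `C`-module C*-category based on the set `J`: its simple objects are represented,
without repetition up to isomorphism, by a family of objects `X r`, `r : J`. -/
structure BasedModule (C : Type u₁) [Category.{v₁} C] [CStarCategory C] [MonoidalCategory C]
    (J : Type v) : Type (max (u + 1) (v + 1) u₁ v₁) where
  carrier : Type (max u v)
  [category : Category.{v} carrier]
  [cstar : CStarCategory carrier]
  [action : MonoidalLeftAction C carrier]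
  [moduleCStar : ModuleCStarCategory C carrier]
  semisimple : IsSemisimple carrier
  X : J → carrier
  simple : ∀ r, IsSimple (X r)
  eq_of_iso : ∀ r s, Nonempty (X r ≅ X s) → r = s
  exists_iso : ∀ Y : carrier, IsSimple Y → ∃ r, Nonempty (Y ≅ X r)

namespace BasedModule

attribute [instance] BasedModule.category BasedModule.cstar BasedModule.action
attribute [instance] BasedModule.moduleCStar

variable {C : Type u₁} [Category.{v₁} C] [CStarCategory C] [MonoidalCategory C] {J : Type v}

/-- The grading of `⨁ Mor(X r, U ⊙ X s)` is banded, for every object `U` of `C`. -/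
def IsBanded (M : BasedModule.{u} C J) : Prop :=
  ∀ U : C, ∃ N : ℕ, ∀ (r : J) (S : Finset J),
    ∑ s ∈ S, (Module.finrank ℂ (M.X r ⟶ U ⊙ₗ M.X s) +
      Module.finrank ℂ (M.X s ⟶ U ⊙ₗ M.X r)) ≤ N

/-- A morphism of based module C*-categories: a `C`-module homomorphism `(functor, ψ)` together with
unitary isomorphisms `u r` from the image of the `r`-th simple object to the `r`-th simple object. -/
structure Hom (M N : BasedModule.{u} C J) where
  functor : M.carrier ⥤ N.carrier
  isCStar : IsCStarFunctor functor
  ψ : ∀ (U : C) (X : M.carrier), functor.obj (U ⊙ₗ X) ⟶ U ⊙ₗ functor.obj X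
  ψ_unitary : ∀ (U : C) (X : M.carrier), IsUnitary (ψ U X)
  ψ_naturality_left : ∀ {U V : C} (f : U ⟶ V) (X : M.carrier),
    functor.map (f ⊵ₗ X) ≫ ψ V X = ψ U X ≫ f ⊵ₗ functor.obj X
  ψ_naturality_right : ∀ (U : C) {X Y : M.carrier} (f : X ⟶ Y),
    functor.map (U ⊴ₗ f) ≫ ψ U Y = ψ U X ≫ U ⊴ₗ functor.map f
  ψ_unit : ∀ X : M.carrier,
    ψ (𝟙_ C) X ≫ (MonoidalLeftActionStruct.actionUnitIso (C := C) (functor.obj X)).hom =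
      functor.map (MonoidalLeftActionStruct.actionUnitIso (C := C) X).hom
  ψ_tensor : ∀ (U V : C) (X : M.carrier),
    functor.map (αₗ U V X).hom ≫ ψ U (V ⊙ₗ X) ≫ U ⊴ₗ ψ V X =
      ψ (U ⊗ V) X ≫ (αₗ U V (functor.obj X)).hom
  u : ∀ r, functor.obj (M.X r) ⟶ N.X r
  u_unitary : ∀ r, IsUnitary (u r)

/-- The identity morphism. -/
def Hom.id (M : BasedModule.{u} C J) : Hom M M where
  functor := 𝟭 M.carrier
  isCStar := ⟨fun _ _ => rfl, fun _ _ => rfl, fun _ => rfl⟩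
  ψ U X := 𝟙 (U ⊙ₗ X)
  ψ_unitary U X := isUnitary_id _
  ψ_naturality_left f X := by simp
  ψ_naturality_right U f := by simp
  ψ_unit X := by simp
  ψ_tensor U V X := by simp
  u r := 𝟙 (M.X r)
  u_unitary r := isUnitary_id _

/-- The composition of morphisms. -/
def Hom.comp {M N P : BasedModule.{u} C J} (g : Hom M N) (h : Hom N P) : Hom M P where
  functor := g.functor ⋙ h.functor
  isCStar :=
    ⟨fun a b => by simp [g.isCStar.map_add, h.isCStar.map_add],
      fun c a => by simp [g.isCStar.map_smul, h.isCStar.map_smul],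
      fun a => by simp [g.isCStar.map_adj, h.isCStar.map_adj]⟩
  ψ U X := h.functor.map (g.ψ U X) ≫ h.ψ U (g.functor.obj X)
  ψ_unitary U X := ((g.ψ_unitary U X).map h.isCStar).comp (h.ψ_unitary U _)
  ψ_naturality_left f X := by
    simp only [Functor.comp_map, Functor.comp_obj, Category.assoc]
    rw [← Category.assoc, ← h.functor.map_comp, g.ψ_naturality_left, h.functor.map_comp,
      Category.assoc, h.ψ_naturality_left]
  ψ_naturality_right U X Y f := by
    simp only [Functor.comp_map, Functor.comp_obj, Category.assoc]
    rw [← Category.assoc, ← h.functor.map_comp, g.ψ_naturality_right, h.functor.map_comp,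
      Category.assoc, h.ψ_naturality_right]
  ψ_unit X := by
    simp only [Functor.comp_map, Functor.comp_obj, Category.assoc]
    rw [h.ψ_unit, ← h.functor.map_comp, g.ψ_unit]
  ψ_tensor U V X := by
    simp only [Functor.comp_map, Functor.comp_obj, Category.assoc,
      MonoidalLeftAction.actionHomRight_comp]
    rw [← h.ψ_tensor, ← Category.assoc (h.functor.map (g.ψ (U ⊗ V) X)), ← h.functor.map_comp,
      ← g.ψ_tensor, h.functor.map_comp, h.functor.map_comp, Category.assoc, Category.assoc,
      ← Category.assoc (h.ψ U _), ← h.ψ_naturality_right, Category.assoc]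
  u r := h.functor.map (g.u r) ≫ h.u r
  u_unitary r := ((g.u_unitary r).map h.isCStar).comp (h.u_unitary r)

/-- Two morphisms are identified if they are related by a natural unitary transformation that is
compatible with the module structures and with the bases. -/
def Hom.Rel {M N : BasedModule.{u} C J} (g h : Hom M N) : Prop :=
  ∃ θ : g.functor ⟶ h.functor, (∀ X, IsUnitary (θ.app X)) ∧
    (∀ (U : C) (X : M.carrier), θ.app (U ⊙ₗ X) ≫ h.ψ U X = g.ψ U X ≫ U ⊴ₗ θ.app X) ∧
    ∀ r, θ.app (M.X r) ≫ h.u r = g.u r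

theorem Hom.Rel.refl {M N : BasedModule.{u} C J} (g : Hom M N) : g.Rel g :=
  ⟨𝟙 _, fun _ => isUnitary_id _, fun U X => by simp, fun r => by simp⟩

theorem Hom.Rel.symm {M N : BasedModule.{u} C J} {g h : Hom M N} : g.Rel h → h.Rel g := by
  rintro ⟨θ, h1, h2, h3⟩
  have e1 : ∀ X, adj (θ.app X) ≫ θ.app X = 𝟙 _ := fun X => (h1 X).2
  have e2 : ∀ X, θ.app X ≫ adj (θ.app X) = 𝟙 _ := fun X => (h1 X).1
  refine ⟨⟨fun X => adj (θ.app X), fun X Y f => ?_⟩, fun X => ⟨?_, ?_⟩, fun U X => ?_, fun r => ?_⟩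
  · calc h.functor.map f ≫ adj (θ.app Y)
        = (adj (θ.app X) ≫ θ.app X) ≫ h.functor.map f ≫ adj (θ.app Y) := by
          rw [e1, Category.id_comp]
      _ = adj (θ.app X) ≫ g.functor.map f ≫ θ.app Y ≫ adj (θ.app Y) := by
          simp only [Category.assoc, NatTrans.naturality_assoc]
      _ = adj (θ.app X) ≫ g.functor.map f := by rw [e2, Category.comp_id]
  · rw [adj_adj]; exact e1 X
  · rw [adj_adj]; exact e2 X
  · have e3 : U ⊴ₗ θ.app X ≫ U ⊴ₗ adj (θ.app X) = 𝟙 _ := by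
      rw [← MonoidalLeftAction.actionHomRight_comp, e2, MonoidalLeftAction.actionHomRight_id]
    calc adj (θ.app (U ⊙ₗ X)) ≫ g.ψ U X
        = adj (θ.app (U ⊙ₗ X)) ≫ (g.ψ U X ≫ U ⊴ₗ θ.app X) ≫ U ⊴ₗ adj (θ.app X) := by
          rw [Category.assoc, e3, Category.comp_id]
      _ = (adj (θ.app (U ⊙ₗ X)) ≫ θ.app (U ⊙ₗ X)) ≫ h.ψ U X ≫ U ⊴ₗ adj (θ.app X) := by
          rw [← h2]; simp only [Category.assoc]
      _ = h.ψ U X ≫ U ⊴ₗ adj (θ.app X) := by rw [e1, Category.id_comp]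
  · change adj (θ.app (M.X r)) ≫ g.u r = h.u r
    rw [← h3, ← Category.assoc, e1, Category.id_comp]

theorem Hom.Rel.trans {M N : BasedModule.{u} C J} {g h k : Hom M N} :
    g.Rel h → h.Rel k → g.Rel k := by
  rintro ⟨θ, h1, h2, h3⟩ ⟨η, k1, k2, k3⟩
  refine ⟨θ ≫ η, fun X => (h1 X).comp (k1 X), fun U X => ?_, fun r => ?_⟩
  · rw [NatTrans.comp_app, NatTrans.comp_app, Category.assoc, k2, ← Category.assoc, h2,
      Category.assoc, MonoidalLeftAction.actionHomRight_comp]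
  · rw [NatTrans.comp_app, Category.assoc, k3, h3]

theorem Hom.Rel.comp {M N P : BasedModule.{u} C J} {g g' : Hom M N} {h h' : Hom N P} :
    g.Rel g' → h.Rel h' → (g.comp h).Rel (g'.comp h') := by
  rintro ⟨θ, h1, h2, h3⟩ ⟨η, k1, k2, k3⟩
  refine ⟨Functor.whiskerRight θ h.functor ≫ Functor.whiskerLeft g'.functor η,
    fun X => ((h1 X).map h.isCStar).comp (k1 _), fun U X => ?_, fun r => ?_⟩
  · change (h.functor.map (θ.app (U ⊙ₗ X)) ≫ η.app (g'.functor.obj (U ⊙ₗ X))) ≫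
        h'.functor.map (g'.ψ U X) ≫ h'.ψ U (g'.functor.obj X) =
      (h.functor.map (g.ψ U X) ≫ h.ψ U (g.functor.obj X)) ≫
        U ⊴ₗ (h.functor.map (θ.app X) ≫ η.app (g'.functor.obj X))
    rw [MonoidalLeftAction.actionHomRight_comp, Category.assoc, Category.assoc,
      ← NatTrans.naturality_assoc, k2, ← Category.assoc, ← h.functor.map_comp, h2,
      h.functor.map_comp, Category.assoc, ← Category.assoc (h.functor.map (U ⊴ₗ θ.app X)),
      h.ψ_naturality_right, Category.assoc]
  · change (h.functor.map (θ.app (M.X r)) ≫ η.app (g'.functor.obj (M.X r))) ≫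
        h'.functor.map (g'.u r) ≫ h'.u r = h.functor.map (g.u r) ≫ h.u r
    rw [Category.assoc, ← NatTrans.naturality_assoc, k3, ← Category.assoc, ← h.functor.map_comp, h3]

/-- Morphisms of based module C*-categories, up to natural unitary isomorphism. -/
def homSetoid (M N : BasedModule.{u} C J) : Setoid (Hom M N) where
  r := Hom.Rel
  iseqv := ⟨Hom.Rel.refl, Hom.Rel.symm, Hom.Rel.trans⟩

/-- Isomorphism classes of morphisms of based module C*-categories. -/
def HomClass (M N : BasedModule.{u} C J) := Quotient (homSetoid M N)

/-- The class of a morphism. -/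
def Hom.toClass {M N : BasedModule.{u} C J} (g : Hom M N) : HomClass M N :=
  Quotient.mk (homSetoid M N) g

/-- The composition of classes of morphisms. -/
def HomClass.comp {M N P : BasedModule.{u} C J} (a : HomClass M N) (b : HomClass N P) :
    HomClass M P :=
  Quotient.map₂ Hom.comp (fun _ _ h _ _ h' => Hom.Rel.comp h h') a b

end BasedModule

/-- A based semi-simple module C*-category such that the gradings of
`⨁ Mor(X r, U ⊙ X s)` are banded. -/
structure BandedModule (C : Type u₁) [Category.{v₁} C] [CStarCategory C] [MonoidalCategory C]
    (J : Type v) : Type (max (u + 1) (v + 1) u₁ v₁) extends BasedModule.{u} C J where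
  banded : toBasedModule.IsBanded

namespace BandedModule

variable {C : Type u₁} [Category.{v₁} C] [CStarCategory C] [MonoidalCategory C] {J : Type v}

/-- The groupoid of banded based module C*-categories, with the isomorphism classes of morphisms of
based module C*-categories as morphisms. -/
instance : Category (BandedModule.{u} C J) where
  Hom M N := BasedModule.HomClass M.toBasedModule N.toBasedModule
  id M := (BasedModule.Hom.id M.toBasedModule).toClass
  comp a b := BasedModule.HomClass.comp a b
  id_comp a := by
    induction a using Quotient.inductionOn with
    | _ g => exact Quotient.sound ⟨⟨fun X => 𝟙 _, fun X Y f => by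
        simp [BasedModule.Hom.comp, BasedModule.Hom.id]⟩, fun X => isUnitary_id _, fun U X => by
        simp [BasedModule.Hom.comp, BasedModule.Hom.id], fun r => by
        simp [BasedModule.Hom.comp, BasedModule.Hom.id]⟩
  comp_id a := by
    induction a using Quotient.inductionOn with
    | _ g => exact Quotient.sound ⟨⟨fun X => 𝟙 _, fun X Y f => by
        simp [BasedModule.Hom.comp, BasedModule.Hom.id]⟩, fun X => isUnitary_id _, fun U X => by
        simp [BasedModule.Hom.comp, BasedModule.Hom.id], fun r => by
        simp [BasedModule.Hom.comp, BasedModule.Hom.id]⟩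
  assoc a b c := by
    induction a using Quotient.inductionOn with
    | _ g =>
    induction b using Quotient.inductionOn with
    | _ h =>
    induction c using Quotient.inductionOn with
    | _ k => exact Quotient.sound ⟨⟨fun X => 𝟙 _, fun X Y f => by
        simp [BasedModule.Hom.comp]⟩, fun X => isUnitary_id _, fun U X => by
        simp [BasedModule.Hom.comp], fun r => by
        simp [BasedModule.Hom.comp]⟩

end BandedModule

/-- A `J × J`-graded Hilbert space with banded grading (an object of `E_f^J`), given by its homogeneous
components: `sup_r ∑_s (dim H_rs + dim H_sr) < ∞`. -/
structure BiHilb (J : Type v) : Type (v + 1) where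
  comp : J → J → Type v
  [normed : ∀ r s, NormedAddCommGroup (comp r s)]
  [innerProd : ∀ r s, InnerProductSpace ℂ (comp r s)]
  [finite : ∀ r s, FiniteDimensional ℂ (comp r s)]
  banded : ∃ N : ℕ, ∀ (r : J) (S : Finset J),
    ∑ s ∈ S, (Module.finrank ℂ (comp r s) + Module.finrank ℂ (comp s r)) ≤ N

namespace BiHilb

attribute [instance] BiHilb.normed BiHilb.innerProd
attribute [instance] BiHilb.finite

variable {J : Type v}

instance (H : BiHilb J) (r s : J) : CompleteSpace (H.comp r s) := FiniteDimensional.complete ℂ _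

abbrev Hom (H K : BiHilb J) : Type v :=
  lp (fun p : J × J => H.comp p.1 p.2 →L[ℂ] K.comp p.1 p.2) ⊤

def Hom.ofBound {H K : BiHilb J} (T : ∀ r s, H.comp r s →L[ℂ] K.comp r s) (c : ℝ)
    (h : ∀ r s, ‖T r s‖ ≤ c) : Hom H K :=
  ⟨fun p => T p.1 p.2, memℓp_infty ⟨c, by rintro _ ⟨p, rfl⟩; exact h p.1 p.2⟩⟩

theorem Hom.norm_apply_le {H K : BiHilb J} (T : Hom H K) (p : J × J) : ‖T.1 p‖ ≤ ‖T‖ :=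
  lp.norm_apply_le_norm ENNReal.top_ne_zero T p

theorem Hom.norm_comp_apply_le {H K L : BiHilb J} (T : Hom H K) (S : Hom K L) (r s : J) :
    ‖(S.1 (r, s)).comp (T.1 (r, s))‖ ≤ ‖S‖ * ‖T‖ :=
  (ContinuousLinearMap.opNorm_comp_le _ _).trans
    (mul_le_mul (Hom.norm_apply_le S (r, s)) (Hom.norm_apply_le T (r, s))
      (norm_nonneg _) (norm_nonneg _))

noncomputable def Hom.id (H : BiHilb J) : Hom H H :=
  Hom.ofBound (fun r s => ContinuousLinearMap.id ℂ (H.comp r s)) 1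
    (fun _ _ => ContinuousLinearMap.norm_id_le)

noncomputable def Hom.comp {H K L : BiHilb J} (T : Hom H K) (S : Hom K L) : Hom H L :=
  Hom.ofBound (fun r s => (S.1 (r, s)).comp (T.1 (r, s))) (‖S‖ * ‖T‖)
    (Hom.norm_comp_apply_le T S)

theorem Hom.ext' {H K : BiHilb J} {T S : Hom H K}
    (h : ∀ r s x, T.1 (r, s) x = S.1 (r, s) x) : T = S :=
  Subtype.ext (funext fun p => ContinuousLinearMap.ext fun x => h p.1 p.2 x)

theorem Hom.id_comp {H K : BiHilb J} (T : Hom H K) : (Hom.id H).comp T = T :=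
  Hom.ext' fun _ _ _ => rfl

theorem Hom.comp_id {H K : BiHilb J} (T : Hom H K) : T.comp (Hom.id K) = T :=
  Hom.ext' fun _ _ _ => rfl

theorem Hom.assoc {H K L M : BiHilb J} (T : Hom H K) (S : Hom K L) (R : Hom L M) :
    (T.comp S).comp R = T.comp (S.comp R) := Hom.ext' fun _ _ _ => rfl

noncomputable instance : Category (BiHilb J) where
  Hom := Hom
  id := Hom.id
  comp := Hom.comp
  id_comp := Hom.id_comp
  comp_id := Hom.comp_id
  assoc := Hom.assoc

/-- The component of a morphism in degree `(r, s)`. -/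
def app {H K : BiHilb J} (T : H ⟶ K) (r s : J) : H.comp r s →L[ℂ] K.comp r s := T.1 (r, s)

def mkHom {H K : BiHilb J} (T : ∀ r s, H.comp r s →L[ℂ] K.comp r s) (c : ℝ)
    (h : ∀ r s, ‖T r s‖ ≤ c) : H ⟶ K := Hom.ofBound T c h

theorem hom_ext {H K : BiHilb J} {T S : H ⟶ K} (h : ∀ r s, app T r s = app S r s) : T = S :=
  Subtype.ext (funext fun p => h p.1 p.2)

theorem hom_ext' {H K : BiHilb J} {T S : H ⟶ K} (h : ∀ r s x, app T r s x = app S r s x) : T = S :=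
  hom_ext fun r s => ContinuousLinearMap.ext (h r s)

@[simp] theorem app_mkHom {H K : BiHilb J} (T : ∀ r s, H.comp r s →L[ℂ] K.comp r s) (c : ℝ)
    (h : ∀ r s, ‖T r s‖ ≤ c) (r s : J) : app (mkHom T c h) r s = T r s := rfl

@[simp] theorem app_id (H : BiHilb J) (r s : J) : app (𝟙 H) r s = ContinuousLinearMap.id ℂ _ := rfl

@[simp] theorem app_comp {H K L : BiHilb J} (T : H ⟶ K) (S : K ⟶ L) (r s : J) :
    app (T ≫ S) r s = (app S r s).comp (app T r s) := rfl

noncomputable instance (H K : BiHilb J) : NormedAddCommGroup (H ⟶ K) :=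
  inferInstanceAs (NormedAddCommGroup (Hom H K))

noncomputable instance (H K : BiHilb J) : NormedSpace ℂ (H ⟶ K) :=
  inferInstanceAs (NormedSpace ℂ (Hom H K))

@[simp] theorem app_add {H K : BiHilb J} (T S : H ⟶ K) (r s : J) :
    app (T + S) r s = app T r s + app S r s := rfl

@[simp] theorem app_smul {H K : BiHilb J} (c : ℂ) (T : H ⟶ K) (r s : J) :
    app (c • T) r s = c • app T r s := rfl

theorem norm_app_le {H K : BiHilb J} (T : H ⟶ K) (r s : J) : ‖app T r s‖ ≤ ‖T‖ :=
  lp.norm_apply_le_norm (f := (T : Hom H K)) (by simp) (r, s)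

theorem norm_le {H K : BiHilb J} (T : H ⟶ K) {c : ℝ} (hc : 0 ≤ c)
    (h : ∀ r s, ‖app T r s‖ ≤ c) : ‖T‖ ≤ c :=
  lp.norm_le_of_forall_le (f := (T : Hom H K)) hc (fun p => h p.1 p.2)

noncomputable instance : CStarCategory (BiHilb J) where
  normedAddCommGroup := inferInstance
  normedSpace := inferInstance
  completeSpace H K := inferInstanceAs (CompleteSpace (Hom H K))
  add_comp f g h := hom_ext fun r s => by simp
  comp_add f g h := hom_ext fun r s => by simp
  smul_comp c f g := hom_ext fun r s => by simp
  comp_smul c f g := hom_ext fun r s => by simp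
  norm_comp_le f g := norm_le _ (by positivity) fun r s => by
    rw [mul_comm]
    exact (ContinuousLinearMap.opNorm_comp_le _ _).trans
      (mul_le_mul (norm_app_le g r s) (norm_app_le f r s) (norm_nonneg _) (norm_nonneg _))
  adj T := mkHom (fun r s => ContinuousLinearMap.adjoint (app T r s)) ‖T‖
    (fun r s => by rw [LinearIsometryEquiv.norm_map]; exact norm_app_le T r s)
  adj_adj f := hom_ext fun r s => by simp
  adj_add f g := hom_ext fun r s => by simp
  adj_smul c f := hom_ext fun r s => by
    simp only [app_mkHom, app_smul, map_smulₛₗ]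
  adj_comp f g := hom_ext fun r s => by simp [ContinuousLinearMap.adjoint_comp]
  norm_comp_adj f := by
    apply le_antisymm
    · refine norm_le _ (by positivity) fun r s => ?_
      rw [app_comp, app_mkHom, ContinuousLinearMap.norm_adjoint_comp_self, sq]
      gcongr <;> exact norm_app_le f r s
    · refine (Real.le_sqrt (norm_nonneg _) (norm_nonneg _)).1 ?_
      refine norm_le _ (Real.sqrt_nonneg _) fun r s => ?_
      refine (Real.le_sqrt (norm_nonneg _) (norm_nonneg _)).2 ?_
      rw [sq, ← ContinuousLinearMap.norm_adjoint_comp_self]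
      exact norm_app_le (f ≫ mkHom (fun r s => ContinuousLinearMap.adjoint (app f r s)) ‖f‖
        (fun r s => by rw [LinearIsometryEquiv.norm_map]; exact norm_app_le f r s)) r s
  positive {H K} f := by
    have key : ∀ r s, ∃ g : H.comp r s →L[ℂ] H.comp r s,
        (ContinuousLinearMap.adjoint (app f r s)).comp (app f r s) =
          (ContinuousLinearMap.adjoint g).comp g := fun r s => by
      have h0 : 0 ≤ (ContinuousLinearMap.adjoint (app f r s)).comp (app f r s) :=
        (ContinuousLinearMap.nonneg_iff_isPositive _).2
          (ContinuousLinearMap.isPositive_adjoint_comp_self _)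
      refine ⟨CFC.sqrt ((ContinuousLinearMap.adjoint (app f r s)).comp (app f r s)), ?_⟩
      have h1 := CFC.sqrt_mul_sqrt_self _ h0
      have h2 : IsSelfAdjoint
          (CFC.sqrt ((ContinuousLinearMap.adjoint (app f r s)).comp (app f r s))) :=
        IsSelfAdjoint.of_nonneg (CFC.sqrt_nonneg _)
      rw [← ContinuousLinearMap.star_eq_adjoint
        (CFC.sqrt ((ContinuousLinearMap.adjoint (app f r s)).comp (app f r s))), h2.star_eq]
      exact h1.symm
    choose g hg using key
    have hn : ∀ r s, ‖g r s‖ ≤ ‖f‖ := fun r s => by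
      have h1 := congrArg norm (hg r s)
      rw [ContinuousLinearMap.norm_adjoint_comp_self,
        ContinuousLinearMap.norm_adjoint_comp_self] at h1
      have h2 := norm_app_le f r s
      nlinarith [norm_nonneg (g r s), norm_nonneg (app f r s), norm_nonneg f]
    exact ⟨mkHom g ‖f‖ hn, hom_ext fun r s => hg r s⟩

@[simp] theorem app_adj {H K : BiHilb J} (T : H ⟶ K) (r s : J) :
    app (CStarCategory.adj T) r s = ContinuousLinearMap.adjoint (app T r s) := rfl


theorem exists_row_bound (H : BiHilb J) : ∃ N : ℕ, ∀ (r : J) (S : Finset J),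
    ∑ s ∈ S, Module.finrank ℂ (H.comp r s) ≤ N := by
  obtain ⟨N, hN⟩ := H.banded
  exact ⟨N, fun r S => (Finset.sum_le_sum fun s _ => Nat.le_add_right _ _).trans (hN r S)⟩

theorem exists_col_bound (H : BiHilb J) : ∃ N : ℕ, ∀ (r : J) (S : Finset J),
    ∑ s ∈ S, Module.finrank ℂ (H.comp s r) ≤ N := by
  obtain ⟨N, hN⟩ := H.banded
  exact ⟨N, fun r S => (Finset.sum_le_sum fun s _ => Nat.le_add_left _ _).trans (hN r S)⟩

theorem row_finite (H : BiHilb J) (r : J) : {s | Module.finrank ℂ (H.comp r s) ≠ 0}.Finite := by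
  obtain ⟨N, hN⟩ := H.exists_row_bound
  by_contra h
  obtain ⟨S, hS, hc⟩ := Set.Infinite.exists_subset_card_eq h (N + 1)
  have h1 := Finset.card_nsmul_le_sum S (fun s => Module.finrank ℂ (H.comp r s)) 1
    (fun s hs => Nat.one_le_iff_ne_zero.2 (hS hs))
  have h2 := hN r S
  simp only [smul_eq_mul, mul_one] at h1
  omega

noncomputable def row (H : BiHilb J) (r : J) : Finset J := (H.row_finite r).toFinset

theorem eq_zero_of_notMem_row (H : BiHilb J) {r s : J} (h : s ∉ H.row r) (x : H.comp r s) :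
    x = 0 := by
  have h1 : Module.finrank ℂ (H.comp r s) = 0 := by simpa [row] using h
  have := Module.finrank_zero_iff.1 h1
  exact Subsingleton.elim _ _

theorem tmul_eq_zero_of_notMem_row (H K : BiHilb J) {r s t : J} (h : s ∉ H.row r)
    (x : H.comp r s ⊗[ℂ] K.comp s t) : x = 0 := by
  induction x with
  | zero => rfl
  | tmul a b => rw [H.eq_zero_of_notMem_row h a, TensorProduct.zero_tmul]
  | add a b ha hb => rw [ha, hb, add_zero]

/-- The component `⨁ₛ H r s ⊗ K s t` (Hilbert space direct sum) of the tensor product. -/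
abbrev TComp (H K : BiHilb J) (r t : J) : Type v :=
  lp (fun s => H.comp r s ⊗[ℂ] K.comp s t) 2

noncomputable def TComp.restrict (H K : BiHilb J) (r t : J) :
    TComp H K r t →ₗ[ℂ] (∀ s : H.row r, H.comp r s ⊗[ℂ] K.comp s t) where
  toFun z s := z.1 s
  map_add' _ _ := rfl
  map_smul' _ _ := rfl

theorem TComp.restrict_injective (H K : BiHilb J) (r t : J) :
    Function.Injective (TComp.restrict H K r t) := by
  intro z w h
  ext s
  by_cases hs : s ∈ H.row r
  · exact congrFun h ⟨s, hs⟩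
  · rw [tmul_eq_zero_of_notMem_row H K hs (z s), tmul_eq_zero_of_notMem_row H K hs (w s)]

instance (H K : BiHilb J) (r t : J) : FiniteDimensional ℂ (TComp H K r t) :=
  FiniteDimensional.of_injective _ (TComp.restrict_injective H K r t)

theorem TComp.finrank_le (H K : BiHilb J) (r t : J) : Module.finrank ℂ (TComp H K r t) ≤
    ∑ s ∈ H.row r, Module.finrank ℂ (H.comp r s) * Module.finrank ℂ (K.comp s t) := by
  refine (LinearMap.finrank_le_finrank_of_injective (TComp.restrict_injective H K r t)).trans ?_
  rw [Module.finrank_pi_fintype,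
    ← Finset.sum_coe_sort (H.row r) (fun s => Module.finrank ℂ (H.comp r s) * Module.finrank ℂ (K.comp s t))]
  simp [Module.finrank_tensorProduct]

theorem TComp.banded (H K : BiHilb J) : ∃ N : ℕ, ∀ (r : J) (S : Finset J),
    ∑ t ∈ S, (Module.finrank ℂ (TComp H K r t) + Module.finrank ℂ (TComp H K t r)) ≤ N := by
  classical
  obtain ⟨a, ha⟩ := H.exists_row_bound
  obtain ⟨b, hb⟩ := H.exists_col_bound
  obtain ⟨c, hc⟩ := K.exists_row_bound
  obtain ⟨d, hd⟩ := K.exists_col_bound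
  refine ⟨a * c + b * d, fun r S => ?_⟩
  rw [Finset.sum_add_distrib]
  refine add_le_add ?_ ?_
  · calc _ ≤ ∑ t ∈ S, ∑ s ∈ H.row r, Module.finrank ℂ (H.comp r s) * Module.finrank ℂ (K.comp s t) :=
          Finset.sum_le_sum fun t _ => TComp.finrank_le H K r t
      _ = ∑ s ∈ H.row r, Module.finrank ℂ (H.comp r s) * ∑ t ∈ S, Module.finrank ℂ (K.comp s t) := by
          rw [Finset.sum_comm]; simp only [Finset.mul_sum]
      _ ≤ ∑ s ∈ H.row r, Module.finrank ℂ (H.comp r s) * c :=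
          Finset.sum_le_sum fun s _ => Nat.mul_le_mul le_rfl (hc s S)
      _ ≤ a * c := by rw [← Finset.sum_mul]; exact Nat.mul_le_mul (ha r _) le_rfl
  · calc _ ≤ ∑ t ∈ S, ∑ s ∈ H.row t, Module.finrank ℂ (H.comp t s) * Module.finrank ℂ (K.comp s r) :=
          Finset.sum_le_sum fun t _ => TComp.finrank_le H K t r
      _ ≤ ∑ t ∈ S, ∑ s ∈ S.biUnion H.row,
            Module.finrank ℂ (H.comp t s) * Module.finrank ℂ (K.comp s r) :=
          Finset.sum_le_sum fun t ht => Finset.sum_le_sum_of_subset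
            (Finset.subset_biUnion_of_mem H.row ht)
      _ = ∑ s ∈ S.biUnion H.row,
            (∑ t ∈ S, Module.finrank ℂ (H.comp t s)) * Module.finrank ℂ (K.comp s r) := by
          rw [Finset.sum_comm]; simp only [Finset.sum_mul]
      _ ≤ ∑ s ∈ S.biUnion H.row, b * Module.finrank ℂ (K.comp s r) :=
          Finset.sum_le_sum fun s _ => Nat.mul_le_mul (hb s S) le_rfl
      _ ≤ b * d := by rw [← Finset.mul_sum]; exact Nat.mul_le_mul le_rfl (hd r _)

noncomputable def tensor (H K : BiHilb J) : BiHilb J where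
  comp := TComp H K
  banded := TComp.banded H K

/-- The elementary tensors, as a map into the tensor product. -/
noncomputable def gen (H K : BiHilb J) {r t : J} (s : J) :
    (H.comp r s ⊗[ℂ] K.comp s t) →ₗ[ℂ] (tensor H K).comp r t := by
  classical
  exact lp.lsingle (E := fun s => H.comp r s ⊗[ℂ] K.comp s t) 2 s

noncomputable def proj (H K : BiHilb J) {r t : J} (s : J) :
    (tensor H K).comp r t →ₗ[ℂ] (H.comp r s ⊗[ℂ] K.comp s t) where
  toFun z := z.1 s
  map_add' _ _ := rfl
  map_smul' _ _ := rfl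

@[simp] theorem proj_gen_same (H K : BiHilb J) {r s t : J} (x : H.comp r s ⊗[ℂ] K.comp s t) :
    proj H K s (gen H K s x) = x := by
  classical
  exact lp.single_apply_self (E := fun s => H.comp r s ⊗[ℂ] K.comp s t) 2 s x

theorem proj_gen_ne (H K : BiHilb J) {r s s' t : J} (h : s' ≠ s)
    (x : H.comp r s ⊗[ℂ] K.comp s t) : proj H K s' (gen H K s x) = 0 := by
  classical
  exact lp.single_apply_ne (E := fun s => H.comp r s ⊗[ℂ] K.comp s t) 2 s x h

theorem proj_ext (H K : BiHilb J) {r t : J} {z w : (tensor H K).comp r t}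
    (h : ∀ s, proj H K s z = proj H K s w) : z = w :=
  lp.ext (funext h)

theorem sum_gen (H K : BiHilb J) {r t : J} (z : (tensor H K).comp r t) :
    ∑ s ∈ H.row r, gen H K s (proj H K s z) = z := by
  refine proj_ext H K fun s => ?_
  rw [map_sum]
  by_cases hs : s ∈ H.row r
  · rw [Finset.sum_eq_single_of_mem s hs fun s' _ h => proj_gen_ne H K h.symm _, proj_gen_same]
  · rw [tmul_eq_zero_of_notMem_row H K hs (proj H K s z)]
    exact tmul_eq_zero_of_notMem_row H K hs _

theorem inner_eq_tsum (H K : BiHilb J) {r t : J} (z w : (tensor H K).comp r t) :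
    inner ℂ z w = ∑' s, inner ℂ (proj H K s z) (proj H K s w) :=
  lp.inner_eq_tsum (𝕜 := ℂ) (G := fun s => H.comp r s ⊗[ℂ] K.comp s t) z w

theorem inner_gen_same (H K : BiHilb J) {r s t : J} (x y : H.comp r s ⊗[ℂ] K.comp s t) :
    inner ℂ (gen H K s x) (gen H K s y) = inner ℂ x y := by
  rw [inner_eq_tsum, tsum_eq_single s, proj_gen_same, proj_gen_same]
  intro s' h
  rw [proj_gen_ne H K h, inner_zero_left]

theorem inner_gen_ne (H K : BiHilb J) {r s s' t : J} (h : s ≠ s') (x : H.comp r s ⊗[ℂ] K.comp s t)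
    (y : H.comp r s' ⊗[ℂ] K.comp s' t) :
    inner ℂ (gen H K s x) (gen H K s' y) = 0 := by
  rw [inner_eq_tsum, tsum_eq_single s, proj_gen_ne H K h, inner_zero_right]
  intro s'' h'
  rw [proj_gen_ne H K h', inner_zero_left]

theorem tensor_ext {H K : BiHilb J} {r t : J} {V : Type*} [AddCommMonoid V] [Module ℂ V]
    {f g : (tensor H K).comp r t →ₗ[ℂ] V}
    (h : ∀ s (x : H.comp r s) (y : K.comp s t), f (gen H K s (x ⊗ₜ y)) = g (gen H K s (x ⊗ₜ y))) :
    f = g := by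
  ext z
  rw [← sum_gen H K z, map_sum, map_sum]
  refine Finset.sum_congr rfl fun s _ => ?_
  exact LinearMap.congr_fun (f := f ∘ₗ gen H K s) (g := g ∘ₗ gen H K s)
    (TensorProduct.ext' (h s)) (proj H K s z)

noncomputable def desc (H K : BiHilb J) {r t : J} {V : Type*} [AddCommMonoid V] [Module ℂ V]
    (f : ∀ s, (H.comp r s ⊗[ℂ] K.comp s t) →ₗ[ℂ] V) : (tensor H K).comp r t →ₗ[ℂ] V :=
  ∑ s ∈ H.row r, f s ∘ₗ proj H K s

@[simp] theorem desc_gen (H K : BiHilb J) {r t : J} {V : Type*} [AddCommMonoid V] [Module ℂ V]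
    (f : ∀ s, (H.comp r s ⊗[ℂ] K.comp s t) →ₗ[ℂ] V) (s : J) (x : H.comp r s ⊗[ℂ] K.comp s t) :
    desc H K f (gen H K s x) = f s x := by
  rw [desc, LinearMap.sum_apply]
  by_cases hs : s ∈ H.row r
  · rw [Finset.sum_eq_single_of_mem s hs, LinearMap.comp_apply, proj_gen_same]
    intro s' _ h
    rw [LinearMap.comp_apply, proj_gen_ne H K h, map_zero]
  · rw [tmul_eq_zero_of_notMem_row H K hs x]
    simp

/-- The tensor product of two morphisms. -/
noncomputable def tensorMap {H H' K K' : BiHilb J} (T : H ⟶ H') (S : K ⟶ K') :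
    tensor H K ⟶ tensor H' K' :=
  mkHom (fun r t => lp.mapCLM 2 (fun s => TensorProduct.mapL (app T r s) (app S s t))
      (K := ‖T‖ * ‖S‖) (by positivity)
      (fun s => (TensorProduct.norm_mapL_le _ _).trans
        (mul_le_mul (norm_app_le T r s) (norm_app_le S s t) (norm_nonneg _) (norm_nonneg _))))
    (‖T‖ * ‖S‖) (fun _ _ => lp.norm_mapCLM_le _ _ _ _)

theorem proj_tensorMap {H H' K K' : BiHilb J} (T : H ⟶ H') (S : K ⟶ K') (r s t : J)
    (z : (tensor H K).comp r t) : proj H' K' s (app (tensorMap T S) r t z) =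
      TensorProduct.mapL (app T r s) (app S s t) (proj H K s z) := rfl

@[simp] theorem tensorMap_gen {H H' K K' : BiHilb J} (T : H ⟶ H') (S : K ⟶ K') (r s t : J)
    (x : H.comp r s) (y : K.comp s t) :
    app (tensorMap T S) r t (gen H K s (x ⊗ₜ y)) = gen H' K' s (app T r s x ⊗ₜ app S s t y) := by
  refine proj_ext H' K' fun s' => ?_
  rw [proj_tensorMap]
  by_cases h : s' = s
  · subst h; rw [proj_gen_same, proj_gen_same, TensorProduct.mapL_tmul]
  · rw [proj_gen_ne H K h, proj_gen_ne H' K' h, map_zero]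

theorem adj_tensorMap {H H' K K' : BiHilb J} (T : H ⟶ H') (S : K ⟶ K') :
    CStarCategory.adj (tensorMap T S) = tensorMap (CStarCategory.adj T) (CStarCategory.adj S) := by
  refine hom_ext fun r t => ?_
  rw [app_adj]
  refine ((ContinuousLinearMap.eq_adjoint_iff _ _).2 fun z w => ?_).symm
  rw [inner_eq_tsum, inner_eq_tsum]
  refine tsum_congr fun s => ?_
  rw [proj_tensorMap, proj_tensorMap, app_adj, app_adj, ← TensorProduct.adjoint_mapL,
    ContinuousLinearMap.adjoint_inner_left]

theorem tensor_hom_ext {H K L : BiHilb J} {T S : tensor H K ⟶ L}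
    (h : ∀ r s t (x : H.comp r s) (y : K.comp s t),
      app T r t (gen H K s (x ⊗ₜ y)) = app S r t (gen H K s (x ⊗ₜ y))) : T = S :=
  hom_ext' fun r t => LinearMap.congr_fun (f := (app T r t).toLinearMap)
    (g := (app S r t).toLinearMap) (tensor_ext (h r · t))

theorem tensor_ext_left {H K L : BiHilb J} {r t : J} {V : Type*} [AddCommMonoid V] [Module ℂ V]
    {f g : (tensor (tensor H K) L).comp r t →ₗ[ℂ] V}
    (h : ∀ p s (x : H.comp r p) (y : K.comp p s) (z : L.comp s t),
      f (gen (tensor H K) L s (gen H K p (x ⊗ₜ y) ⊗ₜ z)) =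
        g (gen (tensor H K) L s (gen H K p (x ⊗ₜ y) ⊗ₜ z))) : f = g := by
  refine tensor_ext fun s w z => ?_
  have : f ∘ₗ gen (tensor H K) L s ∘ₗ (TensorProduct.mk ℂ _ _).flip z =
      g ∘ₗ gen (tensor H K) L s ∘ₗ (TensorProduct.mk ℂ _ _).flip z :=
    tensor_ext fun p x y => h p s x y z
  exact LinearMap.congr_fun this w

theorem tensor_ext_right {H K L : BiHilb J} {r t : J} {V : Type*} [AddCommMonoid V] [Module ℂ V]
    {f g : (tensor H (tensor K L)).comp r t →ₗ[ℂ] V}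
    (h : ∀ p s (x : H.comp r p) (y : K.comp p s) (z : L.comp s t),
      f (gen H (tensor K L) p (x ⊗ₜ gen K L s (y ⊗ₜ z))) =
        g (gen H (tensor K L) p (x ⊗ₜ gen K L s (y ⊗ₜ z)))) : f = g := by
  refine tensor_ext fun p x w => ?_
  have : f ∘ₗ gen H (tensor K L) p ∘ₗ TensorProduct.mk ℂ _ _ x =
      g ∘ₗ gen H (tensor K L) p ∘ₗ TensorProduct.mk ℂ _ _ x :=
    tensor_ext fun s y z => h p s x y z
  exact LinearMap.congr_fun this w

theorem tensor_hom_ext₃ {H K L M : BiHilb J} {T S : tensor (tensor H K) L ⟶ M}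
    (h : ∀ r p s t (x : H.comp r p) (y : K.comp p s) (z : L.comp s t),
      app T r t (gen (tensor H K) L s (gen H K p (x ⊗ₜ y) ⊗ₜ z)) =
        app S r t (gen (tensor H K) L s (gen H K p (x ⊗ₜ y) ⊗ₜ z))) : T = S :=
  hom_ext' fun r t => LinearMap.congr_fun (f := (app T r t).toLinearMap)
    (g := (app S r t).toLinearMap) (tensor_ext_left (h r · · t))

theorem tensor_hom_ext₄ {H K L M N : BiHilb J} {T S : tensor (tensor (tensor H K) L) M ⟶ N}
    (h : ∀ r p q s t (x : H.comp r p) (y : K.comp p q) (z : L.comp q s) (w : M.comp s t),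
      app T r t (gen (tensor (tensor H K) L) M s
          (gen (tensor H K) L q (gen H K p (x ⊗ₜ y) ⊗ₜ z) ⊗ₜ w)) =
        app S r t (gen (tensor (tensor H K) L) M s
          (gen (tensor H K) L q (gen H K p (x ⊗ₜ y) ⊗ₜ z) ⊗ₜ w))) : T = S := by
  refine tensor_hom_ext fun r s t u w => ?_
  have : (app T r t).toLinearMap ∘ₗ gen (tensor (tensor H K) L) M s ∘ₗ
        (TensorProduct.mk ℂ _ _).flip w =
      (app S r t).toLinearMap ∘ₗ gen (tensor (tensor H K) L) M s ∘ₗ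
        (TensorProduct.mk ℂ _ _).flip w :=
    tensor_ext_left fun p q x y z => h r p q s t x y z w
  exact LinearMap.congr_fun this u

/-- An isomorphism from a family of unitary operators. -/
noncomputable def mkIso {H K : BiHilb J} (e : ∀ r s, H.comp r s ≃ₗᵢ[ℂ] K.comp r s) : H ≅ K where
  hom := mkHom (fun r s => (e r s).toContinuousLinearEquiv.toContinuousLinearMap) 1
    (fun r s => (e r s).toLinearIsometry.norm_toContinuousLinearMap_le)
  inv := mkHom (fun r s => (e r s).symm.toContinuousLinearEquiv.toContinuousLinearMap) 1
    (fun r s => (e r s).symm.toLinearIsometry.norm_toContinuousLinearMap_le)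
  hom_inv_id := hom_ext' fun r s x => (e r s).symm_apply_apply x
  inv_hom_id := hom_ext' fun r s x => (e r s).apply_symm_apply x

@[simp] theorem app_mkIso_hom {H K : BiHilb J} (e : ∀ r s, H.comp r s ≃ₗᵢ[ℂ] K.comp r s) (r s : J)
    (x : H.comp r s) : app (mkIso e).hom r s x = e r s x := rfl

theorem adj_mkIso_hom {H K : BiHilb J} (e : ∀ r s, H.comp r s ≃ₗᵢ[ℂ] K.comp r s) :
    CStarCategory.adj (mkIso e).hom = (mkIso e).inv :=
  hom_ext fun r s => by
    rw [app_adj]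
    refine ((ContinuousLinearMap.eq_adjoint_iff _ _).2 fun z w => ?_).symm
    exact (e r s).symm.inner_map_eq_flip z w

theorem inner_map_of_ext {A B : Type*} [NormedAddCommGroup A] [InnerProductSpace ℂ A]
    [NormedAddCommGroup B] [InnerProductSpace ℂ B] (f : A →ₗ[ℂ] B) (P : Set A)
    (hP : ∀ φ ψ : A →ₗ[ℂ] ℂ, (∀ a ∈ P, φ a = ψ a) → φ = ψ)
    (h : ∀ a ∈ P, ∀ b ∈ P, inner ℂ (f a) (f b) = inner ℂ a b) (a b : A) :
    inner ℂ (f a) (f b) = inner ℂ a b := by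
  have h1 : ∀ a ∈ P, ∀ b, inner ℂ (f a) (f b) = inner ℂ a b := fun a ha =>
    LinearMap.congr_fun (hP ((innerₛₗ ℂ (f a)).comp f) (innerₛₗ ℂ a) (h a ha))
  have h2 : ∀ b a, inner ℂ (f b) (f a) = inner ℂ b a := fun b =>
    LinearMap.congr_fun (hP ((innerₛₗ ℂ (f b)).comp f) (innerₛₗ ℂ b) fun a ha => by
      change inner ℂ (f b) (f a) = inner ℂ b a
      rw [← inner_conj_symm, h1 a ha, inner_conj_symm])
  exact h2 a b

/-- A unitary operator from a pair of mutually inverse linear maps, isometric on a total set. -/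
noncomputable def mkUnitary {A B : Type*} [NormedAddCommGroup A] [InnerProductSpace ℂ A]
    [NormedAddCommGroup B] [InnerProductSpace ℂ B] (f : A →ₗ[ℂ] B) (g : B →ₗ[ℂ] A)
    (hfg : f ∘ₗ g = LinearMap.id) (hgf : g ∘ₗ f = LinearMap.id) (P : Set A)
    (hP : ∀ φ ψ : A →ₗ[ℂ] ℂ, (∀ a ∈ P, φ a = ψ a) → φ = ψ)
    (h : ∀ a ∈ P, ∀ b ∈ P, inner ℂ (f a) (f b) = inner ℂ a b) : A ≃ₗᵢ[ℂ] B :=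
  (LinearEquiv.ofLinearMap f g hfg hgf).isometryOfInner (inner_map_of_ext f P hP h)

noncomputable def assocMap (H K L : BiHilb J) (r t : J) :
    (tensor (tensor H K) L).comp r t →ₗ[ℂ] (tensor H (tensor K L)).comp r t :=
  desc (tensor H K) L fun s => TensorProduct.lift (desc H K fun p => TensorProduct.curry
    (gen H (tensor K L) p ∘ₗ LinearMap.lTensor _ (gen K L s) ∘ₗ
      (TensorProduct.assoc ℂ (H.comp r p) (K.comp p s) (L.comp s t)).toLinearMap))

@[simp] theorem assocMap_gen (H K L : BiHilb J) (r p s t : J) (x : H.comp r p) (y : K.comp p s)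
    (z : L.comp s t) : assocMap H K L r t (gen (tensor H K) L s (gen H K p (x ⊗ₜ y) ⊗ₜ z)) =
      gen H (tensor K L) p (x ⊗ₜ gen K L s (y ⊗ₜ z)) := by
  rw [assocMap, desc_gen, TensorProduct.lift.tmul, desc_gen]
  rfl

noncomputable def assocMapInv (H K L : BiHilb J) (r t : J) :
    (tensor H (tensor K L)).comp r t →ₗ[ℂ] (tensor (tensor H K) L).comp r t :=
  desc H (tensor K L) fun p => TensorProduct.lift (desc K L fun s => (TensorProduct.curry
    (gen (tensor H K) L s ∘ₗ LinearMap.rTensor _ (gen H K p) ∘ₗ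
      (TensorProduct.assoc ℂ (H.comp r p) (K.comp p s) (L.comp s t)).symm.toLinearMap)).flip).flip

@[simp] theorem assocMapInv_gen (H K L : BiHilb J) (r p s t : J) (x : H.comp r p) (y : K.comp p s)
    (z : L.comp s t) : assocMapInv H K L r t (gen H (tensor K L) p (x ⊗ₜ gen K L s (y ⊗ₜ z))) =
      gen (tensor H K) L s (gen H K p (x ⊗ₜ y) ⊗ₜ z) := by
  rw [assocMapInv, desc_gen, TensorProduct.lift.tmul, LinearMap.flip_apply, desc_gen]
  rfl

theorem inner_assocMap (H K L : BiHilb J) {r p s p' s' t : J} (x : H.comp r p) (y : K.comp p s)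
    (z : L.comp s t) (x' : H.comp r p') (y' : K.comp p' s') (z' : L.comp s' t) :
    inner ℂ (gen H (tensor K L) p (x ⊗ₜ gen K L s (y ⊗ₜ z)))
      (gen H (tensor K L) p' (x' ⊗ₜ gen K L s' (y' ⊗ₜ z'))) =
    inner ℂ (gen (tensor H K) L s (gen H K p (x ⊗ₜ y) ⊗ₜ z))
      (gen (tensor H K) L s' (gen H K p' (x' ⊗ₜ y') ⊗ₜ z')) := by
  by_cases hp : p = p'
  · subst hp
    by_cases hs : s = s'
    · subst hs
      simp only [inner_gen_same, TensorProduct.inner_tmul, mul_assoc]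
    · rw [inner_gen_same, inner_gen_ne _ _ hs, TensorProduct.inner_tmul, inner_gen_ne _ _ hs,
        mul_zero]
  · rw [inner_gen_ne _ _ hp]
    by_cases hs : s = s'
    · subst hs
      rw [inner_gen_same, TensorProduct.inner_tmul, inner_gen_ne _ _ hp, zero_mul]
    · rw [inner_gen_ne _ _ hs]

noncomputable def assocUnitary (H K L : BiHilb J) (r t : J) :
    (tensor (tensor H K) L).comp r t ≃ₗᵢ[ℂ] (tensor H (tensor K L)).comp r t :=
  mkUnitary (assocMap H K L r t) (assocMapInv H K L r t)
    (tensor_ext_right fun p s x y z => by simp)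
    (tensor_ext_left fun p s x y z => by simp)
    {a | ∃ p s, ∃ (x : H.comp r p) (y : K.comp p s) (z : L.comp s t),
      a = gen (tensor H K) L s (gen H K p (x ⊗ₜ y) ⊗ₜ z)}
    (fun φ ψ h => tensor_ext_left fun p s x y z => h _ ⟨p, s, x, y, z, rfl⟩)
    (by
      rintro _ ⟨p, s, x, y, z, rfl⟩ _ ⟨p', s', x', y', z', rfl⟩
      rw [assocMap_gen, assocMap_gen, inner_assocMap])

/-- A one-element type if `r = s`, and an empty type otherwise. -/
abbrev EqIdx (r s : J) : Type v := ULift.{v} (PLift (r = s))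

noncomputable instance (r s : J) : Fintype (EqIdx r s) := Fintype.ofFinite _

theorem unit_banded_aux (r : J) (S : Finset J) : ∑ s ∈ S,
    (Module.finrank ℂ (EuclideanSpace ℂ (EqIdx r s)) +
      Module.finrank ℂ (EuclideanSpace ℂ (EqIdx s r))) ≤ 2 := by
  classical
  have h : ∀ s ∈ S, (Module.finrank ℂ (EuclideanSpace ℂ (EqIdx r s)) +
      Module.finrank ℂ (EuclideanSpace ℂ (EqIdx s r))) ≤ if s = r then 2 else 0 := by
    intro s _
    rw [finrank_euclideanSpace, finrank_euclideanSpace]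
    split_ifs with h
    · have h1 := Fintype.card_le_one_iff_subsingleton.2
        (inferInstance : Subsingleton (EqIdx r s))
      have h2 := Fintype.card_le_one_iff_subsingleton.2
        (inferInstance : Subsingleton (EqIdx s r))
      omega
    · have : IsEmpty (EqIdx r s) := ⟨fun x => h x.down.down.symm⟩
      have : IsEmpty (EqIdx s r) := ⟨fun x => h x.down.down⟩
      simp
  refine (Finset.sum_le_sum h).trans ?_
  rw [Finset.sum_ite_eq']
  split_ifs <;> simp

/-- The tensor unit: `ℂ` in the diagonal degrees, zero elsewhere. -/
noncomputable def unit (J : Type v) : BiHilb J where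
  comp r s := EuclideanSpace ℂ (EqIdx r s)
  banded := ⟨2, unit_banded_aux⟩

/-- The basis vector of the tensor unit in degree `(r, r)`. -/
noncomputable def delta (r : J) : (unit J).comp r r :=
  WithLp.toLp 2 fun _ => (1 : ℂ)

noncomputable def unitCoef {r s : J} (h : r = s) : (unit J).comp r s →ₗ[ℂ] ℂ where
  toFun x := (show EuclideanSpace ℂ (EqIdx r s) from x) ⟨⟨h⟩⟩
  map_add' _ _ := rfl
  map_smul' _ _ := rfl

@[simp] theorem unitCoef_delta (r : J) : unitCoef rfl (delta r) = 1 := rfl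

theorem eq_smul_delta {r : J} (x : (unit J).comp r r) : x = unitCoef rfl x • delta r := by
  refine PiLp.ext fun i => ?_
  change _ = _ * (1 : ℂ)
  rw [mul_one]
  rfl

theorem unit_eq_zero {r s : J} (h : r ≠ s) (x : (unit J).comp r s) : x = 0 :=
  PiLp.ext fun i => absurd i.down.down h

theorem inner_delta (r : J) : inner ℂ (delta r) (delta r) = 1 := by
  have : inner ℂ (delta r) (delta r) =
    ∑ _ : EqIdx r r, inner ℂ (1 : ℂ) (1 : ℂ) := PiLp.inner_apply _ _
  have hc : Fintype.card (EqIdx r r) = 1 :=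
    Fintype.card_eq_one_iff.2 ⟨⟨⟨rfl⟩⟩, fun _ => Subsingleton.elim _ _⟩
  rw [this]
  simp [hc]

theorem unit_tensor_ext {H : BiHilb J} {r t : J} {V : Type*} [AddCommMonoid V] [Module ℂ V]
    {f g : (tensor (unit J) H).comp r t →ₗ[ℂ] V}
    (h : ∀ y : H.comp r t, f (gen (unit J) H r (delta r ⊗ₜ y)) =
      g (gen (unit J) H r (delta r ⊗ₜ y))) : f = g := by
  refine tensor_ext fun s x y => ?_
  by_cases hs : r = s
  · subst hs
    rw [eq_smul_delta x, ← TensorProduct.smul_tmul', map_smul, map_smul, map_smul, h]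
  · rw [unit_eq_zero hs x, TensorProduct.zero_tmul, map_zero, map_zero, map_zero]

theorem tensor_unit_ext {H : BiHilb J} {r t : J} {V : Type*} [AddCommMonoid V] [Module ℂ V]
    {f g : (tensor H (unit J)).comp r t →ₗ[ℂ] V}
    (h : ∀ x : H.comp r t, f (gen H (unit J) t (x ⊗ₜ delta t)) =
      g (gen H (unit J) t (x ⊗ₜ delta t))) : f = g := by
  refine tensor_ext fun s x y => ?_
  by_cases hs : s = t
  · subst hs
    rw [eq_smul_delta y, TensorProduct.tmul_smul, map_smul, map_smul, map_smul, h]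
  · rw [unit_eq_zero hs y, TensorProduct.tmul_zero, map_zero, map_zero, map_zero]

open Classical in
noncomputable def unitActLeft (H : BiHilb J) (r s t : J) :
    (unit J).comp r s →ₗ[ℂ] H.comp s t →ₗ[ℂ] H.comp r t :=
  if h : r = s then by
    subst h
    exact (LinearMap.lsmul ℂ (H.comp r t)).comp (unitCoef rfl)
  else 0

@[simp] theorem unitActLeft_delta (H : BiHilb J) (r t : J) (y : H.comp r t) :
    unitActLeft H r r t (delta r) y = y := by
  rw [unitActLeft, dif_pos rfl]
  simp

open Classical in
noncomputable def unitActRight (H : BiHilb J) (r s t : J) :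
    H.comp r s →ₗ[ℂ] (unit J).comp s t →ₗ[ℂ] H.comp r t :=
  if h : s = t then by
    subst h
    exact ((LinearMap.lsmul ℂ (H.comp r s)).comp (unitCoef rfl)).flip
  else 0

@[simp] theorem unitActRight_delta (H : BiHilb J) (r t : J) (x : H.comp r t) :
    unitActRight H r t t x (delta t) = x := by
  rw [unitActRight, dif_pos rfl]
  simp

noncomputable def leftUnitary (H : BiHilb J) (r t : J) :
    (tensor (unit J) H).comp r t ≃ₗᵢ[ℂ] H.comp r t :=
  mkUnitary (desc (unit J) H fun s => TensorProduct.lift (unitActLeft H r s t))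
    (gen (unit J) H r ∘ₗ TensorProduct.mk ℂ _ _ (delta r))
    (LinearMap.ext fun y => by simp)
    (unit_tensor_ext fun y => by simp)
    {a | ∃ y : H.comp r t, a = gen (unit J) H r (delta r ⊗ₜ y)}
    (fun φ ψ h => unit_tensor_ext fun y => h _ ⟨y, rfl⟩)
    (by
      rintro _ ⟨y, rfl⟩ _ ⟨y', rfl⟩
      rw [inner_gen_same, TensorProduct.inner_tmul, inner_delta, one_mul]
      simp)

@[simp] theorem leftUnitary_gen (H : BiHilb J) (r t : J) (y : H.comp r t) :
    leftUnitary H r t (gen (unit J) H r (delta r ⊗ₜ y)) = y := by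
  change desc (unit J) H (fun s => TensorProduct.lift (unitActLeft H r s t)) _ = _
  simp

noncomputable def rightUnitary (H : BiHilb J) (r t : J) :
    (tensor H (unit J)).comp r t ≃ₗᵢ[ℂ] H.comp r t :=
  mkUnitary (desc H (unit J) fun s => TensorProduct.lift (unitActRight H r s t))
    (gen H (unit J) t ∘ₗ (TensorProduct.mk ℂ _ _).flip (delta t))
    (LinearMap.ext fun y => by simp)
    (tensor_unit_ext fun y => by simp)
    {a | ∃ x : H.comp r t, a = gen H (unit J) t (x ⊗ₜ delta t)}
    (fun φ ψ h => tensor_unit_ext fun y => h _ ⟨y, rfl⟩)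
    (by
      rintro _ ⟨y, rfl⟩ _ ⟨y', rfl⟩
      rw [inner_gen_same, TensorProduct.inner_tmul, inner_delta, mul_one]
      simp)

@[simp] theorem rightUnitary_gen (H : BiHilb J) (r t : J) (x : H.comp r t) :
    rightUnitary H r t (gen H (unit J) t (x ⊗ₜ delta t)) = x := by
  change desc H (unit J) (fun s => TensorProduct.lift (unitActRight H r s t)) _ = _
  simp

@[simp] theorem assocUnitary_gen (H K L : BiHilb J) (r p s t : J) (x : H.comp r p)
    (y : K.comp p s) (z : L.comp s t) :
    assocUnitary H K L r t (gen (tensor H K) L s (gen H K p (x ⊗ₜ y) ⊗ₜ z)) =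
      gen H (tensor K L) p (x ⊗ₜ gen K L s (y ⊗ₜ z)) :=
  assocMap_gen H K L r p s t x y z

theorem tensorMap_id (H K : BiHilb J) : tensorMap (𝟙 H) (𝟙 K) = 𝟙 (tensor H K) :=
  tensor_hom_ext fun r s t x y => by simp

theorem tensorMap_add_left {H H' K K' : BiHilb J} (T T' : H ⟶ H') (S : K ⟶ K') :
    tensorMap (T + T') S = tensorMap T S + tensorMap T' S :=
  tensor_hom_ext fun r s t x y => by simp [TensorProduct.add_tmul]

theorem tensorMap_add_right {H H' K K' : BiHilb J} (T : H ⟶ H') (S S' : K ⟶ K') :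
    tensorMap T (S + S') = tensorMap T S + tensorMap T S' :=
  tensor_hom_ext fun r s t x y => by simp [TensorProduct.tmul_add]

theorem tensorMap_smul_left {H H' K K' : BiHilb J} (c : ℂ) (T : H ⟶ H') (S : K ⟶ K') :
    tensorMap (c • T) S = c • tensorMap T S :=
  tensor_hom_ext fun r s t x y => by simp [← TensorProduct.smul_tmul']

theorem tensorMap_smul_right {H H' K K' : BiHilb J} (c : ℂ) (T : H ⟶ H') (S : K ⟶ K') :
    tensorMap T (c • S) = c • tensorMap T S :=
  tensor_hom_ext fun r s t x y => by simp

theorem tensorMap_comp {H H' H'' K K' K'' : BiHilb J} (T : H ⟶ H') (S : K ⟶ K') (T' : H' ⟶ H'')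
    (S' : K' ⟶ K'') : tensorMap T S ≫ tensorMap T' S' = tensorMap (T ≫ T') (S ≫ S') :=
  tensor_hom_ext fun r s t x y => by simp

theorem hom_ext_unit_tensor {H K : BiHilb J} {T S : tensor (unit J) H ⟶ K}
    (h : ∀ r t (y : H.comp r t), app T r t (gen (unit J) H r (delta r ⊗ₜ y)) =
      app S r t (gen (unit J) H r (delta r ⊗ₜ y))) : T = S :=
  hom_ext' fun r t => LinearMap.congr_fun (f := (app T r t).toLinearMap)
    (g := (app S r t).toLinearMap) (unit_tensor_ext (h r t))

theorem hom_ext_tensor_unit {H K : BiHilb J} {T S : tensor H (unit J) ⟶ K}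
    (h : ∀ r t (x : H.comp r t), app T r t (gen H (unit J) t (x ⊗ₜ delta t)) =
      app S r t (gen H (unit J) t (x ⊗ₜ delta t))) : T = S :=
  hom_ext' fun r t => LinearMap.congr_fun (f := (app T r t).toLinearMap)
    (g := (app S r t).toLinearMap) (tensor_unit_ext (h r t))

noncomputable instance : MonoidalCategoryStruct (BiHilb J) where
  tensorObj := tensor
  whiskerLeft H _ _ f := tensorMap (𝟙 H) f
  whiskerRight f K := tensorMap f (𝟙 K)
  tensorHom := tensorMap
  tensorUnit := unit J
  associator H K L := mkIso (assocUnitary H K L)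
  leftUnitor H := mkIso (leftUnitary H)
  rightUnitor H := mkIso (rightUnitary H)

theorem assoc_naturality {X₁ X₂ X₃ Y₁ Y₂ Y₃ : BiHilb J} (f₁ : X₁ ⟶ Y₁) (f₂ : X₂ ⟶ Y₂)
    (f₃ : X₃ ⟶ Y₃) : tensorMap (tensorMap f₁ f₂) f₃ ≫ (mkIso (assocUnitary Y₁ Y₂ Y₃)).hom =
      (mkIso (assocUnitary X₁ X₂ X₃)).hom ≫ tensorMap f₁ (tensorMap f₂ f₃) :=
  tensor_hom_ext₃ fun r p s t x y z => by simp

theorem left_naturality {X Y : BiHilb J} (f : X ⟶ Y) :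
    tensorMap (𝟙 (unit J)) f ≫ (mkIso (leftUnitary Y)).hom = (mkIso (leftUnitary X)).hom ≫ f :=
  hom_ext_unit_tensor fun r t y => by simp

theorem right_naturality {X Y : BiHilb J} (f : X ⟶ Y) :
    tensorMap f (𝟙 (unit J)) ≫ (mkIso (rightUnitary Y)).hom = (mkIso (rightUnitary X)).hom ≫ f :=
  hom_ext_tensor_unit fun r t y => by simp

theorem assoc_pentagon (W X Y Z : BiHilb J) :
    tensorMap (mkIso (assocUnitary W X Y)).hom (𝟙 Z) ≫
        (mkIso (assocUnitary W (tensor X Y) Z)).hom ≫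
          tensorMap (𝟙 W) (mkIso (assocUnitary X Y Z)).hom =
      (mkIso (assocUnitary (tensor W X) Y Z)).hom ≫ (mkIso (assocUnitary W X (tensor Y Z))).hom :=
  tensor_hom_ext₄ fun r p q s t x y z w => by
    simp

theorem unit_triangle (X Y : BiHilb J) :
    (mkIso (assocUnitary X (unit J) Y)).hom ≫ tensorMap (𝟙 X) (mkIso (leftUnitary Y)).hom =
      tensorMap (mkIso (rightUnitary X)).hom (𝟙 Y) := by
  refine tensor_hom_ext fun r s t w y => ?_
  have : (app ((mkIso (assocUnitary X (unit J) Y)).hom ≫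
        tensorMap (𝟙 X) (mkIso (leftUnitary Y)).hom) r t).toLinearMap ∘ₗ
        gen (tensor X (unit J)) Y s ∘ₗ (TensorProduct.mk ℂ _ _).flip y =
      (app (tensorMap (mkIso (rightUnitary X)).hom (𝟙 Y)) r t).toLinearMap ∘ₗ
        gen (tensor X (unit J)) Y s ∘ₗ (TensorProduct.mk ℂ _ _).flip y :=
    tensor_unit_ext fun x => by simp
  exact LinearMap.congr_fun this w

theorem tensorMap_eq {X₁ Y₁ X₂ Y₂ : BiHilb J} (f : X₁ ⟶ Y₁) (g : X₂ ⟶ Y₂) :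
    tensorMap f g = tensorMap f (𝟙 X₂) ≫ tensorMap (𝟙 Y₁) g :=
  tensor_hom_ext fun r s t x y => by simp

theorem adj_tensorMap_id_left (H : BiHilb J) {K K' : BiHilb J} (f : K ⟶ K') :
    adj (tensorMap (𝟙 H) f) = tensorMap (𝟙 H) (adj f) := by
  rw [adj_tensorMap, adj_id]

theorem adj_tensorMap_id_right {H H' : BiHilb J} (f : H ⟶ H') (K : BiHilb J) :
    adj (tensorMap f (𝟙 K)) = tensorMap (adj f) (𝟙 K) := by
  rw [adj_tensorMap, adj_id]

theorem isUnitary_mkIso_hom {H K : BiHilb J} (e : ∀ r s, H.comp r s ≃ₗᵢ[ℂ] K.comp r s) :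
    IsUnitary (mkIso e).hom :=
  isUnitary_of_adj_eq_inv _ (adj_mkIso_hom e)

section

attribute [local irreducible] tensor unit mkIso assocUnitary leftUnitary rightUnitary tensorMap

noncomputable instance : MonoidalCategory (BiHilb J) where
  tensorHom_def f g := tensorMap_eq f g
  id_tensorHom_id X Y := tensorMap_id X Y
  tensorHom_comp_tensorHom f g f' g' := tensorMap_comp f g f' g'
  whiskerLeft_id X Y := tensorMap_id X Y
  id_whiskerRight X Y := tensorMap_id X Y
  associator_naturality f g h := assoc_naturality f g h
  leftUnitor_naturality f := left_naturality f
  rightUnitor_naturality f := right_naturality f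
  pentagon W X Y Z := assoc_pentagon W X Y Z
  triangle X Y := unit_triangle X Y

theorem isUnitary_associator (H K L : BiHilb J) : IsUnitary (α_ H K L).hom := by
  have h : α_ H K L = mkIso (assocUnitary H K L) := rfl
  rw [h]
  exact isUnitary_mkIso_hom _

theorem isUnitary_leftUnitor (H : BiHilb J) : IsUnitary (λ_ H).hom := by
  have h : λ_ H = mkIso (leftUnitary H) := rfl
  rw [h]
  exact isUnitary_mkIso_hom _

theorem isUnitary_rightUnitor (H : BiHilb J) : IsUnitary (ρ_ H).hom := by
  have h : ρ_ H = mkIso (rightUnitary H) := rfl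
  rw [h]
  exact isUnitary_mkIso_hom _

instance : TensorCStarCategory (BiHilb J) where
  whiskerLeft_add _ _ _ f g := tensorMap_add_right _ f g
  whiskerLeft_smul _ _ _ c f := tensorMap_smul_right c _ f
  whiskerRight_add f g _ := tensorMap_add_left f g _
  whiskerRight_smul c f _ := tensorMap_smul_left c f _
  adj_whiskerLeft X _ _ f := adj_tensorMap_id_left X f
  adj_whiskerRight f Z := adj_tensorMap_id_right f Z
  associator_unitary H K L := isUnitary_associator H K L
  leftUnitor_unitary H := isUnitary_leftUnitor H
  rightUnitor_unitary H := isUnitary_rightUnitor H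

end

end BiHilb

/-- `F` is the strong tensor functor `U ↦ ⨁ Mor(X r, U ⊙ X s)` associated with the based module
C*-category `M`, by means of the unitary identifications `κ` of the homogeneous components
`F(U)_rs` with the Hilbert spaces `Mor(X r, U ⊙ X s)` (with inner product `⟪f, g⟫ = f* g`).
The functor acts on morphisms by composition, its tensor coherence map sends `f ⊗ g`, for
`f : X r ⟶ U ⊙ X s` and `g : X s ⟶ V ⊙ X t`, to `φ* (id_U ⊙ g) f`, and its unit coherence map sends the
basis vector of degree `(r, r)` to `e*`. -/
structure Realization {C : Type u₁} [Category.{v₁} C] [CStarCategory C] [MonoidalCategory C]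
    [TensorCStarCategory C] {J : Type v} (M : BasedModule.{u} C J)
    (F : StrongTensorFunctor C (BiHilb J)) where
  κ : ∀ (U : C) (r s : J), (F.functor.obj U).comp r s ≃ₗ[ℂ] (M.X r ⟶ U ⊙ₗ M.X s)
  inner_eq : ∀ (U : C) (r s : J) (x y : (F.functor.obj U).comp r s),
    κ U r s y ≫ adj (κ U r s x) = (inner ℂ x y : ℂ) • 𝟙 (M.X r)
  map_eq : ∀ {U V : C} (f : U ⟶ V) (r s : J) (x : (F.functor.obj U).comp r s),
    κ V r s (BiHilb.app (F.functor.map f) r s x) = κ U r s x ≫ f ⊵ₗ M.X s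
  tensor_eq : ∀ (U V : C) (r s t : J) (x : (F.functor.obj U).comp r s)
    (y : (F.functor.obj V).comp s t),
    κ (U ⊗ V) r t (BiHilb.app (Functor.LaxMonoidal.μ F.functor U V) r t
      (BiHilb.gen (F.functor.obj U) (F.functor.obj V) s (x ⊗ₜ[ℂ] y))) =
      κ U r s x ≫ U ⊴ₗ κ V s t y ≫ adj (αₗ U V (M.X t)).hom
  unit_eq : ∀ r : J,
    κ (𝟙_ C) r r (BiHilb.app (Functor.LaxMonoidal.ε F.functor) r r (BiHilb.delta r)) =
      adj (MonoidalLeftActionStruct.actionUnitIso (C := C) (M.X r)).hom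

/-!
Both parts rest on one observation: in a semi-simple C*-category with base `X r`, every object `W` is
an orthogonal direct sum of objects of the base, so `W`, and each morphism out of it, is determined
by the finite-dimensional Hilbert spaces `Mor(X r, W)`.

**Bandedness.** For finite `J` there is nothing to do. If `U` has a conjugate `V`, with morphisms `R`
and `R'`, the Frobenius transform embeds `Mor(X r, U ⊙ X s)` antilinearly into `Mor(X s, V ⊙ X r)`,
so it is enough to bound the number of simple summands of `U ⊙ X`, and by symmetry of `V ⊙ X`,
uniformly in the simple object `X`. The Frobenius transforms of the projections onto the summands have squared norms adding up to at
most `‖R‖²`, and each of these is at least `‖R'‖⁻²`; hence there are at most `‖R‖² ‖R'‖²` summands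
(`ModuleCStarCategory.card_le_of_isDecomp`).

**The functor.** The product `f ⊗ g ↦ φ* (id ⊙ g) f` is isometric because `g* g` is a scalar, and
surjective because `V ⊙ X t` decomposes into objects of the base; coherence is checked on elementary
tensors. This gives `BandedModule.strongFunctor`. A morphism of based modules induces maps between
the spaces `Mor(X r, U ⊙ X s)` (`BasedModule.Hom.tr`), which form a monoidal natural unitary.

**Faithfulness and fullness.** Two morphisms of based modules inducing the same maps are identified by
the natural unitary that matches up their values on a decomposition of each object
(`BasedModule.Hom.rel_of_tr_eq`). Conversely, `X r ↦ X' r` extends to a C*-functor, and a monoidal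
natural unitary prescribes a module structure on this extension on each composite
`X r ⟶ U ⊙ X s ⟶ U ⊙ W`; these composites contain a decomposition of `U ⊙ W`
(`BasedModule.Comparison.hom`).

**Essential surjectivity.** Given a strong tensor functor `F`, a point `o` of `J` is fixed and `C` acts
on the graded Hilbert spaces `H` that are concentrated in the degrees `(r, o)`, by `U ⊙ H = F(U) ⊗ H`.
These columns form a semi-simple C*-category, whose simple objects are the columns `line r` of
dimension one in degree `(r, o)`, and `x ↦ (1 ↦ x ⊗ 1)` identifies `F(U)_rs` with
`Mor(line r, F(U) ⊗ line s)` (`BiHilb.fiber`). A column is determined up to unitary isomorphism by its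
finitely supported dimension function, so the action can be transported to the category whose objects
are these functions (`ActionModel`), which has the size required of a based module.
-/

/-! ### Morphism spaces of a C*-category -/

namespace CStarCategory

variable {D : Type u} [Category.{v} D] [CStarCategory D]

@[simp] theorem zero_comp {X Y Z : D} (g : Y ⟶ Z) : (0 : X ⟶ Y) ≫ g = 0 := by
  have h := add_comp (0 : X ⟶ Y) 0 g
  rw [add_zero] at h
  exact left_eq_add.1 h

@[simp] theorem comp_zero {X Y Z : D} (f : X ⟶ Y) : f ≫ (0 : Y ⟶ Z) = 0 := by
  have h := comp_add f (0 : Y ⟶ Z) 0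
  rw [add_zero] at h
  exact left_eq_add.1 h

theorem sum_comp {ι : Type*} (S : Finset ι) {X Y Z : D} (f : ι → (X ⟶ Y)) (g : Y ⟶ Z) :
    (∑ i ∈ S, f i) ≫ g = ∑ i ∈ S, f i ≫ g :=
  map_sum (AddMonoidHom.mk' (fun f : X ⟶ Y => f ≫ g) fun a b => add_comp a b g) f S

theorem comp_sum {ι : Type*} (S : Finset ι) {X Y Z : D} (f : X ⟶ Y) (g : ι → (Y ⟶ Z)) :
    f ≫ ∑ i ∈ S, g i = ∑ i ∈ S, f ≫ g i :=
  map_sum (AddMonoidHom.mk' (fun g : Y ⟶ Z => f ≫ g) fun a b => comp_add f a b) g S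

@[simp] theorem adj_zero {X Y : D} : adj (0 : X ⟶ Y) = 0 := by
  have h := adj_add (0 : X ⟶ Y) 0
  rw [add_zero] at h
  exact left_eq_add.1 h

theorem adj_sum {ι : Type*} (S : Finset ι) {X Y : D} (f : ι → (X ⟶ Y)) :
    adj (∑ i ∈ S, f i) = ∑ i ∈ S, adj (f i) :=
  map_sum (AddMonoidHom.mk' (fun f : X ⟶ Y => adj f) fun a b => adj_add a b) f S

theorem adj_injective {X Y : D} {f g : X ⟶ Y} (h : adj f = adj g) : f = g := by
  rw [← adj_adj f, h, adj_adj]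

/-- Half of `norm_adj`; the other half follows by applying it to `adj f`. -/
theorem norm_adj_le {X Y : D} (f : X ⟶ Y) : ‖f‖ ≤ ‖adj f‖ := by
  have h := norm_comp_adj f
  have h1 := norm_comp_le f (adj f)
  rcases (norm_nonneg f).eq_or_lt with h0 | h0
  · rw [← h0]; exact norm_nonneg _
  · nlinarith

theorem norm_adj {X Y : D} (f : X ⟶ Y) : ‖adj f‖ = ‖f‖ :=
  le_antisymm ((norm_adj_le (adj f)).trans_eq (by rw [adj_adj])) (norm_adj_le f)

theorem norm_id_le (X : D) : ‖𝟙 X‖ ≤ 1 := by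
  have h := norm_comp_adj (𝟙 X)
  rw [adj_id, Category.comp_id] at h
  by_contra h1
  nlinarith

theorem IsUnitary.adj {X Y : D} {f : X ⟶ Y} (hf : IsUnitary f) : IsUnitary (adj f) :=
  ⟨by rw [adj_adj]; exact hf.2, by rw [adj_adj]; exact hf.1⟩

theorem isUnitary_inv {X Y : D} (e : X ≅ Y) (h : IsUnitary e.hom) : CStarCategory.adj e.hom = e.inv := by
  rw [← cancel_epi e.hom, h.1, e.hom_inv_id]

theorem IsUnitary.inv {X Y : D} {e : X ≅ Y} (h : IsUnitary e.hom) : IsUnitary e.inv := by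
  rw [← isUnitary_inv e h]; exact h.adj

/-- The isomorphism given by a unitary morphism. -/
def IsUnitary.iso {X Y : D} {f : X ⟶ Y} (hf : IsUnitary f) : X ≅ Y where
  hom := f
  inv := CStarCategory.adj f
  hom_inv_id := hf.1
  inv_hom_id := hf.2

/-- The endomorphisms of an object of a C*-category form a Banach algebra, with the multiplication
`a * b = b ≫ a` of `End X`. -/
@[reducible]
noncomputable def endNormedRing (X : D) : NormedRing (End X) where
  __ := CStarCategory.normedAddCommGroup X X
  __ := (End.monoid : Monoid (End X))
  left_distrib a b c := add_comp (X := X) (Y := X) (Z := X) b c a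
  right_distrib a b c := comp_add (X := X) (Y := X) (Z := X) c a b
  zero_mul a := comp_zero (X := X) (Y := X) (Z := X) a
  mul_zero a := zero_comp (X := X) (Y := X) (Z := X) a
  norm_mul_le a b := by
    rw [mul_comm]
    exact norm_comp_le (X := X) (Y := X) (Z := X) b a

/-- The endomorphisms of an object of a C*-category form a C*-algebra. -/
@[reducible]
noncomputable def endCStarAlgebra (X : D) : CStarAlgebra (End X) :=
  letI := endNormedRing X
  { endNormedRing X with
    star := fun a => adj (X := X) (Y := X) a
    star_involutive := fun a => adj_adj (X := X) (Y := X) a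
    star_mul := fun a b => adj_comp (X := X) (Y := X) (Z := X) b a
    star_add := fun a b => adj_add (X := X) (Y := X) a b
    complete := (CStarCategory.completeSpace X X).complete
    norm_mul_self_le := fun a => by
      rw [← sq]
      exact (norm_comp_adj (X := X) (Y := X) a).ge
    smul := fun c a => (c • (show X ⟶ X from a) : X ⟶ X)
    algebraMap :=
      { toFun := fun c => (c • 𝟙 X : X ⟶ X)
        map_one' := one_smul ℂ (𝟙 X)
        map_mul' := fun a b => by
          change (a * b) • 𝟙 X = (b • 𝟙 X) ≫ (a • 𝟙 X)
          rw [smul_comp, comp_smul, Category.comp_id, smul_smul, mul_comm]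
        map_zero' := zero_smul ℂ (𝟙 X)
        map_add' := fun a b => add_smul a b (𝟙 X) }
    commutes' := fun c a => by
      change (show X ⟶ X from a) ≫ (c • 𝟙 X) = (c • 𝟙 X) ≫ (show X ⟶ X from a)
      rw [smul_comp, comp_smul, Category.comp_id, Category.id_comp]
    smul_def' := fun c a => by
      change c • (show X ⟶ X from a) = (show X ⟶ X from a) ≫ (c • 𝟙 X)
      rw [comp_smul, Category.comp_id]
    norm_smul_le := fun c a => _root_.norm_smul_le c (show X ⟶ X from a)
    star_smul := fun c a => adj_smul (X := X) (Y := X) c a }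

end CStarCategory

namespace IsCStarFunctor

variable {D : Type u} [Category.{v} D] [CStarCategory D] {E : Type u₁} [Category.{v₁} E]
  [CStarCategory E] {F : D ⥤ E}

theorem map_zero (hF : IsCStarFunctor F) {X Y : D} : F.map (0 : X ⟶ Y) = 0 := by
  have h := hF.map_add (0 : X ⟶ Y) 0
  rw [add_zero] at h
  exact left_eq_add.1 h

theorem map_sum (hF : IsCStarFunctor F) {ι : Type*} (S : Finset ι) {X Y : D} (f : ι → (X ⟶ Y)) :
    F.map (∑ i ∈ S, f i) = ∑ i ∈ S, F.map (f i) :=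
  _root_.map_sum (AddMonoidHom.mk' (fun f : X ⟶ Y => F.map f) fun a b => hF.map_add a b) f S

/-- A C*-functor is contractive. For endomorphisms this is the contractivity of `*`-homomorphisms of
C*-algebras; the general case follows by the C*-identity. -/
theorem norm_map_le (hF : IsCStarFunctor F) {X Y : D} (f : X ⟶ Y) : ‖F.map f‖ ≤ ‖f‖ := by
  let := endCStarAlgebra X
  let := endCStarAlgebra (F.obj X)
  let φ : End X →⋆ₐ[ℂ] End (F.obj X) :=
    { toFun := fun a => F.map a
      map_one' := F.map_id X
      map_mul' := fun a b => F.map_comp b a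
      map_zero' := hF.map_zero
      map_add' := fun a b => hF.map_add a b
      commutes' := fun c => by
        change F.map (c • 𝟙 X) = c • 𝟙 (F.obj X)
        rw [hF.map_smul, F.map_id]
      map_star' := fun a => hF.map_adj a }
  have h : ‖F.map (f ≫ adj f)‖ ≤ ‖f ≫ adj f‖ :=
    NonUnitalStarAlgHom.norm_apply_le φ (show End X from f ≫ adj f)
  rw [F.map_comp, hF.map_adj, norm_comp_adj, norm_comp_adj] at h
  exact le_of_sq_le_sq h (norm_nonneg _)

end IsCStarFunctor

/-! ### Simple objects and orthogonal decompositions -/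

namespace CStarCategory

variable {D : Type u} [Category.{v} D] [CStarCategory D]

namespace IsSimple

variable {X : D}

/-- The scalar by which an endomorphism of a simple object acts. -/
noncomputable def coef (hX : IsSimple X) (f : X ⟶ X) : ℂ := (hX f).choose

theorem eq_coef_smul (hX : IsSimple X) (f : X ⟶ X) : f = hX.coef f • 𝟙 X := (hX f).choose_spec.1

theorem id_ne_zero (hX : IsSimple X) : 𝟙 X ≠ 0 := by
  intro h
  have h1 := (hX 0).unique (y₁ := 0) (y₂ := 1) (by simp) (by simp [h])
  exact zero_ne_one h1

theorem smul_id_injective (hX : IsSimple X) {c d : ℂ} (h : c • 𝟙 X = d • 𝟙 X) : c = d :=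
  (hX (c • 𝟙 X)).unique rfl h

@[simp] theorem coef_smul_id (hX : IsSimple X) (c : ℂ) : hX.coef (c • 𝟙 X) = c :=
  (hX.smul_id_injective (hX.eq_coef_smul (c • 𝟙 X))).symm

theorem coef_eq (hX : IsSimple X) {f : X ⟶ X} {c : ℂ} (h : f = c • 𝟙 X) : hX.coef f = c := by
  rw [h, coef_smul_id]

@[simp] theorem coef_id (hX : IsSimple X) : hX.coef (𝟙 X) = 1 := hX.coef_eq (one_smul ℂ _).symm

@[simp] theorem coef_zero (hX : IsSimple X) : hX.coef 0 = 0 := hX.coef_eq (zero_smul ℂ _).symm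

theorem coef_add (hX : IsSimple X) (f g : X ⟶ X) : hX.coef (f + g) = hX.coef f + hX.coef g :=
  hX.coef_eq (by rw [add_smul, ← hX.eq_coef_smul, ← hX.eq_coef_smul])

theorem coef_smul (hX : IsSimple X) (c : ℂ) (f : X ⟶ X) : hX.coef (c • f) = c * hX.coef f :=
  hX.coef_eq (by rw [mul_smul, ← hX.eq_coef_smul])

theorem coef_adj (hX : IsSimple X) (f : X ⟶ X) : hX.coef (adj f) = starRingEnd ℂ (hX.coef f) :=
  hX.coef_eq (by
    conv_lhs => rw [hX.eq_coef_smul f]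
    rw [adj_smul, adj_id])

theorem comp_eq_coef_smul (hX : IsSimple X) {Y : D} (f : X ⟶ X) (g : X ⟶ Y) : f ≫ g = hX.coef f • g := by
  conv_lhs => rw [hX.eq_coef_smul f]
  rw [smul_comp, Category.id_comp]

theorem coef_comp (hX : IsSimple X) (f g : X ⟶ X) : hX.coef (f ≫ g) = hX.coef f * hX.coef g := by
  rw [hX.comp_eq_coef_smul, coef_smul]

theorem norm_id (hX : IsSimple X) : ‖𝟙 X‖ = 1 := by
  have h := norm_comp_adj (𝟙 X)
  rw [adj_id, Category.comp_id] at h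
  have h0 : ‖𝟙 X‖ ≠ 0 := norm_ne_zero_iff.2 hX.id_ne_zero
  field_simp at h
  linarith

theorem norm_coef (hX : IsSimple X) (f : X ⟶ X) : ‖hX.coef f‖ = ‖f‖ := by
  conv_rhs => rw [hX.eq_coef_smul f, norm_smul, hX.norm_id, mul_one]

/-- The scalar of `f* f` is the square of the norm: it is nonnegative since `f* f` is positive. -/
theorem coef_comp_adj (hX : IsSimple X) {Y : D} (f : X ⟶ Y) : hX.coef (f ≫ adj f) = ((‖f‖ ^ 2 : ℝ) : ℂ) := by
  obtain ⟨g, hg⟩ := positive f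
  have h : hX.coef (f ≫ adj f) = ((‖hX.coef g‖ ^ 2 : ℝ) : ℂ) := by
    rw [hg, coef_comp, coef_adj, Complex.mul_conj, Complex.normSq_eq_norm_sq]
  rw [h, norm_coef, ← norm_comp_adj g, ← hg, norm_comp_adj]

theorem comp_adj_self (hX : IsSimple X) {Y : D} (f : X ⟶ Y) : f ≫ adj f = ((‖f‖ ^ 2 : ℝ) : ℂ) • 𝟙 X := by
  rw [← hX.coef_comp_adj f, ← hX.eq_coef_smul]

/-- The morphisms out of a simple object form a Hilbert space, with inner product
`⟪f, g⟫ id = f* g`, whose norm is the norm of the C*-category. -/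
@[reducible]
noncomputable def innerProductSpace (hX : IsSimple X) (Y : D) : InnerProductSpace ℂ (X ⟶ Y) where
  inner f g := hX.coef (g ≫ adj f)
  norm_sq_eq_re_inner f := by
    rw [hX.coef_comp_adj]
    rfl
  conj_inner_symm f g := by
    rw [← coef_adj, adj_comp, adj_adj]
  add_left f g h := by
    rw [adj_add, comp_add, coef_add]
  smul_left f g c := by
    rw [adj_smul, comp_smul, coef_smul]

/-- A nonzero morphism between simple objects is a positive multiple of a unitary. -/
theorem exists_isUnitary (hX : IsSimple X) {Y : D} (hY : IsSimple Y) {f : X ⟶ Y} (hf : f ≠ 0) :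
    ∃ c : ℂ, IsUnitary (c • f) := by
  have h0 : ‖f‖ ≠ 0 := norm_ne_zero_iff.2 hf
  have h1 : adj f ≫ f = ((‖f‖ ^ 2 : ℝ) : ℂ) • 𝟙 Y := by
    have := hY.comp_adj_self (adj f)
    rwa [adj_adj, norm_adj] at this
  have h2 : ((‖f‖⁻¹ : ℝ) : ℂ) * ((‖f‖⁻¹ : ℝ) : ℂ) * ((‖f‖ ^ 2 : ℝ) : ℂ) = 1 := by
    rw [← Complex.ofReal_mul, ← Complex.ofReal_mul]
    field_simp
    simp
  refine ⟨((‖f‖⁻¹ : ℝ) : ℂ), ?_, ?_⟩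
  · rw [adj_smul, Complex.conj_ofReal, smul_comp, comp_smul, hX.comp_adj_self, smul_smul, smul_smul,
      h2, one_smul]
  · rw [adj_smul, Complex.conj_ofReal, smul_comp, comp_smul, h1, smul_smul, smul_smul, h2,
      one_smul]

end IsSimple

/-- `W` is the orthogonal direct sum of the finite family `Y`, with isometric injections `v`. This is
`IsDirectSum` for an arbitrary finite index type, as needed for iterated decompositions. -/
def IsDecomp {ι : Type*} [Fintype ι] (Y : ι → D) (W : D) (v : ∀ i, Y i ⟶ W) : Prop :=
  (∀ i, v i ≫ adj (v i) = 𝟙 (Y i)) ∧ (∀ i j, i ≠ j → v i ≫ adj (v j) = 0) ∧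
    ∑ i, adj (v i) ≫ v i = 𝟙 W

namespace IsDecomp

variable {ι : Type*} [Fintype ι] {Y : ι → D} {W : D} {v : ∀ i, Y i ⟶ W}

theorem sum_comp (h : IsDecomp Y W v) {Z : D} (f : W ⟶ Z) : ∑ i, adj (v i) ≫ v i ≫ f = f := by
  have e := CStarCategory.sum_comp Finset.univ (fun i => adj (v i) ≫ v i) f
  rw [h.2.2, Category.id_comp] at e
  simpa only [Category.assoc] using e.symm

theorem comp_sum (h : IsDecomp Y W v) {Z : D} (f : Z ⟶ W) : ∑ i, (f ≫ adj (v i)) ≫ v i = f := by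
  have e := CStarCategory.comp_sum Finset.univ f (fun i => adj (v i) ≫ v i)
  rw [h.2.2, Category.comp_id] at e
  simpa only [Category.assoc] using e.symm

theorem hom_ext (h : IsDecomp Y W v) {Z : D} {f g : W ⟶ Z} (e : ∀ i, v i ≫ f = v i ≫ g) :
    f = g := by
  rw [← h.sum_comp f, ← h.sum_comp g]
  simp only [e]

theorem map {E : Type u₁} [Category.{v₁} E] [CStarCategory E] {F : D ⥤ E} (hF : IsCStarFunctor F)
    (h : IsDecomp Y W v) : IsDecomp (fun i => F.obj (Y i)) (F.obj W) (fun i => F.map (v i)) := by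
  refine ⟨fun i => ?_, fun i j hij => ?_, ?_⟩
  · rw [← hF.map_adj, ← F.map_comp, h.1, F.map_id]
  · rw [← hF.map_adj, ← F.map_comp, h.2.1 i j hij, hF.map_zero]
  · simp only [← hF.map_adj, ← F.map_comp]
    rw [← hF.map_sum, h.2.2, F.map_id]

theorem precomp (h : IsDecomp Y W v) {Y' : ι → D} {z : ∀ i, Y' i ⟶ Y i}
    (hz : ∀ i, IsUnitary (z i)) : IsDecomp Y' W (fun i => z i ≫ v i) := by
  refine ⟨fun i => ?_, fun i j hij => ?_, ?_⟩
  · rw [adj_comp, Category.assoc, ← Category.assoc (v i), h.1, Category.id_comp, (hz i).1]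
  · rw [adj_comp, Category.assoc, ← Category.assoc (v i), h.2.1 i j hij, zero_comp, comp_zero]
  · rw [← h.2.2]
    refine Finset.sum_congr rfl fun i _ => ?_
    rw [adj_comp, Category.assoc, ← Category.assoc (adj (z i)), (hz i).2, Category.id_comp]

theorem postcomp (h : IsDecomp Y W v) {W' : D} {z : W ⟶ W'} (hz : IsUnitary z) :
    IsDecomp Y W' (fun i => v i ≫ z) := by
  refine ⟨fun i => ?_, fun i j hij => ?_, ?_⟩
  · rw [adj_comp, Category.assoc, ← Category.assoc z, hz.1, Category.id_comp, h.1]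
  · rw [adj_comp, Category.assoc, ← Category.assoc z, hz.1, Category.id_comp, h.2.1 i j hij]
  · simp only [adj_comp, Category.assoc]
    rw [← CStarCategory.comp_sum, h.sum_comp, hz.2]

theorem sigma (h : IsDecomp Y W v) {κ : ι → Type*} [∀ i, Fintype (κ i)] {Z : ∀ i, κ i → D}
    {w : ∀ i k, Z i k ⟶ Y i} (hw : ∀ i, IsDecomp (Z i) (Y i) (w i)) :
    IsDecomp (fun p : Σ i, κ i => Z p.1 p.2) W (fun p => w p.1 p.2 ≫ v p.1) := by
  refine ⟨fun p => ?_, fun p q hpq => ?_, ?_⟩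
  · rw [adj_comp, Category.assoc, ← Category.assoc (v _), h.1, Category.id_comp, (hw p.1).1]
  · rw [adj_comp, Category.assoc, ← Category.assoc (v _)]
    obtain ⟨i, k⟩ := p
    obtain ⟨j, l⟩ := q
    by_cases hij : i = j
    · subst hij
      have hkl : k ≠ l := fun e => hpq (by rw [e])
      rw [h.1, Category.id_comp, (hw i).2.1 k l hkl]
    · rw [h.2.1 i j hij, zero_comp, comp_zero]
  · rw [Fintype.sum_sigma, ← h.2.2]
    refine Finset.sum_congr rfl fun i _ => ?_
    simp only [adj_comp, Category.assoc]
    rw [← CStarCategory.comp_sum, (hw i).sum_comp]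

theorem reindex (h : IsDecomp Y W v) {κ : Type*} [Fintype κ] (e : κ ≃ ι) :
    IsDecomp (fun k => Y (e k)) W (fun k => v (e k)) :=
  ⟨fun k => h.1 (e k), fun k l hkl => h.2.1 _ _ (e.injective.ne hkl), by
    rw [← h.2.2]
    exact e.sum_comp fun i => adj (v i) ≫ v i⟩

/-- The morphism matching up two decompositions indexed by the same family of objects. -/
noncomputable def _root_.CStarCategory.matching {W' : D} (v : ∀ i, Y i ⟶ W) (w : ∀ i, Y i ⟶ W') :
    W ⟶ W' := ∑ i, adj (v i) ≫ w i

theorem comp_matching (h : IsDecomp Y W v) {W' : D} (w : ∀ i, Y i ⟶ W') (i : ι) :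
    v i ≫ matching v w = w i := by
  rw [matching, CStarCategory.comp_sum, Finset.sum_eq_single i]
  · rw [← Category.assoc, h.1, Category.id_comp]
  · intro j _ hj
    rw [← Category.assoc, h.2.1 i j hj.symm, zero_comp]
  · exact fun hi => (hi (Finset.mem_univ i)).elim

theorem adj_matching {W' : D} (v : ∀ i, Y i ⟶ W) (w : ∀ i, Y i ⟶ W') :
    adj (matching v w) = matching w v := by
  simp only [matching, adj_sum, adj_comp, adj_adj]

theorem isUnitary_matching (h : IsDecomp Y W v) {W' : D} {w : ∀ i, Y i ⟶ W'}
    (h' : IsDecomp Y W' w) : IsUnitary (matching v w) := by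
  constructor
  · refine h.hom_ext fun i => ?_
    rw [← Category.assoc, h.comp_matching, adj_matching, h'.comp_matching, Category.comp_id]
  · refine h'.hom_ext fun i => ?_
    rw [← Category.assoc, adj_matching, h'.comp_matching, h.comp_matching, Category.comp_id]

end IsDecomp

end CStarCategory

namespace BasedModule

variable {C : Type u₁} [Category.{v₁} C] [CStarCategory C] [MonoidalCategory C] {J : Type v}
  (M : BasedModule.{u} C J)

theorem hom_eq_zero {r s : J} (h : r ≠ s) (f : M.X r ⟶ M.X s) : f = 0 := by
  by_contra hf
  obtain ⟨c, hc⟩ := (M.simple r).exists_isUnitary (M.simple s) hf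
  exact h (M.eq_of_iso r s ⟨hc.iso⟩)

/-- Every object is an orthogonal direct sum of objects of the base. -/
theorem exists_isDecomp (W : M.carrier) : ∃ (n : ℕ) (s : Fin n → J) (v : ∀ i, M.X (s i) ⟶ W),
    IsDecomp (fun i => M.X (s i)) W v := by
  obtain ⟨n, Y, v, hY, hv⟩ := M.semisimple.2 W
  have h : ∀ i, ∃ (r : J) (f : M.X r ⟶ Y i), IsUnitary f := by
    intro i
    obtain ⟨r, ⟨e⟩⟩ := M.exists_iso (Y i) (hY i)
    have he : e.inv ≠ 0 := by
      intro h0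
      apply (hY i).id_ne_zero
      rw [← e.hom_inv_id, h0, comp_zero]
    obtain ⟨c, hc⟩ := (M.simple r).exists_isUnitary (hY i) he
    exact ⟨r, _, hc⟩
  choose s f hf using h
  exact ⟨n, s, fun i => f i ≫ v i, IsDecomp.precomp hv hf⟩

/-- The number of simple summands in a chosen decomposition of an object. -/
noncomputable def len (W : M.carrier) : ℕ := (M.exists_isDecomp W).choose

/-- The labels of the simple summands in a chosen decomposition of an object. -/
noncomputable def lab (W : M.carrier) : Fin (M.len W) → J := (M.exists_isDecomp W).choose_spec.choose

/-- The isometric injections of the simple summands in a chosen decomposition of an object. -/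
noncomputable def inj (W : M.carrier) (i : Fin (M.len W)) : M.X (M.lab W i) ⟶ W :=
  (M.exists_isDecomp W).choose_spec.choose_spec.choose i

theorem isDecomp_inj (W : M.carrier) : IsDecomp (fun i => M.X (M.lab W i)) W (M.inj W) :=
  (M.exists_isDecomp W).choose_spec.choose_spec.choose_spec

/-- The objects of the base generate. -/
theorem hom_ext {W Z : M.carrier} {f g : W ⟶ Z}
    (h : ∀ (r : J) (a : M.X r ⟶ W), a ≫ f = a ≫ g) : f = g :=
  (M.isDecomp_inj W).hom_ext fun _ => h _ _

section

variable {W : M.carrier} {ι : Type*} [Fintype ι] {s : ι → J} {v : ∀ i, M.X (s i) ⟶ W}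

/-- The coordinates of a morphism from an object of the base in a decomposition of the target: only
the summands with the same label contribute. -/
noncomputable def coords (v : ∀ i, M.X (s i) ⟶ W) (r : J) :
    (M.X r ⟶ W) →ₗ[ℂ] ({i // s i = r} → ℂ) where
  toFun f i := (M.simple r).coef (f ≫ adj (v i.1) ≫ eqToHom (by rw [i.2]))
  map_add' f g := funext fun i => by
    rw [add_comp, IsSimple.coef_add]
    rfl
  map_smul' c f := funext fun i => by
    rw [smul_comp, IsSimple.coef_smul]
    rfl

theorem coords_injective (h : IsDecomp (fun i => M.X (s i)) W v) (r : J) :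
    Function.Injective (M.coords v r) := by
  rw [← LinearMap.ker_eq_bot, LinearMap.ker_eq_bot']
  intro f hf
  rw [← h.comp_sum f]
  refine Finset.sum_eq_zero fun i _ => ?_
  by_cases hi : s i = r
  · have h1 : f ≫ adj (v i) ≫ eqToHom (by rw [hi]) = 0 := by
      rw [(M.simple r).eq_coef_smul (f ≫ adj (v i) ≫ eqToHom (by rw [hi]))]
      rw [show (M.simple r).coef (f ≫ adj (v i) ≫ eqToHom _) = 0 from congrFun hf ⟨i, hi⟩, zero_smul]
    have h2 : f ≫ adj (v i) = (f ≫ adj (v i) ≫ eqToHom (by rw [hi])) ≫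
        eqToHom (show M.X r = M.X (s i) by rw [hi]) := by simp
    rw [h2, h1, zero_comp, zero_comp]
  · rw [M.hom_eq_zero (Ne.symm hi) (f ≫ adj (v i)), zero_comp]

theorem finrank_le_card (h : IsDecomp (fun i => M.X (s i)) W v) (r : J) :
    Module.finrank ℂ (M.X r ⟶ W) ≤ Nat.card {i // s i = r} := by
  classical
  have := LinearMap.finrank_le_finrank_of_injective (M.coords_injective h r)
  rwa [Module.finrank_fintype_fun_eq_card, ← Nat.card_eq_fintype_card] at this

/-- The multiplicities of the objects of the base in `W` add up to at most the number of summands. -/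
theorem sum_finrank_le_card (h : IsDecomp (fun i => M.X (s i)) W v) (S : Finset J) :
    ∑ r ∈ S, Module.finrank ℂ (M.X r ⟶ W) ≤ Fintype.card ι := by
  classical
  calc ∑ r ∈ S, Module.finrank ℂ (M.X r ⟶ W)
      ≤ ∑ r ∈ S, (Finset.univ.filter fun i => s i = r).card := by
        refine Finset.sum_le_sum fun r _ => (M.finrank_le_card h r).trans_eq ?_
        rw [Nat.card_eq_fintype_card, Fintype.card_subtype]
    _ ≤ Fintype.card ι := by
        rw [← Finset.card_biUnion]
        · exact Finset.card_le_univ _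
        · intro a _ b _ hab
          exact Finset.disjoint_filter.2 fun i _ h1 h2 => hab (h1.symm.trans h2)

end

instance (r : J) (W : M.carrier) : FiniteDimensional ℂ (M.X r ⟶ W) :=
  FiniteDimensional.of_injective _ (M.coords_injective (M.isDecomp_inj W) r)

end BasedModule

/-! ### Actions of tensor C*-categories -/

namespace ModuleCStarCategory

variable {C : Type u₁} [Category.{v₁} C] [CStarCategory C] [MonoidalCategory C]
  {D : Type u} [Category.{v} D] [CStarCategory D] [MonoidalLeftAction C D]
  [ModuleCStarCategory C D]

open MonoidalLeftAction

variable (D) in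
theorem isCStarFunctor_actionLeft (U : C) : IsCStarFunctor (actionLeft D U) where
  map_add f g := actionHomRight_add U f g
  map_smul c f := actionHomRight_smul U c f
  map_adj f := (adj_actionHomRight U f).symm

variable (C) in
theorem isCStarFunctor_actionRight (X : D) : IsCStarFunctor (actionRight C X) where
  map_add f g := actionHomLeft_add f g X
  map_smul c f := actionHomLeft_smul c f X
  map_adj f := (adj_actionHomLeft f X).symm

theorem norm_actionHomRight_le (U : C) {X Y : D} (f : X ⟶ Y) : ‖U ⊴ₗ f‖ ≤ ‖f‖ :=
  (isCStarFunctor_actionLeft D U).norm_map_le f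

theorem norm_actionHomLeft_le {U V : C} (f : U ⟶ V) (X : D) : ‖f ⊵ₗ X‖ ≤ ‖f‖ :=
  (isCStarFunctor_actionRight C X).norm_map_le f

theorem actionHomRight_sum (U : C) {ι : Type*} (S : Finset ι) {X Y : D} (f : ι → (X ⟶ Y)) :
    U ⊴ₗ (∑ i ∈ S, f i) = ∑ i ∈ S, U ⊴ₗ f i :=
  (isCStarFunctor_actionLeft D U).map_sum S f

@[simp] theorem actionHomRight_zero (U : C) {X Y : D} : U ⊴ₗ (0 : X ⟶ Y) = 0 :=
  (isCStarFunctor_actionLeft D U).map_zero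

theorem adj_assoc_hom (U V : C) (X : D) : adj (αₗ U V X).hom = (αₗ U V X).inv :=
  isUnitary_inv _ (assoc_unitary U V X)

variable (C) in
theorem adj_unit_hom (X : D) : adj (λₗ[C] X).hom = (λₗ[C] X).inv :=
  isUnitary_inv _ (unit_unitary X)

theorem _root_.CStarCategory.IsUnitary.norm_le {X Y : D} {f : X ⟶ Y} (hf : IsUnitary f) :
    ‖f‖ ≤ 1 := by
  have h := norm_comp_adj f
  rw [hf.1] at h
  have h1 := norm_id_le X
  rw [h] at h1
  exact (sq_le_one_iff₀ (norm_nonneg _)).1 h1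

end ModuleCStarCategory

/-! ### Conjugate objects and bandedness -/

namespace ModuleCStarCategory

open MonoidalLeftAction

variable {C : Type u₁} [Category.{v₁} C] [CStarCategory C] [MonoidalCategory C]
  {D : Type u} [Category.{v} D] [MonoidalLeftAction C D]

/-- The morphism `X ⟶ V ⊙ U ⊙ X` induced by a morphism `R : 𝟙 ⟶ V ⊗ U`. -/
def coev {U V : C} (R : 𝟙_ C ⟶ V ⊗ U) (X : D) : X ⟶ V ⊙ₗ U ⊙ₗ X :=
  (λₗ[C] X).inv ≫ R ⊵ₗ X ≫ (αₗ V U X).hom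

/-- The Frobenius transform `Mor(U ⊙ X, Y) → Mor(X, V ⊙ Y)`. -/
def frob {U V : C} (R : 𝟙_ C ⟶ V ⊗ U) {X Y : D} (p : U ⊙ₗ X ⟶ Y) : X ⟶ V ⊙ₗ Y :=
  coev R X ≫ V ⊴ₗ p

/-- The Frobenius transform `Mor(X, V ⊙ Y) → Mor(U ⊙ X, Y)`. -/
def frobInv {U V : C} (R' : 𝟙_ C ⟶ U ⊗ V) {X Y : D} (f : X ⟶ V ⊙ₗ Y) : U ⊙ₗ X ⟶ Y :=
  U ⊴ₗ f ≫ (αₗ U V Y).inv ≫ adj R' ⊵ₗ Y ≫ (λₗ[C] Y).hom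

/-- The first conjugate equation makes the two Frobenius transforms inverse on one side. -/
theorem frobInv_frob {U V : C} (R : 𝟙_ C ⟶ V ⊗ U) (R' : 𝟙_ C ⟶ U ⊗ V)
    (h : (ρ_ U).inv ≫ U ◁ R ≫ (α_ U V U).inv ≫ adj R' ▷ U ≫ (λ_ U).hom = 𝟙 U) {X Y : D}
    (p : U ⊙ₗ X ⟶ Y) : frobInv R' (frob R p) = p := by
  have h1 := congrArg (fun k => k ⊵ₗ X) h
  have hρ : (ρ_ U).inv ⊵ₗ X = U ⊴ₗ (λₗ[C] X).inv ≫ (αₗ U (𝟙_ C) X).inv := by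
    rw [← cancel_epi ((ρ_ U).hom ⊵ₗ X), hom_inv_actionHomLeft, rightUnitor_actionHom]
    simp
  have hα : (α_ U V U).inv ⊵ₗ X = (αₗ U (V ⊗ U) X).hom ≫ U ⊴ₗ (αₗ V U X).hom ≫
      (αₗ U V (U ⊙ₗ X)).inv ≫ (αₗ (U ⊗ V) U X).inv := by
    rw [← cancel_epi ((α_ U V U).hom ⊵ₗ X), hom_inv_actionHomLeft,
      associator_actionHom_assoc]
    simp
  simp only [comp_actionHomLeft, hρ, hα, whiskerLeft_actionHomLeft, whiskerRight_actionHomLeft,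
    leftUnitor_actionHom, id_actionHomLeft, Category.assoc, Iso.inv_hom_id_assoc] at h1
  -- `p` is moved past the contraction, so that what remains is the conjugate equation acting on `X`.
  have h2 : U ⊴ₗ V ⊴ₗ p ≫ (αₗ U V Y).inv ≫ adj R' ⊵ₗ Y ≫ (λₗ[C] Y).hom =
      (αₗ U V (U ⊙ₗ X)).inv ≫ adj R' ⊵ₗ (U ⊙ₗ X) ≫ (λₗ[C] (U ⊙ₗ X)).hom ≫ p := by
    rw [actionUnitIso_hom_naturality, ← action_exchange_assoc, tensor_actionHomRight]
    simp only [Category.assoc, Iso.inv_hom_id_assoc]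
  rw [frobInv, frob, coev]
  simp only [actionHomRight_comp, Category.assoc]
  rw [h2]
  calc _ = (U ⊴ₗ (λₗ[C] X).inv ≫ U ⊴ₗ R ⊵ₗ X ≫ U ⊴ₗ (αₗ V U X).hom ≫
        (αₗ U V (U ⊙ₗ X)).inv ≫ adj R' ⊵ₗ (U ⊙ₗ X) ≫ (λₗ[C] (U ⊙ₗ X)).hom) ≫ p := by
        simp only [Category.assoc]
    _ = p := by rw [h1, Category.id_comp]

variable [CStarCategory D] [ModuleCStarCategory C D]

theorem norm_coev_le {U V : C} (R : 𝟙_ C ⟶ V ⊗ U) (X : D) : ‖coev R X‖ ≤ ‖R‖ := by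
  have h1 : ‖(λₗ[C] X).inv‖ ≤ 1 := (IsUnitary.inv (unit_unitary X)).norm_le
  have h2 : ‖(αₗ V U X).hom‖ ≤ 1 := (assoc_unitary V U X).norm_le
  calc ‖coev R X‖ ≤ ‖(λₗ[C] X).inv‖ * (‖R ⊵ₗ X‖ * ‖(αₗ V U X).hom‖) :=
        (norm_comp_le _ _).trans (by gcongr; exact norm_comp_le _ _)
    _ ≤ 1 * (‖R‖ * 1) := by gcongr; exact norm_actionHomLeft_le R X
    _ = ‖R‖ := by ring

theorem norm_frobInv_le {U V : C} (R' : 𝟙_ C ⟶ U ⊗ V) {X Y : D} (f : X ⟶ V ⊙ₗ Y) :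
    ‖frobInv R' f‖ ≤ ‖f‖ * ‖R'‖ := by
  have h1 : ‖(λₗ[C] Y).hom‖ ≤ 1 := (unit_unitary Y).norm_le
  have h2 : ‖(αₗ U V Y).inv‖ ≤ 1 := (IsUnitary.inv (assoc_unitary U V Y)).norm_le
  have h3 := norm_actionHomLeft_le (adj R') Y
  rw [norm_adj] at h3
  calc ‖frobInv R' f‖ ≤ ‖U ⊴ₗ f‖ * (‖(αₗ U V Y).inv‖ * (‖adj R' ⊵ₗ Y‖ * ‖(λₗ[C] Y).hom‖)) := by
        refine (norm_comp_le _ _).trans ?_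
        gcongr
        refine (norm_comp_le _ _).trans ?_
        gcongr
        exact norm_comp_le _ _
    _ ≤ ‖f‖ * (1 * (‖R'‖ * 1)) := by gcongr; exact norm_actionHomRight_le U f
    _ = ‖f‖ * ‖R'‖ := by ring

/-- The index of a conjugate pair bounds the number of simple summands of `U ⊙ X`, for `X` simple.
With `p i` the projections onto the summands, the positive scalars `(frob p i)* (frob p i)` add up to
`‖coev R X‖² ≤ ‖R‖²`, and each of them is at least `‖R'‖⁻²` since `p i` is recovered from
`frob p i`. -/
theorem card_le_of_isDecomp {U V : C} (R : 𝟙_ C ⟶ V ⊗ U) (R' : 𝟙_ C ⟶ U ⊗ V)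
    (h : (ρ_ U).inv ≫ U ◁ R ≫ (α_ U V U).inv ≫ adj R' ▷ U ≫ (λ_ U).hom = 𝟙 U) {X : D}
    (hX : IsSimple X) {ι : Type*} [Fintype ι] {Y : ι → D} (hY : ∀ i, IsSimple (Y i))
    {v : ∀ i, Y i ⟶ U ⊙ₗ X} (hv : IsDecomp Y (U ⊙ₗ X) v) :
    (Fintype.card ι : ℝ) ≤ ‖R‖ ^ 2 * ‖R'‖ ^ 2 := by
  have h1 : ∀ i, 1 ≤ ‖frob R (adj (v i))‖ ^ 2 * ‖R'‖ ^ 2 := by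
    intro i
    have e1 : ‖v i‖ ^ 2 = 1 := by rw [← norm_comp_adj, hv.1, (hY i).norm_id]
    have e2 := norm_frobInv_le R' (frob R (adj (v i)))
    rw [frobInv_frob R R' h, norm_adj] at e2
    rw [← e1, ← mul_pow]
    gcongr
  have h2 : ∑ i, ‖frob R (adj (v i))‖ ^ 2 = ‖coev R X‖ ^ 2 := by
    have e : ∑ i, frob R (adj (v i)) ≫ adj (frob R (adj (v i))) = coev R X ≫ adj (coev R X) := by
      simp only [frob, adj_comp, adj_actionHomRight, adj_adj, Category.assoc]
      rw [← CStarCategory.comp_sum]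
      congr 1
      simp only [← Category.assoc]
      rw [← CStarCategory.sum_comp]
      simp only [← actionHomRight_comp]
      rw [← actionHomRight_sum, hv.2.2, actionHomRight_id, Category.id_comp]
    simp only [hX.comp_adj_self, ← Finset.sum_smul] at e
    have := hX.smul_id_injective e
    exact_mod_cast this
  calc (Fintype.card ι : ℝ) = ∑ i : ι, (1 : ℝ) := by simp
    _ ≤ ∑ i, ‖frob R (adj (v i))‖ ^ 2 * ‖R'‖ ^ 2 := Finset.sum_le_sum fun i _ => h1 i
    _ = ‖coev R X‖ ^ 2 * ‖R'‖ ^ 2 := by rw [← Finset.sum_mul, h2]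
    _ ≤ ‖R‖ ^ 2 * ‖R'‖ ^ 2 := by gcongr; exact norm_coev_le R X

end ModuleCStarCategory

namespace BasedModule

open ModuleCStarCategory

variable {C : Type u₁} [Category.{v₁} C] [CStarCategory C] [MonoidalCategory C] {J : Type v}
  (M : BasedModule.{u} C J)

/-- Half of Frobenius reciprocity for multiplicities; the other half is not needed. -/
theorem finrank_le_of_conjugate {U V : C} (R : 𝟙_ C ⟶ V ⊗ U) (R' : 𝟙_ C ⟶ U ⊗ V)
    (h : (ρ_ U).inv ≫ U ◁ R ≫ (α_ U V U).inv ≫ adj R' ▷ U ≫ (λ_ U).hom = 𝟙 U) (r s : J) :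
    Module.finrank ℂ (M.X r ⟶ U ⊙ₗ M.X s) ≤ Module.finrank ℂ (M.X s ⟶ V ⊙ₗ M.X r) := by
  let j : (M.X r ⟶ U ⊙ₗ M.X s) →+ (M.X s ⟶ V ⊙ₗ M.X r) :=
    AddMonoidHom.mk' (fun f => frob R (adj f)) fun f g => by
      simp only [frob, adj_add, actionHomRight_add, comp_add]
  have hj : Function.Injective j := fun f g e => adj_injective (by
    rw [← frobInv_frob R R' h (adj f), ← frobInv_frob R R' h (adj g)]
    exact congrArg (frobInv R') e)
  -- `j` is antilinear, so ranks are compared along complex conjugation.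
  have h1 := rank_le_of_surjective_injective (starRingEnd ℂ) j (starRingEnd ℂ).surjective hj
    fun c f => by
      change frob R (adj (c • f)) = _ • frob R (adj f)
      simp only [frob, adj_smul, actionHomRight_smul, comp_smul]
  exact Module.finrank_le_finrank_of_rank_le_rank (by simpa using h1) (Module.rank_lt_aleph0 _ _)

theorem isBanded_of_isRigidCStar (hC : IsRigidCStar C) : M.IsBanded := by
  intro U
  obtain ⟨V, R, R', h, h'⟩ := hC U
  refine ⟨⌈‖R'‖ ^ 2 * ‖R‖ ^ 2⌉₊ + ⌈‖R‖ ^ 2 * ‖R'‖ ^ 2⌉₊, fun r S => ?_⟩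
  rw [Finset.sum_add_distrib]
  refine add_le_add ?_ ?_
  · refine (Finset.sum_le_sum fun s _ => M.finrank_le_of_conjugate R R' h r s).trans ?_
    refine (M.sum_finrank_le_card (M.isDecomp_inj (V ⊙ₗ M.X r)) S).trans ?_
    have := card_le_of_isDecomp R' R h' (M.simple r) (fun i => M.simple _)
      (M.isDecomp_inj (V ⊙ₗ M.X r))
    exact_mod_cast this.trans (Nat.le_ceil _)
  · refine (M.sum_finrank_le_card (M.isDecomp_inj (U ⊙ₗ M.X r)) S).trans ?_
    have := card_le_of_isDecomp R R' h (M.simple r) (fun i => M.simple _)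
      (M.isDecomp_inj (U ⊙ₗ M.X r))
    exact_mod_cast this.trans (Nat.le_ceil _)

theorem isBanded_of_finite [Finite J] : M.IsBanded := by
  have := Fintype.ofFinite J
  intro U
  refine ⟨∑ r, ∑ s, (Module.finrank ℂ (M.X r ⟶ U ⊙ₗ M.X s) +
    Module.finrank ℂ (M.X s ⟶ U ⊙ₗ M.X r)), fun r S => ?_⟩
  refine (Finset.sum_le_sum_of_subset (Finset.subset_univ S)).trans ?_
  exact Finset.single_le_sum (f := fun r => ∑ s, (Module.finrank ℂ (M.X r ⟶ U ⊙ₗ M.X s) +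
    Module.finrank ℂ (M.X s ⟶ U ⊙ₗ M.X r))) (fun _ _ => Nat.zero_le _) (Finset.mem_univ r)

end BasedModule

/-! ### The monoidal structure of bigraded Hilbert spaces on elementary tensors -/

namespace BiHilb

variable {J : Type v}

@[simp] theorem app_whiskerRight_gen {H H' : BiHilb J} (T : H ⟶ H') (K : BiHilb J) (r s t : J)
    (x : H.comp r s) (y : K.comp s t) :
    app (T ▷ K) r t (gen H K s (x ⊗ₜ y)) = gen H' K s (app T r s x ⊗ₜ y) :=
  tensorMap_gen T (𝟙 K) r s t x y

@[simp] theorem app_whiskerLeft_gen (H : BiHilb J) {K K' : BiHilb J} (T : K ⟶ K') (r s t : J)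
    (x : H.comp r s) (y : K.comp s t) :
    app (H ◁ T) r t (gen H K s (x ⊗ₜ y)) = gen H K' s (x ⊗ₜ app T s t y) :=
  tensorMap_gen (𝟙 H) T r s t x y

@[simp] theorem app_tensorHom_gen {H H' K K' : BiHilb J} (T : H ⟶ H') (S : K ⟶ K') (r s t : J)
    (x : H.comp r s) (y : K.comp s t) :
    app (T ⊗ₘ S) r t (gen H K s (x ⊗ₜ y)) = gen H' K' s (app T r s x ⊗ₜ app S s t y) :=
  tensorMap_gen T S r s t x y

@[simp] theorem app_associator_hom_gen (H K L : BiHilb J) (r p s t : J) (x : H.comp r p)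
    (y : K.comp p s) (z : L.comp s t) :
    app (α_ H K L).hom r t (gen (H ⊗ K) L s (gen H K p (x ⊗ₜ y) ⊗ₜ z)) =
      gen H (K ⊗ L) p (x ⊗ₜ gen K L s (y ⊗ₜ z)) :=
  assocUnitary_gen H K L r p s t x y z

@[simp] theorem app_leftUnitor_hom_gen (H : BiHilb J) (r t : J) (y : H.comp r t) :
    app (λ_ H).hom r t (gen (𝟙_ (BiHilb J)) H r (delta r ⊗ₜ y)) = y :=
  leftUnitary_gen H r t y

@[simp] theorem app_rightUnitor_hom_gen (H : BiHilb J) (r t : J) (x : H.comp r t) :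
    app (ρ_ H).hom r t (gen H (𝟙_ (BiHilb J)) t (x ⊗ₜ delta t)) = x :=
  rightUnitary_gen H r t x

theorem comp_apply {H K L : BiHilb J} (T : H ⟶ K) (S : K ⟶ L) (r s : J) (x : H.comp r s) :
    app (T ≫ S) r s x = app S r s (app T r s x) := rfl

theorem tensorObj_hom_ext {H K L : BiHilb J} {T S : H ⊗ K ⟶ L}
    (h : ∀ r s t (x : H.comp r s) (y : K.comp s t),
      app T r t (gen H K s (x ⊗ₜ y)) = app S r t (gen H K s (x ⊗ₜ y))) : T = S :=
  tensor_hom_ext h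

theorem tensorObj_hom_ext₃ {H K L M : BiHilb J} {T S : (H ⊗ K) ⊗ L ⟶ M}
    (h : ∀ r p s t (x : H.comp r p) (y : K.comp p s) (z : L.comp s t),
      app T r t (gen (H ⊗ K) L s (gen H K p (x ⊗ₜ y) ⊗ₜ z)) =
        app S r t (gen (H ⊗ K) L s (gen H K p (x ⊗ₜ y) ⊗ₜ z))) : T = S :=
  tensor_hom_ext₃ h

theorem unit_tensorObj_hom_ext {H K : BiHilb J} {T S : 𝟙_ (BiHilb J) ⊗ H ⟶ K}
    (h : ∀ r t (y : H.comp r t), app T r t (gen (𝟙_ (BiHilb J)) H r (delta r ⊗ₜ y)) =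
      app S r t (gen (𝟙_ (BiHilb J)) H r (delta r ⊗ₜ y))) : T = S :=
  hom_ext_unit_tensor h

theorem tensorObj_unit_hom_ext {H K : BiHilb J} {T S : H ⊗ 𝟙_ (BiHilb J) ⟶ K}
    (h : ∀ r t (x : H.comp r t), app T r t (gen H (𝟙_ (BiHilb J)) t (x ⊗ₜ delta t)) =
      app S r t (gen H (𝟙_ (BiHilb J)) t (x ⊗ₜ delta t))) : T = S :=
  hom_ext_tensor_unit h

theorem unit_hom_ext {H : BiHilb J} {T S : 𝟙_ (BiHilb J) ⟶ H}
    (h : ∀ r, app T r r (delta r) = app S r r (delta r)) : T = S := by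
  refine hom_ext' fun r s (x : (unit J).comp r s) => ?_
  by_cases hrs : r = s
  · subst hrs
    rw [eq_smul_delta x, map_smul, map_smul, h]
  · rw [unit_eq_zero hrs x, map_zero, map_zero]

end BiHilb

/-! ### The graded Hilbert spaces of a based module -/

namespace BandedModule

open ModuleCStarCategory MonoidalLeftAction BiHilb

variable {C : Type u₁} [Category.{v₁} C] [CStarCategory C] [MonoidalCategory C] {J : Type v}
  (M : BandedModule.{u} C J)

/-- The bigraded Hilbert space `⨁ Mor(X r, U ⊙ X s)`. -/
noncomputable def graded (U : C) : BiHilb J where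
  comp r s := M.X r ⟶ U ⊙ₗ M.X s
  normed _ _ := inferInstance
  innerProd r s := (M.simple r).innerProductSpace (U ⊙ₗ M.X s)
  finite r s := inferInstanceAs (FiniteDimensional ℂ (M.X r ⟶ U ⊙ₗ M.X s))
  banded := M.banded U

/-- The elements of the homogeneous components of `M.graded U`, as morphisms. The identification is
the identity; it keeps apart the inner product structure of the former and the composition of the
latter. -/
noncomputable def mor (U : C) (r s : J) : (M.graded U).comp r s ≃ₗ[ℂ] (M.X r ⟶ U ⊙ₗ M.X s) :=
  LinearEquiv.refl ℂ (M.X r ⟶ U ⊙ₗ M.X s)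

theorem norm_mor (U : C) (r s : J) (x : (M.graded U).comp r s) : ‖M.mor U r s x‖ = ‖x‖ := rfl

theorem inner_eq_coef (U : C) (r s : J) (x y : (M.graded U).comp r s) :
    inner ℂ x y = (M.simple r).coef (M.mor U r s y ≫ adj (M.mor U r s x)) := rfl

theorem mor_comp_adj (U : C) (r s : J) (x y : (M.graded U).comp r s) :
    M.mor U r s y ≫ adj (M.mor U r s x) = (inner ℂ x y : ℂ) • 𝟙 (M.X r) := by
  rw [inner_eq_coef]
  exact (M.simple r).eq_coef_smul _

theorem inner_eq_of_comp_adj {U : C} {r s : J} {x y : (M.graded U).comp r s} {c : ℂ}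
    (h : M.mor U r s y ≫ adj (M.mor U r s x) = c • 𝟙 (M.X r)) : inner ℂ x y = c :=
  (M.simple r).coef_eq h

/-- The action of a morphism of `C` on the graded Hilbert spaces. -/
noncomputable def gradedMap {U V : C} (h : U ⟶ V) : M.graded U ⟶ M.graded V :=
  mkHom (fun r s => LinearMap.mkContinuous
    { toFun := fun x => (M.mor V r s).symm (M.mor U r s x ≫ h ⊵ₗ M.X s)
      map_add' := fun x y => by rw [map_add, add_comp, map_add]
      map_smul' := fun c x => by rw [map_smul, smul_comp, map_smul]; rfl } ‖h‖ fun x => by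
        change ‖M.mor U r s x ≫ h ⊵ₗ M.X s‖ ≤ ‖h‖ * ‖x‖
        refine (norm_comp_le _ _).trans ?_
        rw [norm_mor, mul_comm]
        gcongr
        exact norm_actionHomLeft_le h (M.X s)) ‖h‖
    fun r s => LinearMap.mkContinuous_norm_le _ (norm_nonneg h) _

@[simp] theorem mor_gradedMap {U V : C} (h : U ⟶ V) (r s : J) (x : (M.graded U).comp r s) :
    M.mor V r s (app (M.gradedMap h) r s x) = M.mor U r s x ≫ h ⊵ₗ M.X s := rfl

/-- The functor `U ↦ ⨁ Mor(X r, U ⊙ X s)`. -/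
noncomputable def gradedFunctor : C ⥤ BiHilb J where
  obj := M.graded
  map := M.gradedMap
  map_id U := hom_ext' fun r s x => (M.mor U r s).injective (by
    rw [mor_gradedMap, id_actionHomLeft, Category.comp_id]
    rfl)
  map_comp {U V W} f g := hom_ext' fun r s x => (M.mor W r s).injective (by
    rw [comp_apply, mor_gradedMap, mor_gradedMap, mor_gradedMap, comp_actionHomLeft,
      Category.assoc])

theorem gradedMap_add {U V : C} (f g : U ⟶ V) :
    M.gradedMap (f + g) = M.gradedMap f + M.gradedMap g :=
  hom_ext' fun r s x => (M.mor V r s).injective (by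
    rw [app_add, _root_.add_apply, map_add, mor_gradedMap, mor_gradedMap, mor_gradedMap,
      actionHomLeft_add, comp_add])

theorem gradedMap_smul {U V : C} (c : ℂ) (f : U ⟶ V) :
    M.gradedMap (c • f) = c • M.gradedMap f :=
  hom_ext' fun r s x => (M.mor V r s).injective (by
    rw [app_smul, _root_.smul_apply, map_smul, mor_gradedMap, mor_gradedMap,
      actionHomLeft_smul, comp_smul])

theorem gradedMap_adj {U V : C} (f : U ⟶ V) : M.gradedMap (adj f) = adj (M.gradedMap f) :=
  hom_ext fun r s => by
    rw [app_adj]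
    refine (ContinuousLinearMap.eq_adjoint_iff _ _).2 fun x y => ?_
    rw [inner_eq_coef, inner_eq_coef, mor_gradedMap, mor_gradedMap, adj_comp, adj_actionHomLeft,
      adj_adj, Category.assoc]

theorem isCStarFunctor_gradedFunctor : IsCStarFunctor M.gradedFunctor where
  map_add f g := M.gradedMap_add f g
  map_smul c f := M.gradedMap_smul c f
  map_adj f := M.gradedMap_adj f

/-- The product of homogeneous elements: `f ⊗ g ↦ φ* (id ⊙ g) f`. -/
noncomputable def gradedMul (U V : C) (r s t : J) :
    (M.graded U).comp r s →ₗ[ℂ] (M.graded V).comp s t →ₗ[ℂ] (M.graded (U ⊗ V)).comp r t :=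
  LinearMap.mk₂ ℂ (fun x y => (M.mor (U ⊗ V) r t).symm
    (M.mor U r s x ≫ U ⊴ₗ M.mor V s t y ≫ adj (αₗ U V (M.X t)).hom))
    (fun x x' y => by rw [map_add, add_comp, map_add])
    (fun c x y => by rw [map_smul, smul_comp, map_smul])
    (fun x y y' => by rw [map_add, actionHomRight_add, add_comp, comp_add, map_add])
    (fun c x y => by rw [map_smul, actionHomRight_smul, smul_comp, comp_smul, map_smul])

theorem mor_gradedMul (U V : C) (r s t : J) (x : (M.graded U).comp r s)
    (y : (M.graded V).comp s t) : M.mor (U ⊗ V) r t (M.gradedMul U V r s t x y) =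
      M.mor U r s x ≫ U ⊴ₗ M.mor V s t y ≫ adj (αₗ U V (M.X t)).hom := rfl

/-- The product of homogeneous elements, as a linear map on the components of the tensor product. -/
noncomputable def gradedMuMap (U V : C) (r t : J) :
    (tensor (M.graded U) (M.graded V)).comp r t →ₗ[ℂ] (M.graded (U ⊗ V)).comp r t :=
  desc (M.graded U) (M.graded V) fun s => TensorProduct.lift (M.gradedMul U V r s t)

theorem gradedMuMap_gen (U V : C) (r s t : J) (x : (M.graded U).comp r s)
    (y : (M.graded V).comp s t) : M.gradedMuMap U V r t (gen _ _ s (x ⊗ₜ y)) =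
      M.gradedMul U V r s t x y := by
  rw [gradedMuMap, desc_gen, TensorProduct.lift.tmul]

/-- The product is isometric. For elementary tensors, `(x* ⊗ y*)(x' ⊗ y')` is computed from the inside
out: `y* y'` is a scalar, which is zero unless the middle degrees agree. -/
theorem inner_gradedMuMap (U V : C) (r t : J) (a b : (tensor (M.graded U) (M.graded V)).comp r t) :
    inner ℂ (M.gradedMuMap U V r t a) (M.gradedMuMap U V r t b) = inner ℂ a b := by
  refine inner_map_of_ext (M.gradedMuMap U V r t)
    {a | ∃ s, ∃ (x : (M.graded U).comp r s) (y : (M.graded V).comp s t),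
      a = gen (M.graded U) (M.graded V) s (x ⊗ₜ y)}
    (fun φ ψ h => tensor_ext fun s x y => h _ ⟨s, x, y, rfl⟩) ?_ a b
  rintro _ ⟨s, x, y, rfl⟩ _ ⟨s', x', y', rfl⟩
  rw [gradedMuMap_gen, gradedMuMap_gen]
  apply inner_eq_of_comp_adj
  have e : M.mor (U ⊗ V) r t (M.gradedMul U V r s' t x' y') ≫
      adj (M.mor (U ⊗ V) r t (M.gradedMul U V r s t x y)) =
      M.mor U r s' x' ≫ U ⊴ₗ (M.mor V s' t y' ≫ adj (M.mor V s t y)) ≫ adj (M.mor U r s x) := by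
    rw [mor_gradedMul, mor_gradedMul, adj_comp, adj_comp, adj_adj, adj_assoc_hom,
      adj_actionHomRight, actionHomRight_comp]
    simp only [Category.assoc, Iso.inv_hom_id_assoc]
  rw [e]
  by_cases hs : s = s'
  · subst hs
    rw [inner_gen_same, TensorProduct.inner_tmul, mor_comp_adj, actionHomRight_smul,
      actionHomRight_id, smul_comp, comp_smul, Category.id_comp, mor_comp_adj, smul_smul, mul_comm]
  · rw [inner_gen_ne _ _ hs, M.hom_eq_zero (Ne.symm hs) (M.mor V s' t y' ≫ adj (M.mor V s t y)),
      actionHomRight_zero, zero_comp, comp_zero, zero_smul]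

/-- Surjectivity follows from the decomposition of `V ⊙ X t` into objects of the base. -/
theorem gradedMuMap_surjective (U V : C) (r t : J) :
    Function.Surjective (M.gradedMuMap U V r t) := by
  intro k
  let W := V ⊙ₗ M.X t
  let k' : M.X r ⟶ U ⊙ₗ W := M.mor _ r t k ≫ (αₗ U V (M.X t)).hom
  refine ⟨∑ i, gen (M.graded U) (M.graded V) (M.lab W i)
    ((M.mor U r _).symm (k' ≫ U ⊴ₗ adj (M.inj W i)) ⊗ₜ (M.mor V _ t).symm (M.inj W i)), ?_⟩
  apply (M.mor _ r t).injective
  rw [map_sum, map_sum]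
  simp only [gradedMuMap_gen, mor_gradedMul, LinearEquiv.apply_symm_apply, Category.assoc]
  have e : ∑ i, U ⊴ₗ adj (M.inj W i) ≫ U ⊴ₗ M.inj W i ≫ adj (αₗ U V (M.X t)).hom =
      adj (αₗ U V (M.X t)).hom := by
    simp only [← Category.assoc, ← actionHomRight_comp]
    rw [← CStarCategory.sum_comp, ← actionHomRight_sum, (M.isDecomp_inj W).2.2, actionHomRight_id,
      Category.id_comp]
  rw [← CStarCategory.comp_sum, e, adj_assoc_hom]
  simp only [k', Category.assoc, Iso.hom_inv_id, Category.comp_id]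

open Classical in
/-- The linear maps `δ_r ↦ e*` from the components of the unit. -/
noncomputable def gradedEpsMap (r s : J) : (unit J).comp r s →ₗ[ℂ] (M.graded (𝟙_ C)).comp r s :=
  if h : r = s then by
    subst h
    exact (LinearMap.toSpanSingleton ℂ _
      ((M.mor (𝟙_ C) r r).symm (adj (λₗ[C] (M.X r)).hom))).comp (unitCoef rfl)
  else 0

theorem mor_gradedEpsMap_delta (r : J) :
    M.mor (𝟙_ C) r r (M.gradedEpsMap r r (delta r)) = adj (λₗ[C] (M.X r)).hom := by
  rw [gradedEpsMap, dif_pos rfl]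
  simp

theorem inner_gradedEpsMap (r s : J) (x y : (unit J).comp r s) :
    inner ℂ (M.gradedEpsMap r s x) (M.gradedEpsMap r s y) = inner ℂ x y := by
  by_cases h : r = s
  · subst h
    rw [eq_smul_delta x, eq_smul_delta y, map_smul, map_smul]
    simp only [inner_smul_left, inner_smul_right, inner_delta]
    rw [M.inner_eq_of_comp_adj (c := 1)]
    rw [mor_gradedEpsMap_delta, adj_adj, (unit_unitary (C := C) (M.X r)).2, one_smul]
  · rw [unit_eq_zero h x, map_zero, inner_zero_left, inner_zero_left]

theorem gradedEpsMap_surjective (r s : J) : Function.Surjective (M.gradedEpsMap r s) := by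
  intro k
  by_cases h : r = s
  · subst h
    refine ⟨(M.simple r).coef (M.mor _ r r k ≫ (λₗ[C] (M.X r)).hom) • delta r, ?_⟩
    apply (M.mor _ r r).injective
    rw [map_smul, map_smul, mor_gradedEpsMap_delta, ← (M.simple r).comp_eq_coef_smul,
      Category.assoc, (unit_unitary (C := C) (M.X r)).1, Category.comp_id]
  · refine ⟨0, ?_⟩
    apply (M.mor _ r s).injective
    rw [map_zero, map_zero]
    have e := M.hom_eq_zero h (M.mor _ r s k ≫ (λₗ[C] (M.X s)).hom)
    rw [← Category.comp_id (M.mor _ r s k), ← (unit_unitary (C := C) (M.X s)).1, ← Category.assoc,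
      e, zero_comp]

/-- The tensor structure map of the functor `U ↦ ⨁ Mor(X r, U ⊙ X s)`. -/
noncomputable def gradedMu (U V : C) : M.graded U ⊗ M.graded V ≅ M.graded (U ⊗ V) :=
  mkIso fun r t => LinearIsometryEquiv.ofSurjective
    ((M.gradedMuMap U V r t).isometryOfInner (M.inner_gradedMuMap U V r t))
    (M.gradedMuMap_surjective U V r t)

/-- The unit structure map of the functor `U ↦ ⨁ Mor(X r, U ⊙ X s)`. -/
noncomputable def gradedEps : 𝟙_ (BiHilb J) ≅ M.graded (𝟙_ C) :=
  mkIso fun r s => LinearIsometryEquiv.ofSurjective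
    ((M.gradedEpsMap r s).isometryOfInner (M.inner_gradedEpsMap r s))
    (M.gradedEpsMap_surjective r s)

theorem isUnitary_gradedMu (U V : C) : IsUnitary (M.gradedMu U V).hom := isUnitary_mkIso_hom _

theorem isUnitary_gradedEps : IsUnitary M.gradedEps.hom := isUnitary_mkIso_hom _

@[simp] theorem mor_gradedMu_gen (U V : C) (r s t : J) (x : (M.graded U).comp r s)
    (y : (M.graded V).comp s t) :
    M.mor (U ⊗ V) r t (app (M.gradedMu U V).hom r t (gen _ _ s (x ⊗ₜ y))) =
      M.mor U r s x ≫ U ⊴ₗ M.mor V s t y ≫ adj (αₗ U V (M.X t)).hom := by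
  rw [← mor_gradedMul, ← gradedMuMap_gen]
  rfl

@[simp] theorem mor_gradedEps_delta (r : J) :
    M.mor (𝟙_ C) r r (app M.gradedEps.hom r r (delta r)) = adj (λₗ[C] (M.X r)).hom :=
  M.mor_gradedEpsMap_delta r

theorem gradedMu_natural_left {U V : C} (f : U ⟶ V) (W : C) :
    M.gradedMap f ▷ M.graded W ≫ (M.gradedMu V W).hom =
      (M.gradedMu U W).hom ≫ M.gradedMap (f ▷ W) :=
  tensorObj_hom_ext fun r s t x y => (M.mor _ r t).injective (by
    rw [comp_apply, comp_apply, app_whiskerRight_gen]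
    simp only [mor_gradedMu_gen, mor_gradedMap, adj_assoc_hom, Category.assoc,
      whiskerRight_actionHomLeft, Iso.inv_hom_id_assoc]
    rw [action_exchange_assoc])

theorem gradedMu_natural_right {U V : C} (W : C) (f : U ⟶ V) :
    M.graded W ◁ M.gradedMap f ≫ (M.gradedMu W V).hom =
      (M.gradedMu W U).hom ≫ M.gradedMap (W ◁ f) :=
  tensorObj_hom_ext fun r s t x y => (M.mor _ r t).injective (by
    rw [comp_apply, comp_apply, app_whiskerLeft_gen]
    simp only [mor_gradedMu_gen, mor_gradedMap, adj_assoc_hom, Category.assoc,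
      whiskerLeft_actionHomLeft, Iso.inv_hom_id_assoc, actionHomRight_comp])

theorem gradedMu_associativity (U V W : C) :
    (M.gradedMu U V).hom ▷ M.graded W ≫ (M.gradedMu (U ⊗ V) W).hom ≫
        M.gradedMap (α_ U V W).hom =
      (α_ (M.graded U) (M.graded V) (M.graded W)).hom ≫ M.graded U ◁ (M.gradedMu V W).hom ≫
        (M.gradedMu U (V ⊗ W)).hom :=
  tensorObj_hom_ext₃ fun r p s t x y z => (M.mor _ r t).injective (by
    simp only [comp_apply]
    rw [app_whiskerRight_gen, app_associator_hom_gen, app_whiskerLeft_gen]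
    simp only [mor_gradedMu_gen, mor_gradedMap, adj_assoc_hom, Category.assoc,
      actionHomRight_comp, tensor_actionHomRight, Iso.inv_hom_id_assoc]
    congr 3
    rw [← cancel_mono (αₗ U (V ⊗ W) (M.X t)).hom, ← cancel_mono (U ⊴ₗ (αₗ V W (M.X t)).hom)]
    simp)

theorem graded_left_unitality (U : C) :
    (λ_ (M.graded U)).hom = M.gradedEps.hom ▷ M.graded U ≫ (M.gradedMu (𝟙_ C) U).hom ≫
      M.gradedMap (λ_ U).hom :=
  unit_tensorObj_hom_ext fun r t y => (M.mor _ r t).injective (by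
    simp only [comp_apply]
    rw [app_leftUnitor_hom_gen, app_whiskerRight_gen]
    simp only [mor_gradedMu_gen, mor_gradedMap, mor_gradedEps_delta, adj_assoc_hom, adj_unit_hom,
      Category.assoc, leftUnitor_actionHom, Iso.inv_hom_id_assoc]
    rw [← actionUnitIso_hom_naturality, Iso.inv_hom_id_assoc])

theorem graded_right_unitality (U : C) :
    (ρ_ (M.graded U)).hom = M.graded U ◁ M.gradedEps.hom ≫ (M.gradedMu U (𝟙_ C)).hom ≫
      M.gradedMap (ρ_ U).hom :=
  tensorObj_unit_hom_ext fun r t y => (M.mor _ r t).injective (by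
    simp only [comp_apply]
    rw [app_rightUnitor_hom_gen, app_whiskerLeft_gen]
    simp only [mor_gradedMu_gen, mor_gradedMap, mor_gradedEps_delta, adj_assoc_hom, adj_unit_hom,
      Category.assoc, rightUnitor_actionHom, Iso.inv_hom_id_assoc, actionHomRight_inv_hom,
      Category.comp_id])

/-- The strong monoidal structure of the functor `U ↦ ⨁ Mor(X r, U ⊙ X s)`. -/
noncomputable def gradedCoreMonoidal : M.gradedFunctor.CoreMonoidal where
  εIso := M.gradedEps
  μIso := M.gradedMu
  μIso_hom_natural_left f W := M.gradedMu_natural_left f W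
  μIso_hom_natural_right W f := M.gradedMu_natural_right W f
  associativity := M.gradedMu_associativity
  left_unitality := M.graded_left_unitality
  right_unitality := M.graded_right_unitality

noncomputable instance : M.gradedFunctor.Monoidal := M.gradedCoreMonoidal.toMonoidal

theorem ε_gradedFunctor : Functor.LaxMonoidal.ε M.gradedFunctor = M.gradedEps.hom := rfl

theorem μ_gradedFunctor (U V : C) :
    Functor.LaxMonoidal.μ M.gradedFunctor U V = (M.gradedMu U V).hom := rfl

variable [TensorCStarCategory C]

/-- The strong tensor functor `U ↦ ⨁ Mor(X r, U ⊙ X s)`. -/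
noncomputable def strong : StrongTensorFunctor C (BiHilb J) where
  functor := M.gradedFunctor
  isCStar := M.isCStarFunctor_gradedFunctor
  ε_unitary := M.ε_gradedFunctor ▸ M.isUnitary_gradedEps
  μ_unitary U V := M.μ_gradedFunctor U V ▸ M.isUnitary_gradedMu U V

/-- The tautological realization of the functor `U ↦ ⨁ Mor(X r, U ⊙ X s)`. -/
noncomputable def realization : Realization M.toBasedModule M.strong where
  κ U r s := M.mor U r s
  inner_eq U r s x y := M.mor_comp_adj U r s x y
  map_eq f r s x := M.mor_gradedMap f r s x
  tensor_eq U V r s t x y := M.mor_gradedMu_gen U V r s t x y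
  unit_eq r := M.mor_gradedEps_delta r

end BandedModule

/-! ### The transformation induced by a morphism of based modules -/

namespace BasedModule.Hom

open ModuleCStarCategory MonoidalLeftAction

variable {C : Type u₁} [Category.{v₁} C] [CStarCategory C] [MonoidalCategory C] {J : Type v}
  {M N P : BasedModule.{u} C J}

/-- The map `Mor(X r, U ⊙ X s) → Mor(X' r, U ⊙ X' s)` induced by a morphism of based modules. -/
def tr (g : Hom M N) (U : C) (r s : J) (f : M.X r ⟶ U ⊙ₗ M.X s) : N.X r ⟶ U ⊙ₗ N.X s :=
  adj (g.u r) ≫ g.functor.map f ≫ g.ψ U (M.X s) ≫ U ⊴ₗ g.u s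

theorem tr_add (g : Hom M N) (U : C) (r s : J) (f f' : M.X r ⟶ U ⊙ₗ M.X s) :
    g.tr U r s (f + f') = g.tr U r s f + g.tr U r s f' := by
  simp only [tr, g.isCStar.map_add, add_comp, comp_add]

theorem tr_smul (g : Hom M N) (U : C) (r s : J) (c : ℂ) (f : M.X r ⟶ U ⊙ₗ M.X s) :
    g.tr U r s (c • f) = c • g.tr U r s f := by
  simp only [tr, g.isCStar.map_smul, smul_comp, comp_smul]

/-- The maps induced by a morphism of based modules preserve the inner products. -/
theorem tr_comp_adj (g : Hom M N) (U : C) (r s : J) {f f' : M.X r ⟶ U ⊙ₗ M.X s} {c : ℂ}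
    (h : f' ≫ adj f = c • 𝟙 (M.X r)) :
    g.tr U r s f' ≫ adj (g.tr U r s f) = c • 𝟙 (N.X r) := by
  have h1 : g.ψ U (M.X s) ≫ U ⊴ₗ g.u s ≫ U ⊴ₗ adj (g.u s) ≫ adj (g.ψ U (M.X s)) = 𝟙 _ := by
    rw [← actionHomRight_comp_assoc, (g.u_unitary s).1, actionHomRight_id, Category.id_comp,
      (g.ψ_unitary _ _).1]
  calc g.tr U r s f' ≫ adj (g.tr U r s f)
      = adj (g.u r) ≫ g.functor.map f' ≫ (g.ψ U (M.X s) ≫ U ⊴ₗ g.u s ≫ U ⊴ₗ adj (g.u s) ≫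
          adj (g.ψ U (M.X s))) ≫ g.functor.map (adj f) ≫ g.u r := by
        simp only [tr, adj_comp, adj_adj, adj_actionHomRight, g.isCStar.map_adj, Category.assoc]
    _ = adj (g.u r) ≫ g.functor.map (f' ≫ adj f) ≫ g.u r := by
        rw [h1, Category.id_comp, g.functor.map_comp, Category.assoc]
    _ = c • 𝟙 (N.X r) := by
        rw [h, g.isCStar.map_smul, g.functor.map_id, smul_comp, comp_smul, Category.id_comp,
          (g.u_unitary r).2]

/-- A morphism of based modules is full on morphisms out of the objects of the base. -/
theorem exists_map_eq (g : Hom M N) {r : J} {W : M.carrier}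
    (l : g.functor.obj (M.X r) ⟶ g.functor.obj W) : ∃ f : M.X r ⟶ W, g.functor.map f = l := by
  have key : ∀ (s : J) (k : g.functor.obj (M.X r) ⟶ g.functor.obj (M.X s)),
      ∃ a : M.X r ⟶ M.X s, g.functor.map a = k := by
    intro s k
    have hk : k = g.u r ≫ (adj (g.u r) ≫ k ≫ g.u s) ≫ adj (g.u s) := by
      simp only [Category.assoc]
      rw [(g.u_unitary s).1, Category.comp_id, ← Category.assoc, (g.u_unitary r).1,
        Category.id_comp]
    by_cases h : r = s
    · subst h
      refine ⟨(N.simple r).coef (adj (g.u r) ≫ k ≫ g.u r) • 𝟙 _, ?_⟩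
      conv_rhs => rw [hk, (N.simple r).eq_coef_smul (adj (g.u r) ≫ k ≫ g.u r)]
      rw [smul_comp, comp_smul, Category.id_comp, (g.u_unitary r).1, g.isCStar.map_smul,
        g.functor.map_id]
    · refine ⟨0, ?_⟩
      rw [hk, N.hom_eq_zero h (adj (g.u r) ≫ k ≫ g.u s), CStarCategory.zero_comp,
        CStarCategory.comp_zero, g.isCStar.map_zero]
  choose a ha using fun i => key _ (l ≫ g.functor.map (adj (M.inj W i)))
  refine ⟨∑ i, a i ≫ M.inj W i, ?_⟩
  rw [g.isCStar.map_sum]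
  simp only [g.functor.map_comp, ha, g.isCStar.map_adj]
  exact ((M.isDecomp_inj W).map g.isCStar).comp_sum l

theorem tr_surjective (g : Hom M N) (U : C) (r s : J) : Function.Surjective (g.tr U r s) := by
  intro k
  obtain ⟨f, hf⟩ := g.exists_map_eq (g.u r ≫ k ≫ U ⊴ₗ adj (g.u s) ≫ adj (g.ψ U (M.X s)))
  refine ⟨f, ?_⟩
  rw [tr, hf]
  simp only [Category.assoc]
  rw [← Category.assoc (adj (g.ψ U _)), (g.ψ_unitary _ _).2, Category.id_comp,
    ← actionHomRight_comp, (g.u_unitary s).2, actionHomRight_id, Category.comp_id,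
    ← Category.assoc, (g.u_unitary r).2, Category.id_comp]

theorem tr_natural (g : Hom M N) {U V : C} (h : U ⟶ V) (r s : J) (f : M.X r ⟶ U ⊙ₗ M.X s) :
    g.tr V r s (f ≫ h ⊵ₗ M.X s) = g.tr U r s f ≫ h ⊵ₗ N.X s := by
  simp only [tr, g.functor.map_comp, Category.assoc]
  rw [← Category.assoc (g.functor.map (h ⊵ₗ M.X s)), g.ψ_naturality_left, Category.assoc,
    action_exchange]

theorem tr_unit (g : Hom M N) (r : J) :
    g.tr (𝟙_ C) r r (λₗ[C] (M.X r)).inv = (λₗ[C] (N.X r)).inv := by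
  have h : g.functor.map (λₗ[C] (M.X r)).inv ≫ g.ψ (𝟙_ C) (M.X r) =
      (λₗ[C] (g.functor.obj (M.X r))).inv := by
    rw [← cancel_mono (λₗ[C] (g.functor.obj (M.X r))).hom, Category.assoc, g.ψ_unit,
      ← g.functor.map_comp, Iso.inv_hom_id, Iso.inv_hom_id, g.functor.map_id]
  rw [tr, ← Category.assoc (g.functor.map _), h, actionUnitIso_inv_naturality, ← Category.assoc,
    (g.u_unitary r).2, Category.id_comp]

theorem map_assoc_inv (g : Hom M N) (U V : C) (X : M.carrier) :
    g.functor.map (αₗ U V X).inv ≫ g.ψ (U ⊗ V) X =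
      g.ψ U (V ⊙ₗ X) ≫ U ⊴ₗ g.ψ V X ≫ (αₗ U V (g.functor.obj X)).inv := by
  rw [← cancel_mono (αₗ U V (g.functor.obj X)).hom, Category.assoc, ← g.ψ_tensor,
    ← Category.assoc, ← g.functor.map_comp, Iso.inv_hom_id, g.functor.map_id, Category.id_comp]
  simp only [Category.assoc, Iso.inv_hom_id, Category.comp_id]

theorem tr_tensor (g : Hom M N) (U V : C) (r s t : J) (x : M.X r ⟶ U ⊙ₗ M.X s)
    (y : M.X s ⟶ V ⊙ₗ M.X t) :
    g.tr (U ⊗ V) r t (x ≫ U ⊴ₗ y ≫ (αₗ U V (M.X t)).inv) =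
      g.tr U r s x ≫ U ⊴ₗ g.tr V s t y ≫ (αₗ U V (N.X t)).inv := by
  have h1 : U ⊴ₗ g.u s ≫ U ⊴ₗ adj (g.u s) = 𝟙 _ := by
    rw [← actionHomRight_comp, (g.u_unitary s).1, actionHomRight_id]
  simp only [tr, g.functor.map_comp, Category.assoc, actionHomRight_comp]
  rw [← Category.assoc (g.functor.map (αₗ U V (M.X t)).inv), map_assoc_inv,
    ← Category.assoc (U ⊴ₗ g.u s), h1, Category.id_comp,
    ← Category.assoc (g.ψ U (M.X s)) (U ⊴ₗ g.functor.map y), ← g.ψ_naturality_right]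
  simp only [Category.assoc, tensor_actionHomRight, Iso.inv_hom_id_assoc]

theorem tr_id (U : C) (r s : J) (f : M.X r ⟶ U ⊙ₗ M.X s) : (Hom.id M).tr U r s f = f := by
  change adj (𝟙 (M.X r)) ≫ f ≫ 𝟙 (U ⊙ₗ M.X s) ≫ U ⊴ₗ 𝟙 (M.X s) = f
  rw [adj_id, actionHomRight_id, Category.comp_id, Category.comp_id, Category.id_comp]

theorem tr_comp (g : Hom M N) (h : Hom N P) (U : C) (r s : J) (f : M.X r ⟶ U ⊙ₗ M.X s) :
    (g.comp h).tr U r s f = h.tr U r s (g.tr U r s f) := by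
  change adj (h.functor.map (g.u r) ≫ h.u r) ≫ h.functor.map (g.functor.map f) ≫
    (h.functor.map (g.ψ U (M.X s)) ≫ h.ψ U (g.functor.obj (M.X s))) ≫
      U ⊴ₗ (h.functor.map (g.u s) ≫ h.u s) = _
  simp only [tr, adj_comp, h.functor.map_comp, h.isCStar.map_adj, actionHomRight_comp,
    Category.assoc]
  rw [← Category.assoc (h.functor.map (U ⊴ₗ g.u s)), h.ψ_naturality_right, Category.assoc]

theorem Rel.tr_eq {g h : Hom M N} (e : g.Rel h) (U : C) (r s : J) (f : M.X r ⟶ U ⊙ₗ M.X s) :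
    g.tr U r s f = h.tr U r s f := by
  obtain ⟨θ, h1, h2, h3⟩ := e
  rw [tr, tr, ← h3, ← h3, adj_comp, actionHomRight_comp, Category.assoc, ← Category.assoc (g.ψ _ _),
    ← h2, Category.assoc, NatTrans.naturality_assoc, ← Category.assoc (adj (θ.app _)), (h1 _).2,
    Category.id_comp]

end BasedModule.Hom

namespace BandedModule

open ModuleCStarCategory MonoidalLeftAction BiHilb

variable {C : Type u₁} [Category.{v₁} C] [CStarCategory C] [MonoidalCategory C] {J : Type v}
  {M N P : BandedModule.{u} C J}

/-- The unitary between the graded Hilbert spaces of two based modules given by a family of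
surjective linear isometries between the morphism spaces. -/
noncomputable def gradedOfMaps {U : C}
    (t : ∀ r s, (M.X r ⟶ U ⊙ₗ M.X s) →ₗ[ℂ] (N.X r ⟶ U ⊙ₗ N.X s))
    (ht : ∀ r s (f f' : M.X r ⟶ U ⊙ₗ M.X s) (c : ℂ), f' ≫ adj f = c • 𝟙 (M.X r) →
      t r s f' ≫ adj (t r s f) = c • 𝟙 (N.X r))
    (hs : ∀ r s, Function.Surjective (t r s)) : M.graded U ≅ N.graded U :=
  mkIso fun r s => LinearIsometryEquiv.ofSurjective
    (((N.mor U r s).symm.toLinearMap ∘ₗ t r s ∘ₗ (M.mor U r s).toLinearMap).isometryOfInner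
      fun x y => N.inner_eq_of_comp_adj (ht r s _ _ _ (M.mor_comp_adj U r s x y)))
    ((N.mor U r s).symm.surjective.comp ((hs r s).comp (M.mor U r s).surjective))

/-- The unitary between the graded Hilbert spaces induced by a morphism of based modules. -/
noncomputable def gradedTr (g : BasedModule.Hom M.toBasedModule N.toBasedModule) (U : C) :
    M.graded U ≅ N.graded U :=
  gradedOfMaps (fun r s => ⟨⟨g.tr U r s, g.tr_add U r s⟩, g.tr_smul U r s⟩)
    (fun r s _ _ _ h => g.tr_comp_adj U r s h) (fun r s => g.tr_surjective U r s)

@[simp] theorem mor_gradedTr (g : BasedModule.Hom M.toBasedModule N.toBasedModule) (U : C)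
    (r s : J) (x : (M.graded U).comp r s) :
    N.mor U r s (app (gradedTr g U).hom r s x) = g.tr U r s (M.mor U r s x) := rfl

theorem isUnitary_gradedTr (g : BasedModule.Hom M.toBasedModule N.toBasedModule) (U : C) :
    IsUnitary (gradedTr g U).hom := isUnitary_mkIso_hom _

theorem gradedTr_natural (g : BasedModule.Hom M.toBasedModule N.toBasedModule) {U V : C}
    (f : U ⟶ V) : M.gradedMap f ≫ (gradedTr g V).hom = (gradedTr g U).hom ≫ N.gradedMap f :=
  hom_ext' fun r s x => (N.mor V r s).injective (by
    rw [comp_apply, comp_apply, mor_gradedTr, mor_gradedMap, mor_gradedMap, mor_gradedTr,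
      g.tr_natural])

theorem gradedTr_unit (g : BasedModule.Hom M.toBasedModule N.toBasedModule) :
    M.gradedEps.hom ≫ (gradedTr g (𝟙_ C)).hom = N.gradedEps.hom :=
  unit_hom_ext fun r => (N.mor (𝟙_ C) r r).injective (by
    rw [comp_apply, mor_gradedTr, mor_gradedEps_delta, mor_gradedEps_delta, adj_unit_hom,
      adj_unit_hom, g.tr_unit])

theorem gradedTr_tensor (g : BasedModule.Hom M.toBasedModule N.toBasedModule) (U V : C) :
    (M.gradedMu U V).hom ≫ (gradedTr g (U ⊗ V)).hom =
      ((gradedTr g U).hom ⊗ₘ (gradedTr g V).hom) ≫ (N.gradedMu U V).hom :=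
  tensorObj_hom_ext fun r s t x y => (N.mor _ r t).injective (by
    rw [comp_apply, comp_apply, app_tensorHom_gen, mor_gradedTr, mor_gradedMu_gen,
      mor_gradedMu_gen, adj_assoc_hom, adj_assoc_hom, mor_gradedTr, mor_gradedTr, g.tr_tensor])

variable [TensorCStarCategory C]

/-- The monoidal natural unitary induced by a morphism of based modules. -/
noncomputable def strongMap (g : BasedModule.Hom M.toBasedModule N.toBasedModule) :
    M.strong ⟶ N.strong :=
  StrongTensorFunctor.Hom.mk (F := M.strong) (G := N.strong)
    { app := fun U => (gradedTr g U).hom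
      naturality := fun _ _ f => gradedTr_natural g f }
    { unit := gradedTr_unit g
      tensor := gradedTr_tensor g }
    (isUnitary_gradedTr g)

theorem mor_strongMap (g : BasedModule.Hom M.toBasedModule N.toBasedModule) (U : C) (r s : J)
    (x : (M.graded U).comp r s) :
    N.mor U r s (app ((strongMap g).natTrans.app U) r s x) = g.tr U r s (M.mor U r s x) := rfl

theorem strong_hom_ext {a b : M.strong ⟶ N.strong}
    (h : ∀ U r s (x : (M.graded U).comp r s), N.mor U r s (app (a.natTrans.app U) r s x) =
      N.mor U r s (app (b.natTrans.app U) r s x)) : a = b :=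
  StrongTensorFunctor.Hom.ext (NatTrans.ext (funext fun U =>
    hom_ext' fun r s x => (N.mor U r s).injective (h U r s x)))

variable (C J) in
/-- The functor from banded based modules to strong tensor functors. -/
noncomputable def strongFunctor : BandedModule.{u} C J ⥤ StrongTensorFunctor C (BiHilb J) where
  obj M := M.strong
  map {M N} a := Quotient.lift (s := BasedModule.homSetoid M.toBasedModule N.toBasedModule)
    (fun g => strongMap g) (fun g h e => strong_hom_ext fun U r s x => by
      rw [mor_strongMap, mor_strongMap]
      exact BasedModule.Hom.Rel.tr_eq e U r s _) a
  map_id M := strong_hom_ext fun U r s x => BasedModule.Hom.tr_id U r s _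
  map_comp {M N P} a b := by
    induction a using Quotient.inductionOn with
    | _ g =>
    induction b using Quotient.inductionOn with
    | _ h => exact strong_hom_ext fun U r s x => BasedModule.Hom.tr_comp g h U r s _

theorem strongFunctor_map_toClass (g : BasedModule.Hom M.toBasedModule N.toBasedModule) :
    (strongFunctor C J).map (X := M) (Y := N) g.toClass = strongMap g := rfl

end BandedModule

/-! ### Reconstruction of morphisms of based modules -/

namespace BasedModule

open ModuleCStarCategory MonoidalLeftAction

variable {C : Type u₁} [Category.{v₁} C] [CStarCategory C] [MonoidalCategory C] {J : Type v}
  {M N : BasedModule.{u} C J}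

open Classical in
/-- The bijection `Mor(X r, X s) → Mor(X' r, X' s)` between spaces of scalars (for `r = s`) or zero
spaces (for `r ≠ s`), where `X' r` are the objects of the base of `N`. -/
noncomputable def transfer (N : BasedModule.{u} C J) {r s : J} (b : M.X r ⟶ M.X s) :
    N.X r ⟶ N.X s :=
  if h : r = s then (M.simple r).coef (b ≫ eqToHom (by rw [h])) • eqToHom (by rw [h]) else 0

theorem transfer_self {r : J} (b : M.X r ⟶ M.X r) :
    transfer N b = (M.simple r).coef b • 𝟙 (N.X r) := by
  rw [transfer, dif_pos rfl, eqToHom_refl, eqToHom_refl, Category.comp_id]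

theorem transfer_zero {r s : J} : transfer N (0 : M.X r ⟶ M.X s) = 0 := by
  by_cases h : r = s
  · subst h
    rw [transfer_self, IsSimple.coef_zero, zero_smul]
  · rw [transfer, dif_neg h]

theorem transfer_id (r : J) : transfer N (𝟙 (M.X r)) = 𝟙 (N.X r) := by
  rw [transfer_self, IsSimple.coef_id, one_smul]

theorem transfer_add {r s : J} (a b : M.X r ⟶ M.X s) :
    transfer N (a + b) = transfer N a + transfer N b := by
  by_cases h : r = s
  · subst h
    rw [transfer_self, transfer_self, transfer_self, IsSimple.coef_add, add_smul]
  · rw [M.hom_eq_zero h a, M.hom_eq_zero h b, add_zero, transfer_zero, add_zero]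

theorem transfer_smul {r s : J} (c : ℂ) (a : M.X r ⟶ M.X s) :
    transfer N (c • a) = c • transfer N a := by
  by_cases h : r = s
  · subst h
    rw [transfer_self, transfer_self, IsSimple.coef_smul, mul_smul]
  · rw [M.hom_eq_zero h a, smul_zero, transfer_zero, smul_zero]

theorem transfer_adj {r s : J} (a : M.X r ⟶ M.X s) :
    transfer N (adj a) = adj (transfer N a) := by
  by_cases h : r = s
  · subst h
    rw [transfer_self, transfer_self, IsSimple.coef_adj, adj_smul, adj_id]
  · rw [M.hom_eq_zero h a, adj_zero, transfer_zero, transfer_zero, adj_zero]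

namespace Hom

theorem adj_u_map (g : Hom M N) {r s : J} (b : M.X r ⟶ M.X s) :
    adj (g.u r) ≫ g.functor.map b = transfer N b ≫ adj (g.u s) := by
  by_cases h : r = s
  · subst h
    rw [transfer_self, smul_comp, Category.id_comp]
    conv_lhs => rw [(M.simple r).eq_coef_smul b]
    rw [g.isCStar.map_smul, g.functor.map_id, comp_smul, Category.comp_id]
  · rw [M.hom_eq_zero h b, g.isCStar.map_zero, transfer_zero, CStarCategory.comp_zero,
      CStarCategory.zero_comp]

theorem isDecomp_adj_u_map (g : Hom M N) (W : M.carrier) :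
    IsDecomp (fun i => N.X (M.lab W i)) (g.functor.obj W)
      (fun i => adj (g.u (M.lab W i)) ≫ g.functor.map (M.inj W i)) :=
  ((M.isDecomp_inj W).map g.isCStar).precomp fun _ => (g.u_unitary _).adj

theorem hom_ext (g : Hom M N) {W : M.carrier} {Z : N.carrier} {p q : g.functor.obj W ⟶ Z}
    (h : ∀ r (a : M.X r ⟶ W), adj (g.u r) ≫ g.functor.map a ≫ p =
      adj (g.u r) ≫ g.functor.map a ≫ q) : p = q :=
  (g.isDecomp_adj_u_map W).hom_ext fun i => by
    rw [Category.assoc, Category.assoc]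
    exact h _ _

theorem _root_.BasedModule.sum_comp_action (M : BasedModule.{u} C J) {U : C} {W : M.carrier}
    {Z : M.carrier} (k : Z ⟶ U ⊙ₗ W) :
    ∑ i, (k ≫ U ⊴ₗ adj (M.inj W i)) ≫ U ⊴ₗ M.inj W i = k := by
  have h := ((M.isDecomp_inj W).map (isCStarFunctor_actionLeft M.carrier U)).comp_sum k
  simp only [← (isCStarFunctor_actionLeft M.carrier U).map_adj] at h
  exact h

theorem hom_ext_action (g : Hom M N) {U : C} {W : M.carrier} {Z : N.carrier}
    {p q : g.functor.obj (U ⊙ₗ W) ⟶ Z}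
    (h : ∀ r s (f : M.X r ⟶ U ⊙ₗ M.X s) (a : M.X s ⟶ W),
      adj (g.u r) ≫ g.functor.map (f ≫ U ⊴ₗ a) ≫ p =
        adj (g.u r) ≫ g.functor.map (f ≫ U ⊴ₗ a) ≫ q) : p = q :=
  g.hom_ext fun r k => by
    rw [← M.sum_comp_action k, g.isCStar.map_sum, sum_comp, sum_comp, comp_sum, comp_sum]
    exact Finset.sum_congr rfl fun i _ => h _ _ _ _

/-- The module structure of a morphism of based modules is determined by the maps that it induces. -/
theorem adj_u_map_ψ (g : Hom M N) {U : C} {W : M.carrier} {r s : J} (f : M.X r ⟶ U ⊙ₗ M.X s)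
    (a : M.X s ⟶ W) : adj (g.u r) ≫ g.functor.map (f ≫ U ⊴ₗ a) ≫ g.ψ U W =
      g.tr U r s f ≫ U ⊴ₗ (adj (g.u s) ≫ g.functor.map a) := by
  rw [tr, actionHomRight_comp, g.functor.map_comp, Category.assoc, g.ψ_naturality_right]
  simp only [Category.assoc]
  rw [← Category.assoc (U ⊴ₗ g.u s), ← actionHomRight_comp, (g.u_unitary s).1, actionHomRight_id,
    Category.id_comp]

/-- The comparison of the underlying functors of two morphisms of based modules: the unique natural
transformation compatible with the unitaries on the objects of the base. -/
noncomputable def compare (g h : Hom M N) (W : M.carrier) : g.functor.obj W ⟶ h.functor.obj W :=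
  matching (fun i => adj (g.u (M.lab W i)) ≫ g.functor.map (M.inj W i))
    (fun i => adj (h.u (M.lab W i)) ≫ h.functor.map (M.inj W i))

theorem adj_u_map_compare (g h : Hom M N) {W : M.carrier} {r : J} (a : M.X r ⟶ W) :
    adj (g.u r) ≫ g.functor.map a ≫ compare g h W = adj (h.u r) ≫ h.functor.map a := by
  rw [← (M.isDecomp_inj W).comp_sum a, g.isCStar.map_sum, h.isCStar.map_sum, sum_comp, comp_sum,
    comp_sum]
  refine Finset.sum_congr rfl fun i _ => ?_
  have e := (g.isDecomp_adj_u_map W).comp_matching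
    (fun i => adj (h.u (M.lab W i)) ≫ h.functor.map (M.inj W i)) i
  rw [g.functor.map_comp, h.functor.map_comp, Category.assoc, ← Category.assoc (adj (g.u r)),
    adj_u_map, ← Category.assoc (adj (h.u r)), adj_u_map, Category.assoc, Category.assoc, ← e,
    Category.assoc]
  rfl

/-- A morphism of based modules is determined, up to identification, by the maps that it induces on
the spaces `Mor(X r, U ⊙ X s)`. -/
theorem rel_of_tr_eq {g h : Hom M N} (e : ∀ U r s f, g.tr U r s f = h.tr U r s f) : g.Rel h := by
  refine ⟨⟨compare g h, fun W W' f => ?_⟩, fun W => ?_, fun U W => ?_, fun r => ?_⟩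
  · refine g.hom_ext fun r a => ?_
    rw [← Category.assoc (g.functor.map a), ← g.functor.map_comp, adj_u_map_compare,
      h.functor.map_comp]
    simp only [← Category.assoc]
    rw [← adj_u_map_compare g h a]
    simp only [Category.assoc]
  · exact (g.isDecomp_adj_u_map W).isUnitary_matching (h.isDecomp_adj_u_map W)
  · refine g.hom_ext_action fun r s f a => ?_
    calc _ = (adj (g.u r) ≫ g.functor.map (f ≫ U ⊴ₗ a) ≫ compare g h (U ⊙ₗ W)) ≫ h.ψ U W := by
          simp only [Category.assoc]
      _ = h.tr U r s f ≫ U ⊴ₗ (adj (h.u s) ≫ h.functor.map a) := by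
          rw [adj_u_map_compare, Category.assoc, adj_u_map_ψ]
      _ = (adj (g.u r) ≫ g.functor.map (f ≫ U ⊴ₗ a) ≫ g.ψ U W) ≫ U ⊴ₗ compare g h W := by
          rw [adj_u_map_ψ, e, Category.assoc, ← actionHomRight_comp, Category.assoc,
            adj_u_map_compare]
      _ = _ := by simp only [Category.assoc]
  · refine g.hom_ext fun q a => ?_
    change adj (g.u q) ≫ g.functor.map a ≫ compare g h (M.X r) ≫ h.u r = _
    calc _ = (adj (g.u q) ≫ g.functor.map a ≫ compare g h (M.X r)) ≫ h.u r := by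
          simp only [Category.assoc]
      _ = transfer N a := by
          rw [adj_u_map_compare, adj_u_map, Category.assoc, (h.u_unitary r).2, Category.comp_id]
      _ = _ := by
          rw [← Category.assoc, adj_u_map, Category.assoc, (g.u_unitary r).2, Category.comp_id]

end Hom

/-! ### The extension of `X r ↦ X' r` to a C*-functor -/

theorem exists_extObj (N : BasedModule.{u} C J) (W : M.carrier) : ∃ (Z : N.carrier)
    (w : ∀ i, N.X (M.lab W i) ⟶ Z), IsDecomp (fun i => N.X (M.lab W i)) Z w :=
  N.semisimple.1 (M.len W) fun i => N.X (M.lab W i)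

/-- The direct sum in `N` of the simple objects with the labels of the summands of `W`. -/
noncomputable def extObj (N : BasedModule.{u} C J) (W : M.carrier) : N.carrier :=
  (exists_extObj N W).choose

/-- The isometric injections of the summands of `extObj N W`. -/
noncomputable def extInj (N : BasedModule.{u} C J) (W : M.carrier) (i : Fin (M.len W)) :
    N.X (M.lab W i) ⟶ extObj N W :=
  (exists_extObj N W).choose_spec.choose i

theorem isDecomp_extInj (N : BasedModule.{u} C J) (W : M.carrier) :
    IsDecomp (fun i => N.X (M.lab W i)) (extObj N W) (extInj N W) :=
  (exists_extObj N W).choose_spec.choose_spec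

/-- The extension of `transfer` to morphisms with values in an arbitrary object: `Mor(X r, W)` is
identified with `Mor(X' r, extObj N W)`. -/
noncomputable def lift (N : BasedModule.{u} C J) {W : M.carrier} {r : J} (a : M.X r ⟶ W) :
    N.X r ⟶ extObj N W :=
  ∑ i, transfer N (a ≫ adj (M.inj W i)) ≫ extInj N W i

theorem transfer_comp {q r s : J} (a : M.X q ⟶ M.X r) (b : M.X r ⟶ M.X s) :
    transfer N (a ≫ b) = transfer N a ≫ transfer N b := by
  by_cases h : q = r
  · subst h
    rw [transfer_self, smul_comp, Category.id_comp, (M.simple q).comp_eq_coef_smul, transfer_smul]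
  · rw [M.hom_eq_zero h a, CStarCategory.zero_comp, transfer_zero, transfer_zero,
      CStarCategory.zero_comp]

theorem lift_add {W : M.carrier} {r : J} (a b : M.X r ⟶ W) :
    lift N (a + b) = lift N a + lift N b := by
  simp only [lift, add_comp, transfer_add, Finset.sum_add_distrib]

theorem lift_smul {W : M.carrier} {r : J} (c : ℂ) (a : M.X r ⟶ W) :
    lift N (c • a) = c • lift N a := by
  simp only [lift, smul_comp, transfer_smul, Finset.smul_sum]

theorem lift_sum {W : M.carrier} {r : J} {ι : Type*} (S : Finset ι) (a : ι → (M.X r ⟶ W)) :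
    lift N (∑ i ∈ S, a i) = ∑ i ∈ S, lift N (a i) :=
  map_sum (AddMonoidHom.mk' (fun a : M.X r ⟶ W => lift N a) lift_add) a S

theorem lift_comp {W : M.carrier} {q r : J} (b : M.X q ⟶ M.X r) (a : M.X r ⟶ W) :
    lift N (b ≫ a) = transfer N b ≫ lift N a := by
  simp only [lift, comp_sum, Category.assoc, transfer_comp b]

/-- `lift` preserves the inner products of `Mor(X r, W)`. -/
theorem lift_comp_adj {W : M.carrier} {q r : J} (a : M.X q ⟶ W) (b : M.X r ⟶ W) :
    lift N a ≫ adj (lift N b) = transfer N (a ≫ adj b) := by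
  have h : ∀ i, extInj N W i ≫ adj (lift N b) = transfer N (M.inj W i ≫ adj b) := by
    intro i
    rw [lift, adj_sum, comp_sum, Finset.sum_eq_single i]
    · rw [adj_comp, ← Category.assoc, (isDecomp_extInj N W).1, Category.id_comp, ← transfer_adj,
        adj_comp, adj_adj]
    · intro j _ hj
      rw [adj_comp, ← Category.assoc, (isDecomp_extInj N W).2.1 i j hj.symm,
        CStarCategory.zero_comp]
    · exact fun hi => (hi (Finset.mem_univ i)).elim
  conv_rhs => rw [← (M.isDecomp_inj W).comp_sum a, sum_comp]
  rw [lift, sum_comp]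
  have h2 : transfer N (∑ i, ((a ≫ adj (M.inj W i)) ≫ M.inj W i) ≫ adj b) =
      ∑ i, transfer N (((a ≫ adj (M.inj W i)) ≫ M.inj W i) ≫ adj b) :=
    map_sum (AddMonoidHom.mk' (fun a : M.X q ⟶ M.X r => transfer N a) transfer_add) _ _
  rw [h2]
  refine Finset.sum_congr rfl fun i _ => ?_
  rw [Category.assoc, h, ← transfer_comp]
  simp only [Category.assoc]

theorem lift_inj (W : M.carrier) (i : Fin (M.len W)) : lift N (M.inj W i) = extInj N W i := by
  rw [lift, Finset.sum_eq_single i]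
  · rw [(M.isDecomp_inj W).1, transfer_id, Category.id_comp]
  · intro j _ hj
    rw [(M.isDecomp_inj W).2.1 i j hj.symm, transfer_zero, CStarCategory.zero_comp]
  · exact fun hi => (hi (Finset.mem_univ i)).elim

theorem ext_hom_ext {W : M.carrier} {Z : N.carrier} {p q : extObj N W ⟶ Z}
    (h : ∀ r (a : M.X r ⟶ W), lift N a ≫ p = lift N a ≫ q) : p = q :=
  (isDecomp_extInj N W).hom_ext fun i => by
    rw [← lift_inj]
    exact h _ _

/-- The extension functor on morphisms: the morphism `extObj N W ⟶ extObj N W'` that composes with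
`lift N a` to `lift N (a ≫ f)`. -/
noncomputable def extMap (N : BasedModule.{u} C J) {W W' : M.carrier} (f : W ⟶ W') :
    extObj N W ⟶ extObj N W' :=
  matching (extInj N W) fun i => lift N (M.inj W i ≫ f)

theorem lift_extMap {W W' : M.carrier} {r : J} (a : M.X r ⟶ W) (f : W ⟶ W') :
    lift N a ≫ extMap N f = lift N (a ≫ f) := by
  conv_rhs => rw [← (M.isDecomp_inj W).comp_sum a, sum_comp]
  rw [lift_sum, lift, sum_comp]
  refine Finset.sum_congr rfl fun i _ => ?_
  rw [Category.assoc, extMap, (isDecomp_extInj N W).comp_matching, ← lift_comp]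
  simp only [Category.assoc]

/-- The C*-functor that sends `X r` to `X' r`. -/
noncomputable def extFunctor (M N : BasedModule.{u} C J) : M.carrier ⥤ N.carrier where
  obj W := extObj N W
  map f := extMap N f
  map_id W := ext_hom_ext fun r a => by rw [lift_extMap, Category.comp_id, Category.comp_id]
  map_comp f g := ext_hom_ext fun r a => by
    rw [lift_extMap, ← Category.assoc (lift N a), lift_extMap, lift_extMap, Category.assoc]

theorem isCStarFunctor_extFunctor : IsCStarFunctor (extFunctor M N) where
  map_add {W W'} f g := by
    have h : extMap N (f + g) = extMap N f + extMap N g := ext_hom_ext fun r a => by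
      simp only [lift_extMap, comp_add, lift_add]
    exact h
  map_smul {W W'} c f := by
    have h : extMap N (c • f) = c • extMap N f := ext_hom_ext fun r a => by
      simp only [lift_extMap, comp_smul, lift_smul]
    exact h
  map_adj {W W'} f := by
    have h : extMap N (adj f) = adj (extMap N f) := ext_hom_ext fun r a =>
      adj_injective (ext_hom_ext fun s b => by
        rw [lift_extMap, lift_comp_adj, adj_comp, adj_comp, adj_adj, adj_adj, ← Category.assoc,
          ← Category.assoc, lift_extMap, lift_comp_adj])
    exact h

theorem isUnitary_adj_lift_id (r : J) : IsUnitary (adj (lift N (𝟙 (M.X r)))) := by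
  constructor
  · refine ext_hom_ext fun q a => ?_
    rw [adj_adj, ← Category.assoc, lift_comp_adj, ← lift_comp, adj_id, Category.comp_id,
      Category.comp_id, Category.comp_id]
  · rw [adj_adj, lift_comp_adj, adj_id, Category.comp_id, transfer_id]

theorem isDecomp_lift {W : M.carrier} {ι : Type*} [Fintype ι] {s : ι → J}
    {v : ∀ i, M.X (s i) ⟶ W} (h : IsDecomp (fun i => M.X (s i)) W v) :
    IsDecomp (fun i => N.X (s i)) (extObj N W) (fun i => lift N (v i)) := by
  have h1 : IsDecomp (fun i => N.X (s i)) (extObj N W)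
      (fun i => adj (adj (lift N (𝟙 (M.X (s i))))) ≫ extMap N (v i)) :=
    (h.map (isCStarFunctor_extFunctor (M := M) (N := N))).precomp
      fun i => (isUnitary_adj_lift_id (N := N) (s i)).adj
  simpa only [adj_adj, lift_extMap, Category.id_comp] using h1

/-- The structure that a monoidal natural unitary induces on the spaces `Mor(X r, U ⊙ X s)`: isometric
bijections that are natural in `U` and compatible with products and units. -/
structure Comparison (M N : BasedModule.{u} C J) where
  t : ∀ (U : C) (r s : J), (M.X r ⟶ U ⊙ₗ M.X s) →ₗ[ℂ] (N.X r ⟶ U ⊙ₗ N.X s)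
  comp_adj : ∀ {U : C} {r s : J} {f f' : M.X r ⟶ U ⊙ₗ M.X s} {c : ℂ},
    f' ≫ adj f = c • 𝟙 (M.X r) → t U r s f' ≫ adj (t U r s f) = c • 𝟙 (N.X r)
  surjective : ∀ U r s, Function.Surjective (t U r s)
  natural : ∀ {U V : C} (h : U ⟶ V) (r s : J) (f : M.X r ⟶ U ⊙ₗ M.X s),
    t V r s (f ≫ h ⊵ₗ M.X s) = t U r s f ≫ h ⊵ₗ N.X s
  unit : ∀ r, t (𝟙_ C) r r (λₗ[C] (M.X r)).inv = (λₗ[C] (N.X r)).inv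
  tensor : ∀ (U V : C) (r s q : J) (x : M.X r ⟶ U ⊙ₗ M.X s) (y : M.X s ⟶ V ⊙ₗ M.X q),
    t (U ⊗ V) r q (x ≫ U ⊴ₗ y ≫ (αₗ U V (M.X q)).inv) =
      t U r s x ≫ U ⊴ₗ t V s q y ≫ (αₗ U V (N.X q)).inv

namespace Comparison

variable (η : Comparison M N)

theorem t_comp {U : C} {q r s : J} (b : M.X q ⟶ M.X r) (f : M.X r ⟶ U ⊙ₗ M.X s) :
    η.t U q s (b ≫ f) = transfer N b ≫ η.t U r s f := by
  by_cases h : q = r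
  · subst h
    rw [(M.simple q).comp_eq_coef_smul, transfer_self, map_smul, smul_comp, Category.id_comp]
  · rw [M.hom_eq_zero h b, CStarCategory.zero_comp, transfer_zero, CStarCategory.zero_comp,
      map_zero]

theorem t_comp_action {U : C} {q r s : J} (f : M.X q ⟶ U ⊙ₗ M.X r) (b : M.X r ⟶ M.X s) :
    η.t U q s (f ≫ U ⊴ₗ b) = η.t U q r f ≫ U ⊴ₗ transfer N b := by
  by_cases h : r = s
  · subst h
    conv_lhs => rw [(M.simple r).eq_coef_smul b]
    rw [transfer_self, actionHomRight_smul, actionHomRight_smul, actionHomRight_id,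
      actionHomRight_id, comp_smul, comp_smul, Category.comp_id, Category.comp_id, map_smul]
  · rw [M.hom_eq_zero h b, transfer_zero, actionHomRight_zero, actionHomRight_zero,
      CStarCategory.comp_zero, CStarCategory.comp_zero, map_zero]

theorem t_comp_adj {U : C} {q r s : J} (f : M.X q ⟶ U ⊙ₗ M.X s) (f' : M.X r ⟶ U ⊙ₗ M.X s) :
    η.t U q s f ≫ adj (η.t U r s f') = transfer N (f ≫ adj f') := by
  by_cases h : q = r
  · subst h
    rw [transfer_self]
    exact η.comp_adj ((M.simple q).eq_coef_smul _)
  · rw [M.hom_eq_zero h (f ≫ adj f'), transfer_zero]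
    exact N.hom_eq_zero h _

theorem isDecomp_t {U : C} {q : J} {ι : Type*} [Fintype ι] {s : ι → J}
    {v : ∀ i, M.X (s i) ⟶ U ⊙ₗ M.X q} (h : IsDecomp (fun i => M.X (s i)) (U ⊙ₗ M.X q) v) :
    IsDecomp (fun i => N.X (s i)) (U ⊙ₗ N.X q) (fun i => η.t U (s i) q (v i)) := by
  refine ⟨fun i => ?_, fun i j hij => ?_, N.hom_ext fun r a => ?_⟩
  · rw [t_comp_adj, h.1, transfer_id]
  · rw [t_comp_adj, h.2.1 i j hij, transfer_zero]
  · obtain ⟨f, rfl⟩ := η.surjective U r q a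
    rw [Category.comp_id, comp_sum]
    conv_rhs => rw [← h.comp_sum f, map_sum]
    refine Finset.sum_congr rfl fun i _ => ?_
    rw [← Category.assoc, t_comp_adj, t_comp]

/-- The index set of the decomposition of `U ⊙ W` into objects of the base that is obtained by
decomposing `W` first. -/
abbrev Idx (M : BasedModule.{u} C J) (U : C) (W : M.carrier) : Type :=
  Σ i : Fin (M.len W), Fin (M.len (U ⊙ₗ M.X (M.lab W i)))

theorem isDecomp_action (M : BasedModule.{u} C J) (U : C) (W : M.carrier) :
    IsDecomp (fun p : Idx M U W => M.X (M.lab (U ⊙ₗ M.X (M.lab W p.1)) p.2)) (U ⊙ₗ W)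
      (fun p => M.inj (U ⊙ₗ M.X (M.lab W p.1)) p.2 ≫ U ⊴ₗ M.inj W p.1) :=
  ((M.isDecomp_inj W).map (isCStarFunctor_actionLeft M.carrier U)).sigma
    fun i => M.isDecomp_inj (U ⊙ₗ M.X (M.lab W i))

theorem isDecomp_t_action (U : C) (W : M.carrier) :
    IsDecomp (fun p : Idx M U W => N.X (M.lab (U ⊙ₗ M.X (M.lab W p.1)) p.2)) (U ⊙ₗ extObj N W)
      (fun p => η.t U _ _ (M.inj (U ⊙ₗ M.X (M.lab W p.1)) p.2) ≫ U ⊴ₗ extInj N W p.1) :=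
  ((isDecomp_extInj N W).map (isCStarFunctor_actionLeft N.carrier U)).sigma
    fun i => η.isDecomp_t (M.isDecomp_inj (U ⊙ₗ M.X (M.lab W i)))

/-- The module structure of the extension functor. It matches the decompositions of both sides that
arise from decomposing `W` first. -/
noncomputable def ψ (U : C) (W : M.carrier) : extObj N (U ⊙ₗ W) ⟶ U ⊙ₗ extObj N W :=
  matching (fun p : Idx M U W => lift N (M.inj (U ⊙ₗ M.X (M.lab W p.1)) p.2 ≫ U ⊴ₗ M.inj W p.1))
    (fun p => η.t U _ _ (M.inj (U ⊙ₗ M.X (M.lab W p.1)) p.2) ≫ U ⊴ₗ extInj N W p.1)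

theorem isUnitary_ψ (U : C) (W : M.carrier) : IsUnitary (η.ψ U W) :=
  (isDecomp_lift (isDecomp_action M U W)).isUnitary_matching (η.isDecomp_t_action U W)

/-- The characterization of the module structure of the extension functor, free of the choice of
decompositions. -/
theorem lift_ψ {U : C} {W : M.carrier} {r s : J} (f : M.X r ⟶ U ⊙ₗ M.X s) (a : M.X s ⟶ W) :
    lift N (f ≫ U ⊴ₗ a) ≫ η.ψ U W = η.t U r s f ≫ U ⊴ₗ lift N a := by
  conv_lhs => rw [← (isDecomp_action M U W).comp_sum (f ≫ U ⊴ₗ a), lift_sum, sum_comp]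
  have h : ∀ p : Idx M U W, lift N (M.inj (U ⊙ₗ M.X (M.lab W p.1)) p.2 ≫ U ⊴ₗ M.inj W p.1) ≫
      η.ψ U W = η.t U _ _ (M.inj (U ⊙ₗ M.X (M.lab W p.1)) p.2) ≫ U ⊴ₗ extInj N W p.1 :=
    (isDecomp_lift (isDecomp_action M U W)).comp_matching _
  rw [Fintype.sum_sigma, lift, actionHomRight_sum, comp_sum]
  refine Finset.sum_congr rfl fun i _ => ?_
  rw [actionHomRight_comp, ← Category.assoc, ← t_comp_action]
  conv_rhs => rw [← (M.isDecomp_inj (U ⊙ₗ M.X (M.lab W i))).comp_sum (f ≫ U ⊴ₗ (a ≫ _)), map_sum,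
    sum_comp]
  refine Finset.sum_congr rfl fun k _ => ?_
  rw [lift_comp, Category.assoc, h ⟨i, k⟩, t_comp, Category.assoc, adj_comp, adj_actionHomRight,
    actionHomRight_comp]
  simp only [Category.assoc]

/-- The morphisms `lift N (f ≫ U ⊴ₗ a)` are jointly epimorphic: the coherence conditions for `ψ` need
to be checked only on these, where `lift_ψ` evaluates `ψ`. -/
theorem ext_hom_ext_action {U : C} {W : M.carrier} {Z : N.carrier} {p q : extObj N (U ⊙ₗ W) ⟶ Z}
    (h : ∀ r s (f : M.X r ⟶ U ⊙ₗ M.X s) (a : M.X s ⟶ W),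
      lift N (f ≫ U ⊴ₗ a) ≫ p = lift N (f ≫ U ⊴ₗ a) ≫ q) : p = q :=
  ext_hom_ext fun r k => by
    rw [← M.sum_comp_action k, lift_sum, sum_comp, sum_comp]
    exact Finset.sum_congr rfl fun i _ => h _ _ _ _

theorem ext_hom_ext_tensor {U V : C} {W : M.carrier} {Z : N.carrier}
    {p q : extObj N ((U ⊗ V) ⊙ₗ W) ⟶ Z}
    (h : ∀ r s t (x : M.X r ⟶ U ⊙ₗ M.X s) (y : M.X s ⟶ V ⊙ₗ M.X t) (a : M.X t ⟶ W),
      lift N ((x ≫ U ⊴ₗ y ≫ (αₗ U V (M.X t)).inv) ≫ (U ⊗ V) ⊴ₗ a) ≫ p =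
        lift N ((x ≫ U ⊴ₗ y ≫ (αₗ U V (M.X t)).inv) ≫ (U ⊗ V) ⊴ₗ a) ≫ q) : p = q :=
  ext_hom_ext_action fun r t f a => by
    have e : f = ∑ i, ((f ≫ (αₗ U V (M.X t)).hom) ≫ U ⊴ₗ adj (M.inj _ i)) ≫
        U ⊴ₗ M.inj (V ⊙ₗ M.X t) i ≫ (αₗ U V (M.X t)).inv := by
      have e1 := congrArg (· ≫ (αₗ U V (M.X t)).inv)
        (M.sum_comp_action (f ≫ (αₗ U V (M.X t)).hom))
      simp only [sum_comp, Category.assoc, Iso.hom_inv_id, Category.comp_id] at e1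
      simpa only [Category.assoc] using e1.symm
    rw [e, sum_comp, lift_sum, sum_comp, sum_comp]
    exact Finset.sum_congr rfl fun i _ => h _ _ _ _ _ _

theorem ψ_unit (W : M.carrier) :
    η.ψ (𝟙_ C) W ≫ (λₗ[C] (extObj N W)).hom = extMap N (λₗ[C] W).hom :=
  ext_hom_ext_action fun r s f a => by
    have e : f = (f ≫ (λₗ[C] (M.X s)).hom) ≫ (λₗ[C] (M.X s)).inv := by simp
    rw [← Category.assoc, lift_ψ, lift_extMap, Category.assoc, Category.assoc,
      ← actionUnitIso_hom_naturality, ← actionUnitIso_hom_naturality]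
    conv_lhs => rw [e]
    rw [t_comp, η.unit, Category.assoc, Iso.inv_hom_id_assoc, ← lift_comp, Category.assoc]

theorem ψ_tensor (U V : C) (W : M.carrier) :
    extMap N (αₗ U V W).hom ≫ η.ψ U (V ⊙ₗ W) ≫ U ⊴ₗ η.ψ V W =
      η.ψ (U ⊗ V) W ≫ (αₗ U V (extObj N W)).hom :=
  ext_hom_ext_tensor fun r s t x y a => by
    have e : ((x ≫ U ⊴ₗ y ≫ (αₗ U V (M.X t)).inv) ≫ (U ⊗ V) ⊴ₗ a) ≫ (αₗ U V W).hom =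
        x ≫ U ⊴ₗ (y ≫ V ⊴ₗ a) := by
      simp
    rw [← Category.assoc, lift_extMap, e, ← Category.assoc, lift_ψ, ← Category.assoc, lift_ψ,
      Category.assoc, ← actionHomRight_comp, lift_ψ, η.tensor]
    simp

theorem ψ_naturality_left {U V : C} (h : U ⟶ V) (W : M.carrier) :
    extMap N (h ⊵ₗ W) ≫ η.ψ V W = η.ψ U W ≫ h ⊵ₗ extObj N W :=
  ext_hom_ext_action fun r s f a => by
    rw [← Category.assoc, lift_extMap, Category.assoc, action_exchange, ← Category.assoc, lift_ψ,
      ← Category.assoc, lift_ψ, Category.assoc, action_exchange, η.natural, Category.assoc]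

theorem ψ_naturality_right (U : C) {W W' : M.carrier} (k : W ⟶ W') :
    extMap N (U ⊴ₗ k) ≫ η.ψ U W' = η.ψ U W ≫ U ⊴ₗ extMap N k :=
  ext_hom_ext_action fun r s f a => by
    rw [← Category.assoc, lift_extMap, Category.assoc, ← actionHomRight_comp, lift_ψ,
      ← Category.assoc, lift_ψ, Category.assoc, ← actionHomRight_comp, lift_extMap]

/-- The morphism of based modules reconstructed from its effect on the spaces
`Mor(X r, U ⊙ X s)`. -/
noncomputable def hom : Hom M N where
  functor := extFunctor M N
  isCStar := isCStarFunctor_extFunctor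
  ψ := η.ψ
  ψ_unitary := η.isUnitary_ψ
  ψ_naturality_left := η.ψ_naturality_left
  ψ_naturality_right := η.ψ_naturality_right
  ψ_unit := η.ψ_unit
  ψ_tensor := η.ψ_tensor
  u r := adj (lift N (𝟙 (M.X r)))
  u_unitary := isUnitary_adj_lift_id

theorem tr_hom (U : C) (r s : J) (f : M.X r ⟶ U ⊙ₗ M.X s) : η.hom.tr U r s f = η.t U r s f := by
  change adj (adj (lift N (𝟙 (M.X r)))) ≫ extMap N f ≫ η.ψ U (M.X s) ≫
    U ⊴ₗ adj (lift N (𝟙 (M.X s))) = _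
  have e := η.lift_ψ f (𝟙 (M.X s))
  rw [actionHomRight_id, Category.comp_id] at e
  rw [adj_adj, ← Category.assoc, lift_extMap, Category.id_comp, ← Category.assoc, e, Category.assoc,
    ← actionHomRight_comp, lift_comp_adj, adj_id, Category.comp_id, transfer_id, actionHomRight_id,
    Category.comp_id]

end Comparison

end BasedModule

/-! ### Fullness and faithfulness -/

namespace BandedModule

open ModuleCStarCategory MonoidalLeftAction BiHilb

variable {C : Type u₁} [Category.{v₁} C] [CStarCategory C] [MonoidalCategory C] {J : Type v}
  {M N : BandedModule.{u} C J}

/-- The linear maps between morphism spaces given by an operator between graded Hilbert spaces. -/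
noncomputable def morMap {U : C} (T : M.graded U ⟶ N.graded U) (r s : J) :
    (M.X r ⟶ U ⊙ₗ M.X s) →ₗ[ℂ] (N.X r ⟶ U ⊙ₗ N.X s) :=
  (N.mor U r s).toLinearMap ∘ₗ (app T r s).toLinearMap ∘ₗ (M.mor U r s).symm.toLinearMap

theorem morMap_mor {U : C} (T : M.graded U ⟶ N.graded U) (r s : J) (x : (M.graded U).comp r s) :
    morMap T r s (M.mor U r s x) = N.mor U r s (app T r s x) := rfl

theorem _root_.BiHilb.IsUnitary.inner_app {H K : BiHilb J} {T : H ⟶ K} (hT : IsUnitary T) (r s : J)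
    (x y : H.comp r s) : inner ℂ (app T r s x) (app T r s y) = inner ℂ x y := by
  rw [← ContinuousLinearMap.adjoint_inner_left, ← app_adj, ← comp_apply, hT.1]
  rfl

theorem _root_.BiHilb.IsUnitary.surjective_app {H K : BiHilb J} {T : H ⟶ K} (hT : IsUnitary T)
    (r s : J) : Function.Surjective (app T r s) := fun y =>
  ⟨app (adj T) r s y, by rw [← comp_apply, hT.2]; rfl⟩

/-- A monoidal natural unitary between the functors of two based modules, seen as maps between the
morphism spaces. -/
noncomputable def comparison (T : ∀ U : C, M.graded U ⟶ N.graded U) (hT : ∀ U, IsUnitary (T U))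
    (natural : ∀ {U V : C} (f : U ⟶ V), M.gradedMap f ≫ T V = T U ≫ N.gradedMap f)
    (unit : M.gradedEps.hom ≫ T (𝟙_ C) = N.gradedEps.hom)
    (tensor : ∀ U V : C, (M.gradedMu U V).hom ≫ T (U ⊗ V) =
      (T U ⊗ₘ T V) ≫ (N.gradedMu U V).hom) :
    BasedModule.Comparison M.toBasedModule N.toBasedModule where
  t U r s := morMap (T U) r s
  comp_adj {U r s f f' c} h := by
    obtain ⟨x, rfl⟩ := (M.mor U r s).surjective f
    obtain ⟨x', rfl⟩ := (M.mor U r s).surjective f'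
    rw [morMap_mor, morMap_mor, mor_comp_adj, BiHilb.IsUnitary.inner_app (hT U),
      M.inner_eq_of_comp_adj h]
  surjective U r s := (N.mor U r s).surjective.comp
    ((BiHilb.IsUnitary.surjective_app (hT U) r s).comp (M.mor U r s).symm.surjective)
  natural {U V} h r s f := by
    obtain ⟨x, rfl⟩ := (M.mor U r s).surjective f
    rw [← mor_gradedMap, morMap_mor, morMap_mor, ← mor_gradedMap, ← comp_apply, natural]
    rfl
  unit r := by
    rw [← adj_unit_hom, ← adj_unit_hom, ← mor_gradedEps_delta, morMap_mor, ← comp_apply, unit,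
      mor_gradedEps_delta]
  tensor U V r s q x y := by
    obtain ⟨x, rfl⟩ := (M.mor U r s).surjective x
    obtain ⟨y, rfl⟩ := (M.mor V s q).surjective y
    rw [← adj_assoc_hom, ← adj_assoc_hom, ← mor_gradedMu_gen, morMap_mor, morMap_mor, morMap_mor,
      ← comp_apply, tensor, comp_apply, app_tensorHom_gen, mor_gradedMu_gen]

variable [TensorCStarCategory C]

/-- Equality of the transformations is equality of the induced maps on `Mor(X r, U ⊙ X s)`. -/
instance : (strongFunctor C J : BandedModule.{u} C J ⥤ _).Faithful where
  map_injective {M N a b} h := by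
    induction a using Quotient.inductionOn with
    | _ g =>
    induction b using Quotient.inductionOn with
    | _ g' =>
    refine Quotient.sound (BasedModule.Hom.rel_of_tr_eq fun U r s f => ?_)
    obtain ⟨x, rfl⟩ := (M.mor U r s).surjective f
    have h' : strongMap g = strongMap g' := h
    rw [← mor_strongMap, ← mor_strongMap, h']

/-- A monoidal natural unitary is induced by the morphism reconstructed from it. -/
instance : (strongFunctor C J : BandedModule.{u} C J ⥤ _).Full where
  map_surjective {M N} a := by
    have ha := a.isMonoidal
    let η : BasedModule.Comparison M.toBasedModule N.toBasedModule :=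
      comparison (fun U => a.natTrans.app U) a.unitary (fun f => a.natTrans.naturality f)
        ha.unit ha.tensor
    refine ⟨η.hom.toClass, ?_⟩
    rw [strongFunctor_map_toClass]
    refine strong_hom_ext fun U r s x => ?_
    rw [mor_strongMap, η.tr_hom]
    rfl

end BandedModule

/-! ### Transport of an action to a small model -/

/-- A family `ι` of objects of `E`, closed up to unitary isomorphism under tensoring with the objects
`F U` on the left. The object `ι (act U s)` is a chosen copy of `F U ⊗ ι s`; the family then carries
an action of `C`, with structure morphisms transported along the isomorphisms `iso`. -/
structure ActionModel {C : Type u₁} [Category.{v₁} C] [CStarCategory C] [MonoidalCategory C]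
    [TensorCStarCategory C] {E : Type*} [Category.{v} E] [CStarCategory E] [MonoidalCategory E]
    [TensorCStarCategory E] (F : StrongTensorFunctor C E) {S : Type*} (ι : S → E) where
  act : C → S → S
  iso : ∀ U s, ι (act U s) ≅ F.functor.obj U ⊗ ι s
  unitary : ∀ U s, IsUnitary (iso U s).hom

namespace ActionModel

open Functor.LaxMonoidal Functor.OplaxMonoidal Functor.Monoidal

variable {C : Type u₁} [Category.{v₁} C] [CStarCategory C] [MonoidalCategory C]
  [TensorCStarCategory C] {E : Type*} [Category.{v} E] [CStarCategory E] [MonoidalCategory E]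
  [TensorCStarCategory E] {F : StrongTensorFunctor C E} {S : Type*} {ι : S → E}
  (A : ActionModel F ι)

/-- The action of a morphism of `C` on an object of the family. -/
def left {U V : C} (f : U ⟶ V) (s : S) : ι (A.act U s) ⟶ ι (A.act V s) :=
  (A.iso U s).hom ≫ F.functor.map f ▷ ι s ≫ (A.iso V s).inv

/-- The action of an object of `C` on a morphism between objects of the family. -/
def right (U : C) {s t : S} (g : ι s ⟶ ι t) : ι (A.act U s) ⟶ ι (A.act U t) :=
  (A.iso U s).hom ≫ F.functor.obj U ◁ g ≫ (A.iso U t).inv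

/-- The associativity isomorphism of the transported action. -/
def assoc (U V : C) (s : S) : ι (A.act (U ⊗ V) s) ≅ ι (A.act U (A.act V s)) :=
  A.iso (U ⊗ V) s ≪≫ whiskerRightIso (μIso F.functor U V).symm (ι s) ≪≫
    α_ (F.functor.obj U) (F.functor.obj V) (ι s) ≪≫
      whiskerLeftIso (F.functor.obj U) (A.iso V s).symm ≪≫ (A.iso U (A.act V s)).symm

/-- The unit isomorphism of the transported action. -/
def unit (s : S) : ι (A.act (𝟙_ C) s) ≅ ι s :=
  A.iso (𝟙_ C) s ≪≫ whiskerRightIso (εIso F.functor).symm (ι s) ≪≫ λ_ (ι s)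

theorem right_id (U : C) (s : S) : A.right U (𝟙 (ι s)) = 𝟙 _ := by simp [right]

theorem id_left (U : C) (s : S) : A.left (𝟙 U) s = 𝟙 _ := by simp [left]

theorem left_comp {U V W : C} (f : U ⟶ V) (g : V ⟶ W) (s : S) :
    A.left (f ≫ g) s = A.left f s ≫ A.left g s := by simp [left]

theorem right_comp (U : C) {s t q : S} (f : ι s ⟶ ι t) (g : ι t ⟶ ι q) :
    A.right U (f ≫ g) = A.right U f ≫ A.right U g := by simp [right]

theorem exchange {U V : C} (f : U ⟶ V) {s t : S} (g : ι s ⟶ ι t) :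
    A.right U g ≫ A.left f t = A.left f s ≫ A.right V g := by
  simp [left, right, whisker_exchange_assoc]

theorem hom_comp {U V W : C} (f : U ⟶ V) (f' : V ⟶ W) {s t q : S} (g : ι s ⟶ ι t) (g' : ι t ⟶ ι q) :
    A.left (f ≫ f') s ≫ A.right W (g ≫ g') =
      (A.left f s ≫ A.right V g) ≫ A.left f' t ≫ A.right W g' := by
  rw [left_comp, right_comp, Category.assoc, Category.assoc, ← Category.assoc (A.right V g),
    exchange, Category.assoc]

theorem assoc_naturality {U U' V V' : C} {s t : S} (f : U ⟶ U') (g : V ⟶ V') (h : ι s ⟶ ι t) :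
    (A.left (f ⊗ₘ g) s ≫ A.right (U' ⊗ V') h) ≫ (A.assoc U' V' t).hom =
      (A.assoc U V s).hom ≫ A.left f (A.act V s) ≫ A.right U' (A.left g s ≫ A.right V' h) := by
  have h1 : F.functor.map (f ▷ V) ▷ ι s ≫ δ F.functor U' V ▷ ι s =
      δ F.functor U V ▷ ι s ≫ F.functor.map f ▷ F.functor.obj V ▷ ι s := by
    rw [← comp_whiskerRight, ← δ_natural_left, comp_whiskerRight]
  have h2 : F.functor.map (U' ◁ g) ▷ ι s ≫ δ F.functor U' V' ▷ ι s =
      δ F.functor U' V ▷ ι s ≫ (F.functor.obj U' ◁ F.functor.map g) ▷ ι s := by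
    rw [← comp_whiskerRight, ← δ_natural_right, comp_whiskerRight]
  simp only [left, right, assoc, MonoidalCategory.tensorHom_def, Iso.trans_hom, Functor.map_comp,
    comp_whiskerRight, Category.assoc, Iso.inv_hom_id_assoc, whiskerRightIso_hom, Iso.symm_hom,
    μIso_inv, whiskerLeftIso_hom, MonoidalCategory.whiskerLeft_comp]
  rw [whisker_exchange_assoc, ← Category.assoc (F.functor.map (U' ◁ g) ▷ ι s), h2, Category.assoc,
    ← Category.assoc (F.functor.map (f ▷ V) ▷ ι s), h1, whisker_exchange_assoc]
  simp

theorem unit_naturality {s t : S} (f : ι s ⟶ ι t) :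
    (A.unit s).hom ≫ f = A.right (𝟙_ C) f ≫ (A.unit t).hom := by
  simp [right, unit, whisker_exchange_assoc]

theorem whiskerLeft_left (U : C) {V W : C} (f : V ⟶ W) (s : S) :
    A.left (U ◁ f) s = (A.assoc U V s).hom ≫ A.right U (A.left f s) ≫ (A.assoc U W s).inv := by
  simp [left, right, assoc]
  rw [Functor.Monoidal.map_whiskerLeft]
  simp only [comp_whiskerRight, whisker_assoc, Category.assoc]

theorem whiskerRight_left {U V : C} (W : C) (f : U ⟶ V) (s : S) :
    A.left (f ▷ W) s = (A.assoc U W s).hom ≫ A.left f (A.act W s) ≫ (A.assoc V W s).inv := by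
  simp [left, assoc]
  rw [Functor.Monoidal.map_whiskerRight, whisker_exchange_assoc]
  simp only [comp_whiskerRight, whiskerRight_tensor, Category.assoc, whiskerLeft_inv_hom_assoc,
    Iso.hom_inv_id_assoc]

theorem associator_left (U V W : C) (s : S) :
    A.left (α_ U V W).hom s ≫ (A.assoc U (V ⊗ W) s).hom ≫ A.right U (A.assoc V W s).hom =
      (A.assoc (U ⊗ V) W s).hom ≫ (A.assoc U V (A.act W s)).hom := by
  simp [left, right, assoc]
  rw [Functor.Monoidal.map_associator, whisker_exchange_assoc]
  simp only [comp_whiskerRight, Category.assoc, whiskerRight_tensor, tensor_whiskerLeft,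
    Iso.inv_hom_id_assoc]
  rw [← comp_whiskerRight_assoc (μ F.functor U (V ⊗ W)), μ_δ, id_whiskerRight, Category.id_comp,
    ← associator_naturality_middle_assoc, ← comp_whiskerRight_assoc (_ ◁ _), ← MonoidalCategory.whiskerLeft_comp, μ_δ,
    MonoidalCategory.whiskerLeft_id, id_whiskerRight, Category.id_comp,
    pentagon_assoc, Iso.hom_inv_id_assoc]

theorem leftUnitor_left (U : C) (s : S) :
    A.left (λ_ U).hom s = (A.assoc (𝟙_ C) U s).hom ≫ (A.unit (A.act U s)).hom := by
  simp [left, assoc, unit]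
  rw [Functor.Monoidal.map_leftUnitor, whisker_exchange_assoc]
  simp only [comp_whiskerRight, Category.assoc, whiskerRight_tensor, leftUnitor_whiskerRight,
    Iso.hom_inv_id_assoc, id_whiskerLeft, Iso.inv_hom_id, Category.comp_id]

theorem rightUnitor_left (U : C) (s : S) :
    A.left (ρ_ U).hom s = (A.assoc U (𝟙_ C) s).hom ≫ A.right U (A.unit s).hom := by
  simp [left, right, assoc, unit]
  rw [Functor.Monoidal.map_rightUnitor]
  simp only [comp_whiskerRight, Category.assoc, whisker_assoc, Iso.inv_hom_id_assoc, ← triangle_assoc]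

end ActionModel

namespace ActionModel

open Functor.LaxMonoidal Functor.OplaxMonoidal Functor.Monoidal

variable {C : Type u₁} [Category.{v₁} C] [CStarCategory C] [MonoidalCategory C]
  [TensorCStarCategory C] {E : Type*} [Category.{v} E] [CStarCategory E] [MonoidalCategory E]
  [TensorCStarCategory E] {F : StrongTensorFunctor C E} {S : Type*} {ι : S → E}

/-- The index set of a family of objects of `E`, as the set of objects of the full subcategory
spanned by the family. -/
def Carrier (_ : ActionModel F ι) := S

variable (A : ActionModel F ι)

/-- The object of `E` with a given index. -/
def toObj (s : A.Carrier) : E := ι s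

instance : Category.{v} A.Carrier where
  Hom s t := A.toObj s ⟶ A.toObj t
  id s := 𝟙 (A.toObj s)
  comp f g := CategoryStruct.comp (obj := E) f g
  id_comp f := Category.id_comp (obj := E) f
  comp_id f := Category.comp_id (obj := E) f
  assoc f g h := Category.assoc (obj := E) f g h

instance : CStarCategory A.Carrier where
  normedAddCommGroup s t := normedAddCommGroup (A.toObj s) (A.toObj t)
  normedSpace s t := normedSpace (A.toObj s) (A.toObj t)
  completeSpace s t := completeSpace (A.toObj s) (A.toObj t)
  add_comp f g h := add_comp (D := E) f g h
  comp_add f g h := comp_add (D := E) f g h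
  smul_comp c f g := smul_comp (D := E) c f g
  comp_smul c f g := comp_smul (D := E) c f g
  norm_comp_le f g := norm_comp_le (D := E) f g
  adj f := adj (D := E) f
  adj_adj f := adj_adj (D := E) f
  adj_add f g := adj_add (D := E) f g
  adj_smul c f := adj_smul (D := E) c f
  adj_comp f g := adj_comp (D := E) f g
  norm_comp_adj f := norm_comp_adj (D := E) f
  positive f := positive (D := E) f

/-- An isomorphism in `E`, as an isomorphism in the full subcategory. -/
def mkIso {s t : A.Carrier} (e : A.toObj s ≅ A.toObj t) : s ≅ t :=
  ⟨e.hom, e.inv, e.hom_inv_id, e.inv_hom_id⟩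

/-- An isomorphism in the full subcategory, as an isomorphism in `E`. -/
def objIso {s t : A.Carrier} (e : s ≅ t) : A.toObj s ≅ A.toObj t :=
  ⟨e.hom, e.inv, e.hom_inv_id, e.inv_hom_id⟩

instance : MonoidalLeftAction C A.Carrier where
  actionObj U s := A.act U s
  actionHomLeft f s := A.left f s
  actionHomRight U _ _ g := A.right U g
  actionAssocIso U V s := A.mkIso (A.assoc U V s)
  actionUnitIso s := A.mkIso (A.unit s)
  actionHom_def _ _ := rfl
  actionHomRight_id U s := A.right_id U s
  id_actionHomLeft U s := A.id_left U s
  actionHom_comp f f' g g' := A.hom_comp f f' g g'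
  actionAssocIso_hom_naturality f g h := A.assoc_naturality f g h
  actionUnitIso_hom_naturality f := A.unit_naturality f
  whiskerLeft_actionHomLeft U _ _ f s := A.whiskerLeft_left U f s
  whiskerRight_actionHomLeft W f s := A.whiskerRight_left W f s
  associator_actionHom U V W s := A.associator_left U V W s
  leftUnitor_actionHom U s := A.leftUnitor_left U s
  rightUnitor_actionHom U s := A.rightUnitor_left U s

theorem unit_inv (s : S) : (A.unit s).inv =
    ((λ_ (ι s)).inv ≫ ε F.functor ▷ ι s) ≫ (A.iso (𝟙_ C) s).inv := rfl

theorem right_comp_assoc_inv (U V : C) {s t : S} (g : ι s ⟶ ι (A.act V t)) :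
    A.right U g ≫ (A.assoc U V t).inv = (A.iso U s).hom ≫
      F.functor.obj U ◁ (g ≫ (A.iso V t).hom) ≫ (α_ (F.functor.obj U) (F.functor.obj V) (ι t)).inv ≫
        μ F.functor U V ▷ ι t ≫ (A.iso (U ⊗ V) t).inv := by
  simp [right, assoc]

theorem adj_iso_hom (U : C) (s : S) : adj (A.iso U s).hom = (A.iso U s).inv :=
  isUnitary_inv _ (A.unitary U s)

theorem adj_iso_inv (U : C) (s : S) : adj (A.iso U s).inv = (A.iso U s).hom := by
  rw [← adj_iso_hom, adj_adj]

theorem isUnitary_assoc (U V : C) (s : S) : IsUnitary (A.assoc U V s).hom := by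
  have h1 : IsUnitary (δ F.functor U V) := IsUnitary.inv (e := μIso F.functor U V) (F.μ_unitary U V)
  refine (A.unitary _ s).comp (.comp ?_ (.comp ?_ (.comp ?_ ?_)))
  · exact h1.map (F := tensorRight (ι s)) ⟨fun f g => TensorCStarCategory.whiskerRight_add f g _,
      fun c f => TensorCStarCategory.whiskerRight_smul c f _,
      fun f => (TensorCStarCategory.adj_whiskerRight f _).symm⟩
  · exact TensorCStarCategory.associator_unitary _ _ _
  · exact (A.unitary V s).inv.map (F := tensorLeft (F.functor.obj U))
      ⟨fun f g => TensorCStarCategory.whiskerLeft_add _ f g,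
      fun c f => TensorCStarCategory.whiskerLeft_smul _ c f,
      fun f => (TensorCStarCategory.adj_whiskerLeft _ f).symm⟩
  · exact (A.unitary U _).inv

theorem isUnitary_unit (s : S) : IsUnitary (A.unit s).hom := by
  have h1 : IsUnitary (η F.functor) := IsUnitary.inv (e := εIso F.functor) F.ε_unitary
  refine (A.unitary _ s).comp (.comp ?_ (TensorCStarCategory.leftUnitor_unitary _))
  exact h1.map (F := tensorRight (ι s)) ⟨fun f g => TensorCStarCategory.whiskerRight_add f g _,
    fun c f => TensorCStarCategory.whiskerRight_smul c f _,
    fun f => (TensorCStarCategory.adj_whiskerRight f _).symm⟩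

theorem left_add {U V : C} (f g : U ⟶ V) (s : S) : A.left (f + g) s = A.left f s + A.left g s := by
  simp only [left, F.isCStar.map_add, TensorCStarCategory.whiskerRight_add, comp_add, add_comp]

theorem left_smul {U V : C} (c : ℂ) (f : U ⟶ V) (s : S) : A.left (c • f) s = c • A.left f s := by
  simp only [left, F.isCStar.map_smul, TensorCStarCategory.whiskerRight_smul, comp_smul, smul_comp]

theorem right_add (U : C) {s t : S} (f g : ι s ⟶ ι t) :
    A.right U (f + g) = A.right U f + A.right U g := by
  simp only [right, TensorCStarCategory.whiskerLeft_add, comp_add, add_comp]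

theorem right_smul (U : C) {s t : S} (c : ℂ) (f : ι s ⟶ ι t) :
    A.right U (c • f) = c • A.right U f := by
  simp only [right, TensorCStarCategory.whiskerLeft_smul, comp_smul, smul_comp]

theorem adj_left {U V : C} (f : U ⟶ V) (s : S) : adj (A.left f s) = A.left (adj f) s := by
  simp only [left, adj_comp, adj_iso_hom, adj_iso_inv, F.isCStar.map_adj,
    TensorCStarCategory.adj_whiskerRight, Category.assoc]

theorem adj_right (U : C) {s t : S} (f : ι s ⟶ ι t) : adj (A.right U f) = A.right U (adj f) := by
  simp only [right, adj_comp, adj_iso_hom, adj_iso_inv,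
    TensorCStarCategory.adj_whiskerLeft, Category.assoc]

instance : ModuleCStarCategory C A.Carrier where
  actionHomLeft_add f g s := A.left_add f g s
  actionHomLeft_smul c f s := A.left_smul c f s
  actionHomRight_add U _ _ f g := A.right_add U f g
  actionHomRight_smul U _ _ c f := A.right_smul U c f
  adj_actionHomLeft f s := A.adj_left f s
  adj_actionHomRight U _ _ f := A.adj_right U f
  assoc_unitary U V s := A.isUnitary_assoc U V s
  unit_unitary s := A.isUnitary_unit s

end ActionModel

/-! ### Direct sums of graded Hilbert spaces -/

namespace BiHilb

variable {J : Type v}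

/-- The orthogonal direct sum of a finite family of graded Hilbert spaces. -/
noncomputable def directSum {n : ℕ} (Y : Fin n → BiHilb J) : BiHilb J where
  comp r s := PiLp 2 fun i => (Y i).comp r s
  banded := by
    choose N hN using fun i => (Y i).banded
    refine ⟨∑ i, N i, fun r S => ?_⟩
    have h : ∀ r s, Module.finrank ℂ (PiLp 2 fun i => (Y i).comp r s) =
        ∑ i, Module.finrank ℂ ((Y i).comp r s) := fun r s => by
      rw [(WithLp.linearEquiv 2 ℂ (∀ i, (Y i).comp r s)).finrank_eq, Module.finrank_pi_fintype]
    simp only [h, ← Finset.sum_add_distrib]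
    rw [Finset.sum_comm]
    exact Finset.sum_le_sum fun i _ => hN i r S

/-- The isometric injection of a summand in a direct sum. -/
noncomputable def directSumInj {n : ℕ} (Y : Fin n → BiHilb J) (i : Fin n) : Y i ⟶ directSum Y :=
  mkHom (fun r s => LinearMap.mkContinuous
    { toFun := fun x : (Y i).comp r s => (PiLp.single 2 i x : PiLp 2 fun i => (Y i).comp r s)
      map_add' := fun x y => PiLp.single_add 2 i
      map_smul' := fun c x => by
        refine PiLp.ext fun j => ?_
        exact congrFun (Pi.single_smul (f := fun i => (Y i).comp r s) i c x) j } 1 fun x => by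
        rw [one_mul]
        exact (PiLp.norm_single 2 (fun i => (Y i).comp r s) i x).le) 1
    fun r s => LinearMap.mkContinuous_norm_le _ zero_le_one _

theorem app_directSumInj {n : ℕ} (Y : Fin n → BiHilb J) (i : Fin n) (r s : J)
    (x : (Y i).comp r s) :
    app (directSumInj Y i) r s x = (PiLp.single 2 i x : PiLp 2 fun i => (Y i).comp r s) := rfl

theorem app_adj_directSumInj {n : ℕ} (Y : Fin n → BiHilb J) (i : Fin n) (r s : J)
    (x : (directSum Y).comp r s) : app (adj (directSumInj Y i)) r s x =
      (show PiLp 2 fun i => (Y i).comp r s from x) i := by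
  refine ext_inner_left ℂ fun y => ?_
  rw [app_adj, ContinuousLinearMap.adjoint_inner_right, app_directSumInj]
  refine (PiLp.inner_apply (f := fun i => (Y i).comp r s) _ _).trans ?_
  rw [Finset.sum_eq_single i]
  · rw [PiLp.single_eq_same]
  · intro j _ hj
    rw [PiLp.single_eq_of_ne _ hj, inner_zero_left]
  · exact fun h => (h (Finset.mem_univ i)).elim

theorem isDirectSum_directSum {n : ℕ} (Y : Fin n → BiHilb J) :
    IsDirectSum Y (directSum Y) (directSumInj Y) := by
  refine ⟨fun i => hom_ext' fun r s x => ?_, fun i j h => hom_ext' fun r s x => ?_,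
    hom_ext' fun r s x => ?_⟩
  · rw [comp_apply, app_adj_directSumInj, app_directSumInj]
    exact PiLp.single_eq_same (β := fun i => (Y i).comp r s) 2 i x
  · rw [comp_apply, app_adj_directSumInj, app_directSumInj]
    exact PiLp.single_eq_of_ne (β := fun i => (Y i).comp r s) 2 h.symm x
  · have happ : ∀ (f : Fin n → (directSum Y ⟶ directSum Y)),
        app (∑ i, f i) r s x = ∑ i, app (f i) r s x := fun f =>
      map_sum (AddMonoidHom.mk' (fun T : directSum Y ⟶ directSum Y => app T r s x)
        fun _ _ => rfl) f Finset.univ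
    rw [happ]
    change _ = x
    have : ∀ i, app (adj (directSumInj Y i) ≫ directSumInj Y i) r s x =
        (PiLp.single 2 i ((show PiLp 2 fun i => (Y i).comp r s from x) i) :
          PiLp 2 fun i => (Y i).comp r s) := fun i => by
      rw [comp_apply, app_adj_directSumInj, app_directSumInj]
    simp only [this]
    refine PiLp.ext fun j => ?_
    refine (map_sum (PiLp.proj (𝕜 := ℂ) 2 (fun i => (Y i).comp r s) j) _ _).trans ?_
    refine (Finset.sum_eq_single j (fun i _ h => ?_) fun h => (h (Finset.mem_univ j)).elim).trans ?_
    · exact PiLp.single_eq_of_ne (β := fun i => (Y i).comp r s) 2 h.symm _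
    · exact PiLp.single_eq_same (β := fun i => (Y i).comp r s) 2 j _

/-! ### Columns -/

/-- Graded Hilbert spaces are classified by the dimensions of their components. -/
theorem exists_isUnitary_of_finrank_eq {H K : BiHilb J}
    (h : ∀ r s, Module.finrank ℂ (H.comp r s) = Module.finrank ℂ (K.comp r s)) :
    ∃ e : H ≅ K, IsUnitary e.hom :=
  ⟨_, isUnitary_mkIso_hom fun r s => (stdOrthonormalBasis ℂ (H.comp r s)).equiv
    (stdOrthonormalBasis ℂ (K.comp r s)) (finCongr (h r s))⟩

theorem finrank_comp_eq {H K : BiHilb J} (e : H ≅ K) (r s : J) :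
    Module.finrank ℂ (H.comp r s) = Module.finrank ℂ (K.comp r s) :=
  (LinearEquiv.ofLinearMap (app e.hom r s).toLinearMap (app e.inv r s).toLinearMap
    (LinearMap.ext fun x => by
      change app (e.inv ≫ e.hom) r s x = x
      rw [e.inv_hom_id]
      rfl)
    (LinearMap.ext fun x => by
      change app (e.hom ≫ e.inv) r s x = x
      rw [e.hom_inv_id]
      rfl)).finrank_eq

/-- The chosen point `o` of `J`. The argument `r` only witnesses that `J` is nonempty; by proof
irrelevance the point does not depend on it. In this way the case of empty `J` needs no separate
treatment. -/
noncomputable abbrev pt (r : J) : J := Classical.choice ⟨r⟩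

/-- A graded Hilbert space is a column if its components vanish outside of the degrees `(r, o)`, for
the chosen point `o` of `J`. -/
def IsColumn (H : BiHilb J) : Prop := ∀ r s, s ≠ pt r → Subsingleton (H.comp r s)

/-- A type with `k` elements if `s = pt r`, and an empty type otherwise. It is lifted to the universe
of `J`, where the components of a graded Hilbert space live. -/
abbrev ColumnIdx (k : ℕ) (r s : J) : Type v := ULift.{v} {_i : Fin k // s = pt r}

noncomputable instance (k : ℕ) (r s : J) : Fintype (ColumnIdx k r s) := Fintype.ofFinite _

theorem card_columnIdx_le (k : ℕ) (r s : J) : Fintype.card (ColumnIdx k r s) ≤ k :=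
  (Fintype.card_le_of_injective (fun i : ColumnIdx k r s => i.down.1)
    fun _ _ h => ULift.ext _ _ (Subtype.ext h)).trans_eq (Fintype.card_fin k)

theorem card_columnIdx (k : ℕ) (r : J) : Fintype.card (ColumnIdx k r (pt r)) = k :=
  (Fintype.card_congr (Equiv.ulift.trans (Equiv.subtypeUnivEquiv fun _ => rfl))).trans
    (Fintype.card_fin k)

theorem card_columnIdx_eq_zero (k : ℕ) {r s : J} (h : s ≠ pt r) :
    Fintype.card (ColumnIdx k r s) = 0 :=
  Fintype.card_eq_zero_iff.2 ⟨fun i => h i.down.2⟩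

/-- The column whose component of degree `(r, o)` is of dimension `n r`. -/
noncomputable def column (n : J →₀ ℕ) : BiHilb J where
  comp r s := EuclideanSpace ℂ (ColumnIdx (n r) r s)
  banded := by
    classical
    have hle : ∀ S : Finset J, ∑ r ∈ S, n r ≤ ∑ r ∈ n.support, n r := fun S => by
      rw [← Finset.sum_filter_ne_zero]
      exact Finset.sum_le_sum_of_subset fun r hr =>
        Finsupp.mem_support_iff.2 (Finset.mem_filter.1 hr).2
    refine ⟨∑ r ∈ n.support, n r + ∑ r ∈ n.support, n r, fun r S => ?_⟩
    simp only [finrank_euclideanSpace]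
    rw [Finset.sum_add_distrib]
    refine add_le_add ?_ ((Finset.sum_le_sum fun s _ => card_columnIdx_le (n s) s r).trans (hle S))
    calc ∑ s ∈ S, Fintype.card (ColumnIdx (n r) r s)
        ≤ ∑ s ∈ S, if s = pt r then n r else 0 := by
          refine Finset.sum_le_sum fun s _ => ?_
          split_ifs with h
          · exact card_columnIdx_le _ _ _
          · exact (card_columnIdx_eq_zero _ h).le
      _ ≤ ∑ r ∈ {r}, n r := by
          rw [Finset.sum_ite_eq', Finset.sum_singleton]
          split_ifs <;> simp
      _ ≤ _ := hle {r}

theorem finrank_column (n : J →₀ ℕ) (r : J) :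
    Module.finrank ℂ ((column n).comp r (pt r)) = n r :=
  finrank_euclideanSpace.trans (card_columnIdx (n r) r)

theorem isColumn_column (n : J →₀ ℕ) : IsColumn (column n) := fun r s h => by
  have : IsEmpty (ColumnIdx (n r) r s) := ⟨fun i => h i.down.2⟩
  exact (WithLp.equiv 2 (ColumnIdx (n r) r s → ℂ)).subsingleton

/-- Up to unitary isomorphism, columns are given by finitely supported dimension functions: the support
is finite since the dimensions in the column of `o` have bounded sums. -/
theorem IsColumn.exists_iso {H : BiHilb J} (hH : IsColumn H) :
    ∃ (n : J →₀ ℕ) (e : column n ≅ H), IsUnitary e.hom := by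
  have hfin : {r | Module.finrank ℂ (H.comp r (pt r)) ≠ 0}.Finite := by
    obtain ⟨N, hN⟩ := H.exists_col_bound
    by_contra h
    obtain ⟨S, hS, hc⟩ := Set.Infinite.exists_subset_card_eq h (N + 1)
    obtain ⟨r, _⟩ : S.Nonempty := Finset.card_pos.1 (by omega)
    have h1 := Finset.card_nsmul_le_sum S (fun s => Module.finrank ℂ (H.comp s (pt r))) 1
      (fun s hs => Nat.one_le_iff_ne_zero.2 (hS hs))
    have h2 := hN (pt r) S
    simp only [smul_eq_mul, mul_one] at h1
    omega
  let n : J →₀ ℕ := Finsupp.ofSupportFinite (fun r => Module.finrank ℂ (H.comp r (pt r))) hfin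
  refine ⟨n, exists_isUnitary_of_finrank_eq fun r s => ?_⟩
  by_cases h : s = pt r
  · subst h
    exact finrank_column n r
  · have h1 := isColumn_column n r s h
    have h2 := hH r s h
    rw [Module.finrank_zero_of_subsingleton, Module.finrank_zero_of_subsingleton]

theorem isColumn_tensor (H : BiHilb J) {K : BiHilb J} (hK : IsColumn K) : IsColumn (H ⊗ K) :=
  fun r s h => ⟨fun z w => by
    have : (LinearMap.id : (tensor H K).comp r s →ₗ[ℂ] _) = 0 := tensor_ext fun t x y => by
      have := hK t s h
      rw [Subsingleton.elim y 0, TensorProduct.tmul_zero, map_zero, map_zero, map_zero]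
    exact (LinearMap.congr_fun this z).trans (LinearMap.congr_fun this w).symm⟩

theorem isColumn_directSum {n : ℕ} {Y : Fin n → BiHilb J} (hY : ∀ i, IsColumn (Y i)) :
    IsColumn (directSum Y) := fun r s h => by
  have := fun i => hY i r s h
  exact (WithLp.equiv 2 (∀ i, (Y i).comp r s)).subsingleton

end BiHilb

/-! ### Simple columns -/

namespace BiHilb

variable {J : Type v}

/-- The column whose only nonzero component is of degree `(r, o)` and of dimension `1`. -/
noncomputable abbrev line (r : J) : BiHilb J := column (Finsupp.single r 1)

theorem finrank_line (r : J) : Module.finrank ℂ ((line r).comp r (pt r)) = 1 :=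
  (finrank_column _ r).trans Finsupp.single_eq_same

theorem line_eq_zero {r a s : J} (h : ¬(a = r ∧ s = pt r)) (x : (line r).comp a s) : x = 0 := by
  have : Subsingleton ((line r).comp a s) := by
    by_cases hs : s = pt a
    · subst hs
      have ha : a ≠ r := fun ha => h ⟨ha, rfl⟩
      have h0 : Module.finrank ℂ ((line r).comp a (pt a)) = 0 :=
        (finrank_column _ a).trans (Finsupp.single_eq_of_ne ha)
      exact Module.finrank_zero_iff.1 h0
    · exact isColumn_column _ a s hs
  exact Subsingleton.elim _ _

/-- A unit vector of `line r`. -/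
noncomputable def one (r : J) : (line r).comp r (pt r) :=
  stdOrthonormalBasis ℂ ((line r).comp r (pt r)) ⟨0, by rw [finrank_line]; exact one_pos⟩

theorem norm_one (r : J) : ‖one r‖ = 1 := (stdOrthonormalBasis ℂ _).norm_eq_one _

theorem inner_one (r : J) : inner ℂ (one r) (one r) = 1 := (stdOrthonormalBasis ℂ _).inner_eq_one _

theorem one_ne_zero (r : J) : one r ≠ 0 := norm_ne_zero_iff.1 (by rw [norm_one]; exact _root_.one_ne_zero)

theorem eq_inner_smul_one {r : J} (x : (line r).comp r (pt r)) : x = inner ℂ (one r) x • one r := by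
  obtain ⟨c, rfl⟩ := (finrank_eq_one_iff_of_nonzero' (one r) (one_ne_zero r)).1 (finrank_line r) x
  rw [inner_smul_right, inner_one, mul_one]

theorem line_hom_ext {r : J} {H : BiHilb J} {T S : line r ⟶ H}
    (h : app T r (pt r) (one r) = app S r (pt r) (one r)) : T = S := by
  refine hom_ext' fun a s x => ?_
  by_cases ha : a = r ∧ s = pt r
  · obtain ⟨rfl, rfl⟩ := ha
    rw [eq_inner_smul_one x, map_smul, map_smul, h]
  · rw [line_eq_zero ha x, map_zero, map_zero]

open Classical in
/-- The morphism `line r ⟶ H` that sends the unit vector to a given element. -/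
noncomputable def vec {H : BiHilb J} {r : J} (x : H.comp r (pt r)) : line r ⟶ H :=
  mkHom (fun a s => if h : a = r ∧ s = pt r then by
      obtain ⟨rfl, rfl⟩ := h
      exact (innerSL ℂ (one a)).smulRight x
    else 0) ‖x‖ fun a s => by
      split_ifs with h
      · obtain ⟨rfl, rfl⟩ := h
        simp [norm_one]
      · simp

@[simp] theorem app_vec_one {H : BiHilb J} {r : J} (x : H.comp r (pt r)) :
    app (vec x) r (pt r) (one r) = x := by
  rw [vec, app_mkHom, dif_pos ⟨rfl, rfl⟩]
  change inner ℂ (one r) (one r) • x = x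
  rw [inner_one, one_smul]

theorem vec_app_one {H : BiHilb J} {r : J} (T : line r ⟶ H) : vec (app T r (pt r) (one r)) = T :=
  line_hom_ext (app_vec_one _)

theorem vec_comp {H K : BiHilb J} {r : J} (x : H.comp r (pt r)) (T : H ⟶ K) :
    vec x ≫ T = vec (app T r (pt r) x) :=
  line_hom_ext (by rw [comp_apply, app_vec_one, app_vec_one])

theorem vec_add {H : BiHilb J} {r : J} (x y : H.comp r (pt r)) : vec (x + y) = vec x + vec y :=
  line_hom_ext (by rw [app_add, _root_.add_apply, app_vec_one, app_vec_one, app_vec_one])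

theorem vec_smul {H : BiHilb J} {r : J} (c : ℂ) (x : H.comp r (pt r)) : vec (c • x) = c • vec x :=
  line_hom_ext (by rw [app_smul, _root_.smul_apply, app_vec_one, app_vec_one])

theorem vec_injective {H : BiHilb J} {r : J} {x y : H.comp r (pt r)} (h : vec x = vec y) : x = y := by
  rw [← app_vec_one x, h, app_vec_one]

/-- `vec` identifies the component of degree `(r, o)` with the Hilbert space `Mor(line r, H)`. -/
theorem vec_comp_adj {H : BiHilb J} {r : J} (x y : H.comp r (pt r)) :
    vec y ≫ adj (vec x) = (inner ℂ x y : ℂ) • 𝟙 (line r) := by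
  refine line_hom_ext ?_
  rw [comp_apply, app_vec_one, app_smul, _root_.smul_apply, app_id, app_adj,
    eq_inner_smul_one (ContinuousLinearMap.adjoint _ y), ContinuousLinearMap.adjoint_inner_right,
    app_vec_one]
  rfl

theorem isSimple_line (r : J) : IsSimple (line r) := fun T => by
  have h := eq_inner_smul_one (app T r (pt r) (one r))
  refine ⟨inner ℂ (one r) (app T r (pt r) (one r)), line_hom_ext h, fun c hc => ?_⟩
  have h1 : app T r (pt r) (one r) = c • one r := by rw [hc]; rfl
  rw [h1, inner_smul_right, inner_one, mul_one]

theorem line_injective {r s : J} (e : line r ≅ line s) : r = s := by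
  by_contra h
  have h1 := finrank_comp_eq e r (pt r)
  rw [finrank_line] at h1
  have h2 : Module.finrank ℂ ((line s).comp r (pt r)) = 0 :=
    (finrank_column _ r).trans (Finsupp.single_eq_of_ne h)
  omega

theorem line_hom_eq_zero {r s : J} (h : r ≠ s) (T : line r ⟶ line s) : T = 0 :=
  line_hom_ext ((line_eq_zero (fun h' => h h'.1) _).trans rfl)

theorem IsColumn.hom_ext {H K : BiHilb J} (hH : IsColumn H) {T S : H ⟶ K}
    (h : ∀ (r : J) (x : H.comp r (pt r)), vec x ≫ T = vec x ≫ S) : T = S := by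
  refine BiHilb.hom_ext' fun r s x => ?_
  by_cases hs : s = pt r
  · subst hs
    exact vec_injective (by rw [← vec_comp, ← vec_comp, h])
  · have := hH r s hs
    rw [Subsingleton.elim x 0, map_zero, map_zero]

theorem vec_sum {H : BiHilb J} {r : J} {κ : Type*} (t : Finset κ) (x : κ → H.comp r (pt r)) :
    vec (∑ i ∈ t, x i) = ∑ i ∈ t, vec (x i) :=
  map_sum (AddMonoidHom.mk' (fun x : H.comp r (pt r) => vec x) vec_add) x t

/-- Orthonormal bases of the components decompose a column into simple columns. -/
theorem line_isDecomp_column (n : J →₀ ℕ) : ∃ v : ∀ p : (Σ r : n.support, Fin (n r.1)),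
    line p.1.1 ⟶ column n, IsDecomp (fun p : (Σ r : n.support, Fin (n r.1)) => line p.1.1) (column n) v := by
  let b : ∀ r : n.support, OrthonormalBasis (Fin (n r.1)) ℂ ((column n).comp r.1 (pt r.1)) := fun r =>
    (stdOrthonormalBasis ℂ _).reindex (finCongr (finrank_column n r.1))
  refine ⟨fun p => vec (b p.1 p.2), fun p => ?_, fun p q hpq => ?_, ?_⟩
  · rw [vec_comp_adj, (b p.1).inner_eq_one, one_smul]
  · obtain ⟨r, i⟩ := p
    obtain ⟨s, j⟩ := q
    by_cases hrs : r = s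
    · subst hrs
      have hij : j ≠ i := fun h => hpq (by rw [h])
      rw [vec_comp_adj, (b r).inner_eq_zero hij, zero_smul]
    · exact line_hom_eq_zero (fun h => hrs (Subtype.ext h)) _
  · refine (isColumn_column n).hom_ext fun r x => ?_
    rw [CStarCategory.comp_sum, Category.comp_id, Fintype.sum_sigma]
    by_cases hr : r ∈ n.support
    · rw [Finset.sum_eq_single ⟨r, hr⟩]
      · conv_rhs => rw [← (b ⟨r, hr⟩).sum_repr' x, vec_sum]
        refine Finset.sum_congr rfl fun i _ => ?_
        rw [← Category.assoc, vec_comp_adj, smul_comp, Category.id_comp, vec_smul]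
      · intro s _ hs
        refine Finset.sum_eq_zero fun i _ => ?_
        rw [← Category.assoc, line_hom_eq_zero (fun h => hs (Subtype.ext h.symm))
          (vec x ≫ adj (vec (b s i))), zero_comp]
      · exact fun h => (h (Finset.mem_univ _)).elim
    · have h0 : Module.finrank ℂ ((column n).comp r (pt r)) = 0 := by
        rw [finrank_column, Finsupp.notMem_support_iff.1 hr]
      have := Module.finrank_zero_iff.1 h0
      have hx : vec x = 0 := line_hom_ext (Subsingleton.elim _ _)
      rw [hx]
      simp only [zero_comp, Finset.sum_const_zero]

theorem exists_isDecomp_column (n : J →₀ ℕ) : ∃ (k : ℕ) (r : Fin k → J)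
    (v : ∀ i, line (r i) ⟶ column n), IsDecomp (fun i => line (r i)) (column n) v := by
  obtain ⟨v, hv⟩ := line_isDecomp_column n
  exact ⟨_, _, _, hv.reindex (Fintype.equivFin _).symm⟩

end BiHilb

/-! ### The components of a graded Hilbert space as morphism spaces -/

namespace BiHilb

variable {J : Type v}

/-- The tensor product of an element of `H` with the unit vector of a simple column. -/
noncomputable def tmulOne (H : BiHilb J) (r s : J) : H.comp r s →ₗ[ℂ] (H ⊗ line s).comp r (pt r) :=
  gen H (line s) s ∘ₗ (TensorProduct.mk ℂ (H.comp r s) ((line s).comp s (pt s))).flip (one s)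

theorem tmulOne_apply (H : BiHilb J) (r s : J) (x : H.comp r s) :
    tmulOne H r s x = gen H (line s) s (x ⊗ₜ one s) := rfl

/-- Only the elementary tensors with middle degree `s` contribute, since `line s` vanishes in the
other degrees. -/
theorem tmulOne_surjective (H : BiHilb J) (r s : J) : Function.Surjective (tmulOne H r s) := by
  have h : (LinearMap.range (tmulOne H r s)).mkQ = 0 := tensor_ext fun t x y => by
    rw [LinearMap.zero_apply, Submodule.mkQ_apply, Submodule.Quotient.mk_eq_zero]
    by_cases ht : t = s
    · subst ht
      rw [eq_inner_smul_one y, ← TensorProduct.smul_tmul]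
      exact LinearMap.mem_range_self _ _
    · rw [line_eq_zero (fun h => ht h.1) y, TensorProduct.tmul_zero, map_zero]
      exact Submodule.zero_mem _
  rw [← LinearMap.range_eq_top, ← Submodule.ker_mkQ (LinearMap.range (tmulOne H r s)), h,
    LinearMap.ker_zero]

/-- The element `x` of degree `(r, s)`, as the morphism `line r ⟶ H ⊗ line s` that sends the unit
vector of `line r` to its tensor product with the unit vector of `line s`. -/
noncomputable def fiber {H : BiHilb J} {r s : J} (x : H.comp r s) : line r ⟶ H ⊗ line s :=
  vec (tmulOne H r s x)

theorem fiber_add {H : BiHilb J} {r s : J} (x y : H.comp r s) :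
    fiber (x + y) = fiber x + fiber y := by
  rw [fiber, map_add, vec_add, fiber, fiber]

theorem fiber_smul {H : BiHilb J} {r s : J} (c : ℂ) (x : H.comp r s) :
    fiber (c • x) = c • fiber x := by
  rw [fiber, map_smul, vec_smul, fiber]

theorem fiber_comp_adj {H : BiHilb J} {r s : J} (x y : H.comp r s) :
    fiber y ≫ adj (fiber x) = (inner ℂ x y : ℂ) • 𝟙 (line r) := by
  refine (vec_comp_adj (tmulOne H r s x) (tmulOne H r s y)).trans ?_
  congr 1
  refine (inner_gen_same H (line s) (x ⊗ₜ one s) (y ⊗ₜ one s)).trans ?_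
  rw [TensorProduct.inner_tmul, inner_one, mul_one]

theorem fiber_injective {H : BiHilb J} {r s : J} {x y : H.comp r s} (h : fiber x = fiber y) :
    x = y := by
  rw [← sub_eq_zero, ← inner_self_eq_zero (𝕜 := ℂ)]
  apply (isSimple_line r).smul_id_injective
  have e : fiber (x - y) = 0 := by
    rw [sub_eq_add_neg, ← neg_one_smul ℂ y, fiber_add, fiber_smul, h, neg_one_smul, add_neg_cancel]
  rw [← fiber_comp_adj, e, zero_comp, zero_smul]

theorem fiber_surjective {H : BiHilb J} {r s : J} (T : line r ⟶ H ⊗ line s) :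
    ∃ x : H.comp r s, fiber x = T := by
  obtain ⟨x, hx⟩ := tmulOne_surjective H r s (app T r (pt r) (one r))
  exact ⟨x, by rw [fiber, hx, vec_app_one]⟩

theorem fiber_whiskerRight {H K : BiHilb J} {r s : J} (x : H.comp r s) (T : H ⟶ K) :
    fiber x ≫ T ▷ line s = fiber (app T r s x) := by
  rw [fiber, vec_comp, fiber, tmulOne_apply, tmulOne_apply]
  exact congrArg vec (app_whiskerRight_gen T (line s) r s (pt r) x (one s))

theorem fiber_delta (r : J) :
    fiber (H := 𝟙_ (BiHilb J)) (s := r) (delta r) ≫ (λ_ (line r)).hom = 𝟙 (line r) := by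
  rw [fiber, vec_comp, tmulOne_apply]
  refine (congrArg vec (app_leftUnitor_hom_gen (line r) r (pt r) (one r))).trans ?_
  exact vec_app_one (𝟙 (line r))

/-- Composition of the morphisms given by `x` and `y` corresponds to the tensor product `x ⊗ y`; this
makes the tensor structure of `F` the product of the spaces `Mor(X r, U ⊙ X s)`. -/
theorem fiber_comp_whiskerLeft {H K : BiHilb J} {r s t : J} (x : H.comp r s) (y : K.comp s t) :
    fiber x ≫ H ◁ fiber y =
      fiber (H := H ⊗ K) (gen H K s (x ⊗ₜ y)) ≫ (α_ H K (line t)).hom := by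
  have h1 : app (fiber y) s (pt s) (one s) = gen K (line t) t (y ⊗ₜ one t) := app_vec_one _
  have h2 := app_whiskerLeft_gen H (fiber y) r s (pt s) x (one s)
  rw [h1] at h2
  refine (vec_comp _ _).trans (.trans ?_ (vec_comp _ _).symm)
  exact congrArg vec (h2.trans (app_associator_hom_gen H K (line t) r s t (pt t) x y (one t)).symm)

end BiHilb

/-! ### The based module of a strong tensor functor -/

/-- A realization of `F` by a based module, in terms of an action of `C` on a category `D` and a family
`X` of representatives of its simple objects. -/
def Realization.ofBase {C : Type u₁} [Category.{v₁} C] [CStarCategory C] [MonoidalCategory C]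
    [TensorCStarCategory C] {J : Type v} {D : Type (max u v)} [Category.{v} D] [CStarCategory D]
    [MonoidalLeftAction C D] [ModuleCStarCategory C D] (semisimple : IsSemisimple D) (X : J → D)
    (simple : ∀ r, IsSimple (X r)) (eq_of_iso : ∀ r s, Nonempty (X r ≅ X s) → r = s)
    (exists_iso : ∀ Y : D, IsSimple Y → ∃ r, Nonempty (Y ≅ X r))
    (F : StrongTensorFunctor C (BiHilb J))
    (κ : ∀ (U : C) (r s : J), (F.functor.obj U).comp r s ≃ₗ[ℂ] (X r ⟶ U ⊙ₗ X s))
    (inner_eq : ∀ (U : C) (r s : J) (x y : (F.functor.obj U).comp r s),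
      κ U r s y ≫ adj (κ U r s x) = (inner ℂ x y : ℂ) • 𝟙 (X r))
    (map_eq : ∀ {U V : C} (f : U ⟶ V) (r s : J) (x : (F.functor.obj U).comp r s),
      κ V r s (BiHilb.app (F.functor.map f) r s x) = κ U r s x ≫ f ⊵ₗ X s)
    (tensor_eq : ∀ (U V : C) (r s t : J) (x : (F.functor.obj U).comp r s)
      (y : (F.functor.obj V).comp s t),
      κ (U ⊗ V) r t (BiHilb.app (Functor.LaxMonoidal.μ F.functor U V) r t
        (BiHilb.gen (F.functor.obj U) (F.functor.obj V) s (x ⊗ₜ[ℂ] y))) =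
        κ U r s x ≫ U ⊴ₗ κ V s t y ≫ adj (αₗ U V (X t)).hom)
    (unit_eq : ∀ r : J,
      κ (𝟙_ C) r r (BiHilb.app (Functor.LaxMonoidal.ε F.functor) r r (BiHilb.delta r)) =
        adj (λₗ[C] (X r)).hom) :
    Realization ⟨D, semisimple, X, simple, eq_of_iso, exists_iso⟩ F :=
  ⟨κ, inner_eq, map_eq, tensor_eq, unit_eq⟩

namespace StrongTensorFunctor

open BiHilb MonoidalLeftAction Functor.LaxMonoidal Functor.Monoidal

variable {C : Type u₁} [Category.{v₁} C] [CStarCategory C] [MonoidalCategory C]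
  [TensorCStarCategory C] {J : Type v} (F : StrongTensorFunctor C (BiHilb J))

/-- The columns, indexed by their dimensions: a family closed under tensoring by graded Hilbert
spaces on the left. The index set is lifted to the universe in which the objects of a based module
live. -/
noncomputable def columns : ActionModel F fun n : ULift.{u} (J →₀ ℕ) => column n.down where
  act U n := ⟨(isColumn_tensor (F.functor.obj U) (isColumn_column n.down)).exists_iso.choose⟩
  iso U n :=
    (isColumn_tensor (F.functor.obj U) (isColumn_column n.down)).exists_iso.choose_spec.choose
  unitary U n :=
    (isColumn_tensor (F.functor.obj U) (isColumn_column n.down)).exists_iso.choose_spec.choose_spec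

/-- The index of the simple column `line r`. -/
noncomputable abbrev lineIdx (r : J) : ULift.{u} (J →₀ ℕ) := ⟨Finsupp.single r 1⟩

/-- The simple column `line r`, as an object of the model. -/
noncomputable def base (r : J) : (columns.{u} F).Carrier := lineIdx.{u} r

theorem isSemisimple_columns : IsSemisimple (columns.{u} F).Carrier := by
  constructor
  · intro n Y
    obtain ⟨m, e, he⟩ := (isColumn_directSum fun i => isColumn_column (Y i).down).exists_iso
    have h : IsDecomp (fun i => column (Y i).down) _ _ :=
      isDirectSum_directSum fun i => column (Y i).down
    exact ⟨⟨m⟩, _, h.postcomp he.inv⟩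
  · intro X
    obtain ⟨k, r, v, hv⟩ := exists_isDecomp_column X.down
    exact ⟨k, fun i => F.base (r i), v, fun i => isSimple_line (r i), hv⟩

theorem isSimple_base (r : J) : IsSimple (base.{u} F r) := isSimple_line r

theorem base_injective {r s : J} (e : base.{u} F r ≅ base.{u} F s) : r = s :=
  line_injective ((columns.{u} F).objIso e)

theorem exists_iso_base (Y : (columns.{u} F).Carrier) (hY : IsSimple Y) :
    ∃ r, Nonempty (Y ≅ F.base r) := by
  obtain ⟨k, r, v, hv⟩ := exists_isDecomp_column Y.down
  have hk : 0 < k := by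
    rw [Nat.pos_iff_ne_zero]
    rintro rfl
    exact hY.id_ne_zero (hv.2.2.symm.trans (by simp; rfl))
  have hne : v ⟨0, hk⟩ ≠ 0 := fun h => (isSimple_line _).id_ne_zero (by
    rw [← hv.1 ⟨0, hk⟩, h, zero_comp])
  have hr : IsSimple (F.base (r ⟨0, hk⟩)) := isSimple_line _
  obtain ⟨c, hc⟩ := hr.exists_isUnitary hY (f := v ⟨0, hk⟩) hne
  exact ⟨_, ⟨hc.iso.symm⟩⟩

/-- The object of the model that is isomorphic to `F(U) ⊗ line s`. -/
noncomputable def columnsIso (U : C) (s : J) :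
    column ((columns.{u} F).act U (lineIdx.{u} s)).down ≅ F.functor.obj U ⊗ line s :=
  (columns.{u} F).iso U (lineIdx.{u} s)

theorem isUnitary_columnsIso (U : C) (s : J) : IsUnitary (columnsIso.{u} F U s).hom :=
  (columns.{u} F).unitary U (lineIdx.{u} s)

/-- The elements of the component `F(U)_rs`, as morphisms between objects of the model. -/
noncomputable def fiberMap (U : C) (r s : J) : (F.functor.obj U).comp r s →ₗ[ℂ]
    (line r ⟶ column ((columns.{u} F).act U (lineIdx.{u} s)).down) where
  toFun x := fiber x ≫ (columnsIso.{u} F U s).inv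
  map_add' x y := by rw [fiber_add, add_comp]
  map_smul' c x := by rw [fiber_smul, smul_comp]; rfl

theorem fiberMap_apply (U : C) (r s : J) (x : (F.functor.obj U).comp r s) :
    fiberMap.{u} F U r s x = fiber x ≫ (columnsIso.{u} F U s).inv := rfl

theorem fiberMap_bijective (U : C) (r s : J) : Function.Bijective (fiberMap.{u} F U r s) := by
  refine ⟨fun x y h => fiber_injective ((cancel_mono (columnsIso.{u} F U s).inv).1 h), fun T => ?_⟩
  obtain ⟨x, hx⟩ := fiber_surjective (T ≫ (columnsIso.{u} F U s).hom)
  exact ⟨x, by rw [fiberMap_apply, hx, Category.assoc, Iso.hom_inv_id, Category.comp_id]⟩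

theorem fiberMap_comp_adj (U : C) (r s : J) (x y : (F.functor.obj U).comp r s) :
    fiberMap.{u} F U r s y ≫ adj (fiberMap.{u} F U r s x) = (inner ℂ x y : ℂ) • 𝟙 (line r) := by
  rw [fiberMap_apply, fiberMap_apply, adj_comp, Category.assoc,
    ← Category.assoc (columnsIso.{u} F U s).inv, (isUnitary_columnsIso.{u} F U s).inv.1, Category.id_comp,
    fiber_comp_adj]

theorem fiberMap_map {U V : C} (f : U ⟶ V) (r s : J) (x : (F.functor.obj U).comp r s) :
    fiberMap.{u} F V r s (app (F.functor.map f) r s x) =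
      fiberMap.{u} F U r s x ≫ (columns F).left f (lineIdx.{u} s) := by
  change _ = (fiber x ≫ (columnsIso.{u} F U s).inv) ≫ (columnsIso.{u} F U s).hom ≫
    F.functor.map f ▷ line s ≫ (columnsIso.{u} F V s).inv
  rw [Category.assoc, Iso.inv_hom_id_assoc, ← Category.assoc, fiber_whiskerRight, fiberMap_apply]

theorem fiberMap_ε (r : J) :
    fiberMap.{u} F (𝟙_ C) r r (app (ε F.functor) r r (delta r)) =
      ((columns.{u} F).unit (lineIdx.{u} r)).inv := by
  have h : fiber (H := 𝟙_ (BiHilb J)) (s := r) (delta r) = (λ_ (line r)).inv := by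
    rw [← cancel_mono (λ_ (line r)).hom, fiber_delta, Iso.inv_hom_id]
  rw [ActionModel.unit_inv, fiberMap_apply, ← fiber_whiskerRight (H := 𝟙_ (BiHilb J)), h]
  rfl

theorem fiberMap_μ (U V : C) (r s t : J) (x : (F.functor.obj U).comp r s)
    (y : (F.functor.obj V).comp s t) :
    fiberMap.{u} F (U ⊗ V) r t (app (μ F.functor U V) r t (gen _ _ s (x ⊗ₜ y))) =
      fiberMap.{u} F U r s x ≫ (columns.{u} F).right U (s := lineIdx.{u} s) (fiberMap.{u} F V s t y) ≫
        ((columns.{u} F).assoc U V (lineIdx.{u} t)).inv := by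
  have h := fiber_comp_whiskerLeft x y
  rw [← Iso.comp_inv_eq, Category.assoc] at h
  rw [ActionModel.right_comp_assoc_inv, fiberMap_apply,
    ← fiber_whiskerRight (H := F.functor.obj U ⊗ F.functor.obj V), ← h]
  change _ = (fiber x ≫ (columnsIso.{u} F U s).inv) ≫ (columnsIso.{u} F U s).hom ≫
    F.functor.obj U ◁ ((fiber y ≫ (columnsIso.{u} F V t).inv) ≫ (columnsIso.{u} F V t).hom) ≫
      (α_ _ _ (line t)).inv ≫ μ F.functor U V ▷ line t ≫ (columnsIso.{u} F (U ⊗ V) t).inv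
  simp only [Category.assoc]
  rw [Iso.inv_hom_id_assoc, Iso.inv_hom_id, Category.comp_id]

/-- The identification of the component `F(U)_rs` with the morphism space `Mor(X r, U ⊙ X s)`. -/
noncomputable def fiberEquiv (U : C) (r s : J) :
    (F.functor.obj U).comp r s ≃ₗ[ℂ] (base.{u} F r ⟶ U ⊙ₗ base.{u} F s) :=
  LinearEquiv.ofBijective (fiberMap.{u} F U r s) (fiberMap_bijective F U r s)

theorem fiberEquiv_comp_adj (U : C) (r s : J) (x y : (F.functor.obj U).comp r s) :
    fiberEquiv.{u} F U r s y ≫ adj (fiberEquiv.{u} F U r s x) =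
      (inner ℂ x y : ℂ) • 𝟙 (base.{u} F r) := fiberMap_comp_adj F U r s x y

theorem fiberEquiv_map {U V : C} (f : U ⟶ V) (r s : J) (x : (F.functor.obj U).comp r s) :
    fiberEquiv.{u} F V r s (app (F.functor.map f) r s x) =
      fiberEquiv.{u} F U r s x ≫ f ⊵ₗ base.{u} F s := fiberMap_map F f r s x

theorem fiberEquiv_ε (r : J) :
    fiberEquiv.{u} F (𝟙_ C) r r (app (ε F.functor) r r (delta r)) =
      adj (λₗ[C] (base.{u} F r)).hom := by
  rw [ModuleCStarCategory.adj_unit_hom]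
  exact fiberMap_ε F r

theorem fiberEquiv_μ (U V : C) (r s t : J) (x : (F.functor.obj U).comp r s)
    (y : (F.functor.obj V).comp s t) :
    fiberEquiv.{u} F (U ⊗ V) r t (app (μ F.functor U V) r t (gen _ _ s (x ⊗ₜ y))) =
      fiberEquiv.{u} F U r s x ≫ U ⊴ₗ fiberEquiv.{u} F V s t y ≫
        adj (αₗ U V (base.{u} F t)).hom := by
  rw [ModuleCStarCategory.adj_assoc_hom]
  exact fiberMap_μ F U V r s t x y

attribute [local irreducible] fiberEquiv base

/-- The full subcategory of the columns, as a based module whose base consists of the simple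
columns. -/
noncomputable abbrev toBandedModule : BandedModule.{u} C J where
  carrier := (columns.{u} F).Carrier
  semisimple := F.isSemisimple_columns
  X := base F
  simple := F.isSimple_base
  eq_of_iso _ _ := fun ⟨e⟩ => F.base_injective e
  exists_iso := F.exists_iso_base
  banded U := by
    obtain ⟨N, hN⟩ := (F.functor.obj U).banded
    refine ⟨N, fun r S => le_of_eq_of_le (Finset.sum_congr rfl fun s _ => ?_) (hN r S)⟩
    exact congrArg₂ (· + ·) (fiberEquiv.{u} F U r s).finrank_eq.symm
      (fiberEquiv.{u} F U s r).finrank_eq.symm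

/-- A strong tensor functor is realized by its based module of columns. -/
noncomputable def realization : Realization (toBandedModule.{u} F).toBasedModule F :=
  Realization.ofBase _ _ _ _ _ F (fiberEquiv.{u} F) F.fiberEquiv_comp_adj F.fiberEquiv_map
    F.fiberEquiv_μ F.fiberEquiv_ε

end StrongTensorFunctor

/-! ### Uniqueness of the realized functor -/

namespace Realization

open BiHilb MonoidalLeftAction

variable {C : Type u₁} [Category.{v₁} C] [CStarCategory C] [MonoidalCategory C]
  [TensorCStarCategory C] {J : Type v} {M : BandedModule.{u} C J}
  {F : StrongTensorFunctor C (BiHilb J)} (R : Realization M.toBasedModule F)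

/-- The unitary given by the identifications of a realization. -/
noncomputable def appIso (U : C) : F.functor.obj U ≅ M.graded U :=
  BiHilb.mkIso fun r s => ((R.κ U r s).trans (M.mor U r s).symm).isometryOfInner fun x y =>
    M.inner_eq_of_comp_adj (R.inner_eq U r s x y)

theorem mor_appIso (U : C) (r s : J) (x : (F.functor.obj U).comp r s) :
    M.mor U r s (app (R.appIso U).hom r s x) = R.κ U r s x := rfl

theorem appIso_natural {U V : C} (f : U ⟶ V) :
    F.functor.map f ≫ (R.appIso V).hom = (R.appIso U).hom ≫ M.gradedMap f :=
  hom_ext' fun r s x => (M.mor V r s).injective (by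
    rw [BiHilb.comp_apply, BiHilb.comp_apply, BandedModule.mor_gradedMap, mor_appIso, mor_appIso,
      R.map_eq])

theorem appIso_unit : Functor.LaxMonoidal.ε F.functor ≫ (R.appIso (𝟙_ C)).hom = M.gradedEps.hom :=
  unit_hom_ext fun r => (M.mor (𝟙_ C) r r).injective (by
    rw [BiHilb.comp_apply, mor_appIso, R.unit_eq, BandedModule.mor_gradedEps_delta])

theorem appIso_tensor (U V : C) :
    Functor.LaxMonoidal.μ F.functor U V ≫ (R.appIso (U ⊗ V)).hom =
      ((R.appIso U).hom ⊗ₘ (R.appIso V).hom) ≫ (M.gradedMu U V).hom :=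
  tensorObj_hom_ext fun r s t x y => (M.mor _ r t).injective (by
    rw [BiHilb.comp_apply, BiHilb.comp_apply, app_tensorHom_gen, mor_appIso,
      BandedModule.mor_gradedMu_gen, mor_appIso, mor_appIso, R.tensor_eq])

/-- The natural isomorphism given by the identifications of a realization. -/
noncomputable def natIso : F.functor ≅ M.gradedFunctor :=
  NatIso.ofComponents R.appIso fun f => R.appIso_natural f

instance : NatTrans.IsMonoidal R.natIso.hom where
  unit := R.appIso_unit
  tensor := R.appIso_tensor

theorem isUnitary_appIso (U : C) : IsUnitary (R.appIso U).hom := isUnitary_mkIso_hom _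

/-- The functor of a based module is determined by its realization, up to a monoidal natural
unitary. -/
noncomputable def iso : M.strong ≅ F where
  hom := StrongTensorFunctor.Hom.mk (F := M.strong) (G := F) R.natIso.inv
    (inferInstanceAs (NatTrans.IsMonoidal R.natIso.inv)) fun U => (R.isUnitary_appIso U).inv
  inv := StrongTensorFunctor.Hom.mk (F := F) (G := M.strong) R.natIso.hom
    (inferInstanceAs (NatTrans.IsMonoidal R.natIso.hom)) R.isUnitary_appIso
  hom_inv_id := StrongTensorFunctor.Hom.ext R.natIso.inv_hom_id
  inv_hom_id := StrongTensorFunctor.Hom.ext R.natIso.hom_inv_id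

end Realization

instance {C : Type u₁} [Category.{v₁} C] [CStarCategory C] [MonoidalCategory C]
    [TensorCStarCategory C] {J : Type v} :
    (BandedModule.strongFunctor C J : BandedModule.{u} C J ⥤ _).EssSurj where
  mem_essImage F := ⟨F.toBandedModule, ⟨F.realization.iso⟩⟩

instance {C : Type u₁} [Category.{v₁} C] [CStarCategory C] [MonoidalCategory C]
    [TensorCStarCategory C] {J : Type v} :
    (BandedModule.strongFunctor C J : BandedModule.{u} C J ⥤ _).IsEquivalence where

/-! ### The equivalence -/

theorem mainTheorem10 {C : Type u₁} [Category.{v₁} C] [CStarCategory C] [MonoidalCategory C]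
    [TensorCStarCategory C] (J : Type v) :
    ((IsRigidCStar C ∨ Finite J) → ∀ M : BasedModule.{u} C J, M.IsBanded) ∧
    ∃ (Φ : BandedModule.{u} C J ≌ StrongTensorFunctor C (BiHilb J))
      (ρ : ∀ M : BandedModule.{u} C J, Realization M.toBasedModule (Φ.functor.obj M)),
      ∀ (M N : BandedModule.{u} C J) (g : BasedModule.Hom M.toBasedModule N.toBasedModule)
        (U : C) (r s : J) (x : ((Φ.functor.obj M).functor.obj U).comp r s),
        (ρ N).κ U r s (BiHilb.app
            ((Φ.functor.map (X := M) (Y := N) g.toClass).natTrans.app U) r s x) =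
          adj (g.u r) ≫ g.functor.map ((ρ M).κ U r s x) ≫ g.ψ U (M.X s) ≫ U ⊴ₗ g.u s := by
  refine ⟨?_, (BandedModule.strongFunctor C J).asEquivalence, fun M => M.realization,
    fun M N g U r s x => BandedModule.mor_strongMap g U r s x⟩
  rintro (hC | hJ) M
  · exact M.isBanded_of_isRigidCStar hC
  · exact M.isBanded_of_finite
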